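/- Let $a\in u(n)$ be a diagonal matrix, $\langle x,y\rangle=-\mathrm{tr}(xy)$ on $u(n)$, $u(n)_a$ the centralizer of $a$ in $u(n)$, $u(n)_a^\perp$ its orthogonal complement with orthogonal projection $\pi_a^\perp$, and $M$ the adjoint $U(n)$-orbit of $a$. Let $\mathcal S(\mathbb R,u(n)_a^\perp)$ be the space of Schwartz maps into $u(n)_a^\perp$, and $C_a(\mathbb R,M)$ the space of smooth $\gamma:\mathbb R\to M$ with $\gamma(-\infty)=a$ and $\gamma_x$ Schwartz, topologized through $\gamma\mapsto\gamma_x$ by the Schwartz topology. Curves in these spaces are differentiated in these topologies; tangent vectors of $C_a(\mathbb R,M)$ are velocities of curves. Put $$\hat\tau_\gamma(\xi,\eta)=\int_{-\infty}^\infty\langle-\mathrm{ad}(\gamma)^{-1}\xi,\eta\rangle\,dx,\qquad w(v_1,v_2)=\int_{-\infty}^\infty\langle-\mathrm{ad}(a)^{-1}v_1,v_2\rangle\,dx ,$$ where $\mathrm{ad}(y)^{-1}v$ denotes the $z\in u(n)_y^\perp$ with $[y,z]=v$. The Hamiltonian vector field $X_f$ of $f$ for a form $\omega$ is given by $df=\omega(X_f,\cdot)$,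 and its Hamiltonian flow consists of the integral curves of $X_f$. For $u\in\mathcal S(\mathbb R,u(n)_a^\perp)$ let $Q_j(u):\mathbb R\to u(n)$ be the smooth maps determined by $Q_0(u)=a$, $(Q_j(u))_x+[u,Q_j(u)]=[Q_{j+1}(u),a]$ for $j\ge0$ and $Q_j(u)(-\infty)=0$ for $j\ge1$, and let $$F_j(u)=\frac1{j+1}\int_{-\infty}^\infty\mathrm{tr}(Q_{j+2}(u)\,a)\,dx .$$ Let $\Phi:C_a(\mathbb R,M)\to\mathcal S(\mathbb R,u(n)_a^\perp)$ be the development map: $\Phi(\gamma)=g^{-1}g_x$, where $g:\mathbb R\to U(n)$ is determined by $\gamma=gag^{-1}$, $g(-\infty)=I$, $g^{-1}g_x\in u(n)_a^\perp$. Put $H_j=F_j\circ\Phi$. Then $\Phi$ is a well-defined bijection, each sequence $(Q_j(u))_j$ exists and is unique, and for every $j\ge0$ the integral defining $F_j$ converges and, with $u=\Phi(\gamma)$ and $g$ as above: 1. the $L^2$ gradient of $H_j$ at $\gamma$ is $\nabla H_j(\gamma)=g\,\pi_a^\perp(Q_{j+2}(u))\,g^{-1}$, and the unique Hamiltonian vector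 of $H_j$ at $\gamma$ with respect to $\hat\tau$ is $g[Q_{j+2}(u),a]g^{-1}$; 2. the unique Hamiltonian vector of $F_{j+2}$ at any $u\in\mathcal S(\mathbb R,u(n)_a^\perp)$ with respect to $w$ is $[Q_{j+3}(u),a]$, so the Hamiltonian flow of $F_{j+2}$ with respect to $w$ is the $(j+2)$-th flow $u_t=[Q_{j+3}(u),a]$ of the $u(n)$-hierarchy; 3. $d\Phi$ maps the Hamiltonian vector field of $H_j$ with respect to $\hat\tau$ to that of $F_{j+2}$ with respect to $w$; 4. for every time interval $I$, a curve $t\mapsto\gamma(\cdot,t)$ in $C_a(\mathbb R,M)$ is on $I$ an integral curve of the Hamiltonian flow of $H_j$ with respect to $\hat\tau$ if and only if $t\mapsto\Phi(\gamma(\cdot,t))$ is on $I$ an integral curve of the Hamiltonian flow of $F_{j+2}$ with respect to $w$, equivalently a solution of the $(j+2)$-th flow $u_t=[Q_{j+3}(u),a]$. -/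

import Mathlib

open Filter Topology MeasureTheory
open scoped SchwartzMap ContDiff Matrix.Norms.L2Operator

noncomputable section

namespace SchrodingerFlow

/-- Complex `n × n` matrices. They carry the operator norm; since the space is finite dimensional,
nothing below depends on the choice of the norm. -/
abbrev Mat (n : ℕ) : Type := Matrix (Fin n) (Fin n) ℂ

/-! ### Linear algebra in `u(n)` -/

section LinearAlgebra

variable {n : ℕ}

/-- The Lie algebra `u(n)` of skew-Hermitian matrices. -/
def u (n : ℕ) : Submodule ℝ (Mat n) := skewAdjoint.submodule ℝ (Mat n)

/-- The form `<x, y> = -tr (x y)`, which is real valued and positive definite on `u(n)`. -/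
def ip (x y : Mat n) : ℝ := -(Matrix.trace (x * y)).re

/-- The centralizer `u(n)_x` of `x` in `u(n)`. -/
def cent (x : Mat n) : Set (Mat n) := {y | y ∈ u n ∧ ⁅y, x⁆ = 0}

/-- The orthogonal complement `u(n)_x^⊥` of `u(n)_x` in `u(n)`. -/
def perp (x : Mat n) : Set (Mat n) := {y | y ∈ u n ∧ ∀ z ∈ cent x, ip y z = 0}

/-- The adjoint orbit `M` of `a` under `U(n)`. -/
def orbit (a : Mat n) : Set (Mat n) :=
  {y | ∃ g ∈ Matrix.unitaryGroup (Fin n) ℂ, y = g * a * star g}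

open Classical in
/-- `ad(x)⁻¹ v`: the element `y` of `u(n)_x^⊥` with `[x, y] = v` (zero if there is none).
For `x` in `u(n)` there is at most one such `y`, see `adInv_lie`. -/
def adInv (x v : Mat n) : Mat n :=
  if h : ∃ y, y ∈ perp x ∧ ⁅x, y⁆ = v then h.choose else 0

/-- The orthogonal projection of `u(n)` onto `u(n)_a^⊥`, for a diagonal matrix `a`
(see `piPerp_mem` and `sub_piPerp_mem`). -/
def piPerp (a y : Mat n) : Mat n := Matrix.of fun i j => if a i i = a j j then 0 else y i j

theorem mem_u {y : Mat n} : y ∈ u n ↔ star y = -y := Iff.rfl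

theorem lie_diag_apply {a : Mat n} (hd : a.IsDiag) (y : Mat n) (i j : Fin n) :
    ⁅y, a⁆ i j = y i j * (a j j - a i i) := by
  obtain ⟨d, rfl⟩ : ∃ d, a = Matrix.diagonal d := ⟨a.diag, hd.diagonal_diag.symm⟩
  rw [Ring.lie_def, Matrix.sub_apply, Matrix.mul_diagonal, Matrix.diagonal_mul]
  simp
  ring

theorem eq_zero_of_ip_self {y : Mat n} (hy : y ∈ u n) (h : ip y y = 0) : y = 0 := by
  have h1 : (Matrix.trace (star y * y)).re = 0 := by
    rw [mem_u.1 hy]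
    simpa [ip] using h
  have h2 : (Matrix.trace (star y * y)).re = ∑ i, ∑ j, Complex.normSq (y j i) := by
    simp only [Matrix.trace, Matrix.diag, Matrix.mul_apply, Complex.re_sum, Matrix.star_apply]
    refine Finset.sum_congr rfl fun i _ => Finset.sum_congr rfl fun j _ => ?_
    simp [Complex.normSq_apply]
  rw [h2] at h1
  ext j i
  have h3 := (Finset.sum_eq_zero_iff_of_nonneg
    (fun i _ => Finset.sum_nonneg fun j _ => Complex.normSq_nonneg (y j i))).1 h1 i
    (Finset.mem_univ _)
  have h4 := (Finset.sum_eq_zero_iff_of_nonneg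
    (fun j _ => Complex.normSq_nonneg (y j i))).1 h3 j (Finset.mem_univ _)
  simpa using Complex.normSq_eq_zero.1 h4

theorem adInv_lie {x y : Mat n} (hy : y ∈ perp x) : adInv x ⁅x, y⁆ = y := by
  have h : ∃ z, z ∈ perp x ∧ ⁅x, z⁆ = ⁅x, y⁆ := ⟨y, hy, rfl⟩
  have hs := h.choose_spec
  rw [adInv, dif_pos h]
  set z := h.choose with hz
  obtain ⟨⟨hzu, hzp⟩, hz2⟩ := hs
  have hu : z - y ∈ u n := (u n).sub_mem hzu hy.1
  have hc : z - y ∈ cent x := by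
    refine ⟨hu, ?_⟩
    have : ⁅x, z⁆ - ⁅x, y⁆ = 0 := sub_eq_zero.2 hz2
    simp only [Ring.lie_def] at this ⊢
    rw [← neg_eq_zero, ← this]
    noncomm_ring
  have h1 := hzp _ hc
  have h2 := hy.2 _ hc
  have h3 : ip (z - y) (z - y) = 0 := by
    have : ip (z - y) (z - y) = ip z (z - y) - ip y (z - y) := by
      simp only [ip, sub_mul, Matrix.trace_sub, Complex.sub_re]
      ring
    rw [this, h1, h2, sub_zero]
  exact sub_eq_zero.1 (eq_zero_of_ip_self hu h3)

theorem piPerp_mem_u {a : Mat n} {y : Mat n} (hy : y ∈ u n) : piPerp a y ∈ u n := by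
  rw [mem_u] at hy ⊢
  ext i j
  have h := congrFun (congrFun hy i) j
  simp only [Matrix.star_apply, Matrix.neg_apply] at h
  by_cases hij : a i i = a j j
  · simp [piPerp, hij]
  · simp [piPerp, hij, Ne.symm hij, h]

theorem sub_piPerp_mem {a : Mat n} (hd : a.IsDiag) {y : Mat n} (hy : y ∈ u n) :
    y - piPerp a y ∈ cent a := by
  refine ⟨(u n).sub_mem hy (piPerp_mem_u hy), ?_⟩
  ext i j
  rw [lie_diag_apply hd]
  by_cases hij : a i i = a j j
  · simp [hij]
  · simp [piPerp, hij]

theorem piPerp_mem {a : Mat n} (hd : a.IsDiag) {y : Mat n} (hy : y ∈ u n) :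
    piPerp a y ∈ perp a := by
  refine ⟨piPerp_mem_u hy, fun z hz => ?_⟩
  have h0 : Matrix.trace (piPerp a y * z) = 0 := by
    simp only [Matrix.trace, Matrix.diag, Matrix.mul_apply]
    refine Finset.sum_eq_zero fun i _ => Finset.sum_eq_zero fun j _ => ?_
    have h := congrFun (congrFun hz.2 j) i
    rw [lie_diag_apply hd] at h
    by_cases hij : a i i = a j j
    · simp [piPerp, hij]
    · have : z j i = 0 := by
        rcases mul_eq_zero.1 h with h | h
        · exact h
        · exact absurd (sub_eq_zero.1 h) hij
      simp [this]
  simp [ip, h0]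

end LinearAlgebra

/-! ### The two phase spaces -/

/-- `S(R, u(n)_a^⊥)`: Schwartz maps with values in `u(n)_a^⊥`, with the (subspace) topology of the
Schwartz space. -/
def S {n : ℕ} (a : Mat n) : Submodule ℝ 𝓢(ℝ, Mat n) where
  carrier := {v | ∀ x, v x ∈ perp a}
  zero_mem' x := ⟨(u n).zero_mem, fun z _ => by simp [ip]⟩
  add_mem' {v w} hv hw x := by
    refine ⟨(u n).add_mem (hv x).1 (hw x).1, fun z hz => ?_⟩
    have h1 := (hv x).2 z hz
    have h2 := (hw x).2 z hz
    simp only [ip, add_apply, add_mul, Matrix.trace_add, Complex.add_re] at *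
    linarith
  smul_mem' r v hv x := by
    refine ⟨(u n).smul_mem r (hv x).1, fun z hz => ?_⟩
    have h1 := (hv x).2 z hz
    simp only [ip, smul_apply, smul_mul_assoc, Matrix.trace_smul, Complex.smul_re,
      smul_eq_mul] at *
    rw [← mul_neg, h1, mul_zero]

/-- `C_a(R, M)`: paths `γ : R → M` in the orbit of `a` with `γ(-∞) = a` whose derivative `γ_x` is a
Schwartz map (so `γ` is smooth). The field `vel` is the derivative, hence determined by `toFun`. -/
structure Path {n : ℕ} (a : Mat n) where
  toFun : ℝ → Mat n
  vel : 𝓢(ℝ, Mat n)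
  hasDerivAt : ∀ x, HasDerivAt toFun (vel x) x
  mem : ∀ x, toFun x ∈ orbit a
  tendsto : Tendsto toFun atBot (𝓝 a)

instance {n : ℕ} (a : Mat n) : CoeFun (Path a) (fun _ => ℝ → Mat n) := ⟨Path.toFun⟩

section Flows

variable {n : ℕ} {a : Mat n}

/-- The curve `c` in a topological vector space has derivative `v` at time `t`, relative to the
set `I` of times: the difference quotients converge to `v`. -/
def HasCurveDeriv {E : Type*} [AddCommGroup E] [Module ℝ E] [TopologicalSpace E]
    (c : ℝ → E) (v : E) (I : Set ℝ) (t : ℝ) : Prop :=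
  Tendsto (fun s => (s - t)⁻¹ • (c s - c t)) (𝓝[I \ {t}] t) (𝓝 v)

/-- The curve `c` of paths in `C_a(R, M)` has velocity `ξ` (a matrix field along the path `c t`) at
time `t`. The topology on `C_a(R, M)` is the one given by the Schwartz topology on `γ_x`; as
`γ(-∞) = a` is fixed, `ξ` is determined by `ξ_x` and `ξ(-∞) = 0`. -/
def HasVelocity (c : ℝ → Path a) (ξ : ℝ → Mat n) (I : Set ℝ) (t : ℝ) : Prop :=
  ∃ η : 𝓢(ℝ, Mat n), (∀ x, HasDerivAt ξ (η x) x) ∧ Tendsto ξ atBot (𝓝 0) ∧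
    HasCurveDeriv (fun s => (c s).vel) η I t

/-- `ξ` is a tangent vector of `C_a(R, M)` at `γ`: the velocity of a curve through `γ`. -/
def IsTangent (γ : Path a) (ξ : ℝ → Mat n) : Prop :=
  ∃ c : ℝ → Path a, c 0 = γ ∧ HasVelocity c ξ Set.univ 0

/-- The integrand `<-ad(γ)⁻¹(ξ), η>` of the form induced by the orbit symplectic form of `M`. -/
def tauDensity (γ : Path a) (ξ η : ℝ → Mat n) (x : ℝ) : ℝ :=
  ip (-(adInv (γ x) (ξ x))) (η x)

/-- The orbit symplectic form `τ̂` on `C_a(R, M)`. -/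
def tau (γ : Path a) (ξ η : ℝ → Mat n) : ℝ := ∫ x, tauDensity γ ξ η x

/-- The symplectic form `w` on `S(R, u(n)_a^⊥)`. -/
def w (v₁ v₂ : S a) : ℝ := ∫ x, ip (-(adInv a (v₁.1 x))) (v₂.1 x)

/-- `G` is the `L²` gradient of `H` at `γ`: a tangent vector with `dH_γ(η) = ∫ <G, η> dx` for all
tangent vectors `η`. -/
def IsGradient (H : Path a → ℝ) (γ : Path a) (G : ℝ → Mat n) : Prop :=
  IsTangent γ G ∧ ∀ (c : ℝ → Path a) (η : ℝ → Mat n), c 0 = γ → HasVelocity c η Set.univ 0 →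
    Integrable (fun x => ip (G x) (η x)) ∧
      HasDerivAt (fun s => H (c s)) (∫ x, ip (G x) (η x)) 0

/-- `X` is the Hamiltonian vector of `H` at `γ` for `τ̂`: a tangent vector with
`dH_γ(η) = τ̂_γ(X, η)` for all tangent vectors `η`. -/
def IsHamTau (H : Path a → ℝ) (γ : Path a) (X : ℝ → Mat n) : Prop :=
  IsTangent γ X ∧ ∀ (c : ℝ → Path a) (η : ℝ → Mat n), c 0 = γ → HasVelocity c η Set.univ 0 →
    Integrable (tauDensity γ X η) ∧ HasDerivAt (fun s => H (c s)) (tau γ X η) 0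

/-- `X` is the Hamiltonian vector of `F` at `q` for `w`: `dF_q(v) = w(X, v)` for all `v`. -/
def IsHamW (F : S a → ℝ) (q : S a) (X : S a) : Prop :=
  ∀ (c : ℝ → S a) (v : S a), c 0 = q → HasCurveDeriv c v Set.univ 0 →
    HasDerivAt (fun s => F (c s)) (w X v) 0

/-- `c` is, on the time set `I`, an integral curve of the Hamiltonian flow of `H` for `τ̂`. -/
def IsFlowTau (H : Path a → ℝ) (c : ℝ → Path a) (I : Set ℝ) : Prop :=
  ∀ t ∈ I, ∃ X, IsHamTau H (c t) X ∧ HasVelocity c X I t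

/-- `c` is, on the time set `I`, an integral curve of the Hamiltonian flow of `F` for `w`. -/
def IsFlowW (F : S a → ℝ) (c : ℝ → S a) (I : Set ℝ) : Prop :=
  ∀ t ∈ I, ∃ X, IsHamW F (c t) X ∧ HasCurveDeriv c X I t

end Flows

/-! ### The `u(n)`-hierarchy -/

section Hierarchy

variable {n : ℕ} (a : Mat n)

/-- The recursion `(Q_j)_x + [q, Q_j] = [Q_{j+1}, a]`, `Q_0 = a`, `Q_j(-∞) = 0` for `j ≥ 1`, for
smooth maps `Q_j : R → u(n)`. -/
structure IsQSeq (q : S a) (Q : ℕ → ℝ → Mat n) : Prop where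
  smooth : ∀ j, ContDiff ℝ ∞ (Q j)
  mem : ∀ j x, Q j x ∈ u n
  zero : ∀ x, Q 0 x = a
  succ : ∀ j x, deriv (Q j) x + ⁅q.1 x, Q j x⁆ = ⁅Q (j + 1) x, a⁆
  tendsto : ∀ j, 1 ≤ j → Tendsto (Q j) atBot (𝓝 0)

open Classical in
/-- The sequence `Q_j(q)` determined by the recursion. -/
def Q (q : S a) : ℕ → ℝ → Mat n := if h : ∃ Q, IsQSeq a q Q then h.choose else 0

/-- The Hamiltonian `F_j(q) = -(1/(j+1)) ∫ <Q_{j+2}(q), a> dx = (1/(j+1)) ∫ tr (Q_{j+2}(q) a) dx`. -/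
def F (j : ℕ) (q : S a) : ℝ := -(1 / ((j : ℝ) + 1)) * ∫ x, ip (Q a q (j + 2) x) a

/-- `c` is, on the time set `I`, a solution of the `m`-th flow `q_t = [Q_{m+1}(q), a]` of the
`u(n)`-hierarchy. -/
def IsHierarchyFlow (m : ℕ) (c : ℝ → S a) (I : Set ℝ) : Prop :=
  ∀ t ∈ I, ∃ Y : S a, (∀ x, Y.1 x = ⁅Q a (c t) (m + 1) x, a⁆) ∧ HasCurveDeriv c Y I t

/-- `g : R → U(n)` solves `g⁻¹ g_x = q`, `g(-∞) = I`, and `γ = g a g⁻¹`. -/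
structure IsFrame (γ : Path a) (q : S a) (g : ℝ → Mat n) : Prop where
  unitary : ∀ x, g x ∈ Matrix.unitaryGroup (Fin n) ℂ
  hasDerivAt : ∀ x, HasDerivAt g (g x * q.1 x) x
  tendsto : Tendsto g atBot (𝓝 1)
  eq : ∀ x, γ x = g x * a * star (g x)

open Classical in
/-- The development map `Φ : C_a(R, M) → S(R, u(n)_a^⊥)`: `Φ(γ) = g⁻¹ g_x` where `γ = g a g⁻¹`,
`g(-∞) = I` and `g⁻¹ g_x` takes values in `u(n)_a^⊥`. -/
def Phi (γ : Path a) : S a := if h : ∃ q : S a, ∃ g, IsFrame a γ q g then h.choose else 0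

/-- `H_j = F_j ∘ Φ`. -/
def H (j : ℕ) (γ : Path a) : ℝ := F a j (Phi a γ)

end Hierarchy

end SchrodingerFlow

end

/-! Call the entries `(i, j)` with `a i i = a j j` the block part of a matrix and the others its
off-diagonal part; for skew-Hermitian matrices these are the components in `u(n)_a` and `u(n)_a^⊥`.

Everything rests on linearizing the development map. If `q = Φ(γ)` varies with velocity `v` and `ζ`
solves `ζ_x + [q, ζ] = v`, `ζ(-∞) = 0`, then `γ = g a g⁻¹` varies with velocity `g [ζ, a] g⁻¹`
(`hasVelocity_of_hasCurveDeriv`), and every velocity has this form (`HasVelocity.exists_gauge`). On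
the flat side `dF_j(v) = ∫ <Q_{j+1}, v>` (`hasDerivAt_F`). Inserting `v = ζ_x + [q, ζ]`, integrating
by parts and using the recursion once gives `dH_j = ∫ <Q_{j+2}, [ζ, a]>` (`integral_ip_gauge`), from
which the gradient and, by invariance of the form, the Hamiltonian vector `g [Q_{j+2}, a] g⁻¹` are
read off. Finally `ζ = Q_{j+2}` itself solves the linearized equation for `v = [Q_{j+3}, a]`
(`isGauge_qS`), which is the Hamiltonian vector of `F_{j+2}`; so `dΦ` matches the two fields and the
flows correspond (`hasVelocity_iff`).

Algebra. Read naively, the recursion yields the block part of `Q_j` only after an integration.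
Instead, for each eigenvalue of `a` with spectral projection `e`, a formal projection `P = e + ∑ P_j
λ^{-j}` commuting with `∂ + q + λ a` is built: `P² = P` fixes the block parts algebraically, so
`P_j` is a differential polynomial in `q`, hence Schwartz (`pC_spec`), and `Q` is the sum of the `P`
weighted by eigenvalues. For the variation of `F_j`, let `N = -λ ∂_λ P` and let `d` be the variation
of `P`; the `x`-derivative of `tr (P [N, d])` has coefficients `-tr (d_{j+1} a) - j tr (P_j v)`, and
integrating gives `dF_j` (`trace_variation`, `integral_trace_variation`).

Analysis. Frames and the fields `ζ` are not Schwartz; they have a limit at `-∞` and a Schwartz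
derivative, and multiplication by such maps is jointly continuous on Schwartz maps
(`continuous_bmap`). The spectral projections of `γ` are polynomials in `γ`, so Kato's generator `σ
= ∑ P_μ' P_μ` depends differentiably on `γ`, and `q = g⁻¹ σ g` with `g_x = σ g` (`exists_frame`).
Frames at two times are compared through their quotient, which solves a linear equation whose
coefficient vanishes at the base time; unitarity supplies the seminorm bounds
(`hasCurveDeriv_unitary`). -/

noncomputable section

namespace SchrodingerFlow

/-! ### Differentiable curves in topological vector spaces -/

section CurveDeriv

variable {E F G : Type*} [AddCommGroup E] [Module ℝ E] [TopologicalSpace E]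
  [AddCommGroup F] [Module ℝ F] [TopologicalSpace F] [AddCommGroup G] [Module ℝ G]
  [TopologicalSpace G] {I : Set ℝ} {t : ℝ}

theorem HasCurveDeriv.clm {c : ℝ → E} {v : E} (h : HasCurveDeriv c v I t) (L : E →L[ℝ] F) :
    HasCurveDeriv (fun s => L (c s)) (L v) I t := by
  refine ((L.continuous.tendsto v).comp h).congr fun s => ?_
  simp

theorem hasCurveDeriv_const (x : E) : HasCurveDeriv (fun _ => x) 0 I t := by
  unfold HasCurveDeriv
  simp only [sub_self, smul_zero]
  exact tendsto_const_nhds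

theorem HasCurveDeriv.add [ContinuousAdd E] {c d : ℝ → E} {v w : E} (h : HasCurveDeriv c v I t)
    (h' : HasCurveDeriv d w I t) : HasCurveDeriv (fun s => c s + d s) (v + w) I t := by
  refine (Tendsto.add h h').congr fun s => ?_
  rw [← smul_add, add_sub_add_comm]

theorem HasCurveDeriv.sum [ContinuousAdd E] {ι : Type*} (s : Finset ι) {c : ι → ℝ → E} {v : ι → E}
    (h : ∀ i ∈ s, HasCurveDeriv (c i) (v i) I t) :
    HasCurveDeriv (fun r => ∑ i ∈ s, c i r) (∑ i ∈ s, v i) I t := by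
  classical
  induction s using Finset.induction_on with
  | empty => simpa using hasCurveDeriv_const (0 : E)
  | insert i s hi ih =>
    simp only [Finset.sum_insert hi]
    exact (h i (by simp)).add (ih fun j hj => h j (by simp [hj]))

theorem HasCurveDeriv.prodMk {c : ℝ → E} {d : ℝ → F} {v : E} {w : F} (h : HasCurveDeriv c v I t)
    (h' : HasCurveDeriv d w I t) : HasCurveDeriv (fun s => (c s, d s)) (v, w) I t :=
  (Filter.Tendsto.prodMk_nhds h h').congr fun s => by simp

theorem HasCurveDeriv.congr {c d : ℝ → E} {v : E} (h : HasCurveDeriv c v I t)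
    (hcd : ∀ s, c s = d s) : HasCurveDeriv d v I t := by
  rwa [show d = c from funext fun s => (hcd s).symm]

theorem HasCurveDeriv.tendsto [ContinuousAdd E] [ContinuousSMul ℝ E] {c : ℝ → E} {v : E}
    (h : HasCurveDeriv c v I t) : Tendsto c (𝓝[I \ {t}] t) (𝓝 (c t)) := by
  have h1 : Tendsto (fun s : ℝ => s - t) (𝓝[I \ {t}] t) (𝓝 0) :=
    ((continuous_id.sub continuous_const).tendsto' t 0 (by simp)).mono_left nhdsWithin_le_nhds
  have h2 := (h1.smul h).const_add (c t)
  rw [zero_smul, add_zero] at h2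
  refine h2.congr' ?_
  filter_upwards [self_mem_nhdsWithin] with s hs
  rw [smul_smul, mul_inv_cancel₀ (sub_ne_zero.2 hs.2), one_smul, add_sub_cancel]

theorem HasCurveDeriv.unique [T2Space E] [(𝓝[I \ {t}] t).NeBot] {c : ℝ → E} {v w : E}
    (h : HasCurveDeriv c v I t) (h' : HasCurveDeriv c w I t) : v = w :=
  tendsto_nhds_unique h h'

/-- The difference quotient splits as `μ` of the quotient of `c` with `d s`, plus `μ` of `c t` with
the quotient of `d`. Joint continuity of `μ` suffices, so the rule applies to Schwartz space, where
no norm is available. -/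
theorem HasCurveDeriv.bilin [ContinuousAdd E] [ContinuousSMul ℝ E] [ContinuousAdd F]
    [ContinuousSMul ℝ F] [ContinuousAdd G] (μ : E →ₗ[ℝ] F →ₗ[ℝ] G)
    (hμ : Continuous fun p : E × F => μ p.1 p.2) {c : ℝ → E} {d : ℝ → F} {v : E} {w : F}
    (h : HasCurveDeriv c v I t) (h' : HasCurveDeriv d w I t) :
    HasCurveDeriv (fun s => μ (c s) (d s)) (μ v (d t) + μ (c t) w) I t := by
  have h1 := (hμ.tendsto (v, d t)).comp (Filter.Tendsto.prodMk_nhds h h'.tendsto)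
  have h2 := (hμ.tendsto (c t, w)).comp
    (Filter.Tendsto.prodMk_nhds (tendsto_const_nhds (x := c t)) h')
  refine (h1.add h2).congr fun s => ?_
  simp [smul_sub]

theorem hasCurveDeriv_line [ContinuousAdd E] (x v : E) :
    HasCurveDeriv (fun s : ℝ => x + s • v) v Set.univ 0 := by
  refine tendsto_const_nhds.congr' ?_
  filter_upwards [self_mem_nhdsWithin] with s hs
  have : s ≠ 0 := hs.2
  simp [smul_smul, this]

theorem HasCurveDeriv.hasDerivAt {E : Type*} [NormedAddCommGroup E] [NormedSpace ℝ E] {c : ℝ → E}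
    {v : E} (h : HasCurveDeriv c v Set.univ t) : HasDerivAt c v t := by
  rw [hasDerivAt_iff_tendsto_slope]
  have h1 : (Set.univ \ {t} : Set ℝ) = {t}ᶜ := by ext; simp
  rw [HasCurveDeriv, h1] at h
  exact h

instance neBot_univ : (𝓝[(Set.univ : Set ℝ) \ {t}] t).NeBot := by
  have h1 : (Set.univ \ {t} : Set ℝ) = {t}ᶜ := by ext; simp
  rw [h1]
  infer_instance

end CurveDeriv

/-! ### Seminorms of Schwartz maps on the line -/

section Seminorms

variable {V : Type*} [NormedAddCommGroup V] [NormedSpace ℝ V]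

/-- Lets every seminorm estimate be proved by induction on the number of derivatives, from order
zero and a Leibniz rule. -/
theorem seminorm_succ (k m : ℕ) (f : 𝓢(ℝ, V)) :
    SchwartzMap.seminorm ℝ k (m + 1) f =
      SchwartzMap.seminorm ℝ k m (SchwartzMap.derivCLM ℝ V f) := by
  have h : ∀ x, iteratedDeriv m (SchwartzMap.derivCLM ℝ V f) x = iteratedDeriv (m + 1) f x := by
    intro x
    rw [iteratedDeriv_succ']
    rfl
  refine le_antisymm ?_ ?_
  · refine SchwartzMap.seminorm_le_bound' ℝ k _ f (apply_nonneg _ _) fun x => ?_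
    rw [← h]
    exact SchwartzMap.le_seminorm' ℝ k m _ x
  · refine SchwartzMap.seminorm_le_bound' ℝ k _ _ (apply_nonneg _ _) fun x => ?_
    rw [h]
    exact SchwartzMap.le_seminorm' ℝ k _ _ x

theorem seminorm_zero_le_of_norm_le (k : ℕ) {f g : 𝓢(ℝ, V)} {C : ℝ} (hC : 0 ≤ C)
    (h : ∀ x, ‖f x‖ ≤ C * ‖g x‖) :
    SchwartzMap.seminorm ℝ k 0 f ≤ C * SchwartzMap.seminorm ℝ k 0 g := by
  refine SchwartzMap.seminorm_le_bound' ℝ k _ f (mul_nonneg hC (apply_nonneg _ _)) fun x => ?_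
  have h1 := SchwartzMap.le_seminorm' ℝ k 0 g x
  simp only [iteratedDeriv_zero] at h1 ⊢
  calc |x| ^ k * ‖f x‖ ≤ |x| ^ k * (C * ‖g x‖) := by gcongr; exact h x
    _ = C * (|x| ^ k * ‖g x‖) := by ring
    _ ≤ _ := by gcongr

theorem tendsto_zero_iff_seminorm {ι : Type*} {l : Filter ι} {f : ι → 𝓢(ℝ, V)} :
    Tendsto f l (𝓝 0) ↔
      ∀ m k, Tendsto (fun s => SchwartzMap.seminorm ℝ k m (f s)) l (𝓝 0) := by
  constructor
  · intro h m k
    have h1 := ((schwartz_withSeminorms ℝ ℝ V).continuous_seminorm (k, m)).tendsto 0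
    rw [map_zero] at h1
    exact h1.comp h
  · intro h
    rw [(schwartz_withSeminorms ℝ ℝ V).tendsto_nhds]
    rintro ⟨k, m⟩ ε hε
    simp only [sub_zero]
    exact (h m k).eventually_lt_const hε

/-- The `L¹` norm is dominated by two Schwartz seminorms times the integral of an integrable power
weight. -/
theorem tendsto_integral_norm_zero {ι : Type*} {l : Filter ι} {f : ι → 𝓢(ℝ, V)}
    (h : Tendsto f l (𝓝 0)) : Tendsto (fun s => ∫ x, ‖f s x‖) l (𝓝 0) := by
  rw [tendsto_zero_iff_seminorm] at h
  have h1 := ((h 0 0).add (h 0 (0 + (volume : Measure ℝ).integrablePower))).const_mul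
    (2 ^ (volume : Measure ℝ).integrablePower *
      (∫ x : ℝ, (1 + ‖x‖) ^ (- ((volume : Measure ℝ).integrablePower : ℝ))))
  rw [add_zero, mul_zero] at h1
  refine squeeze_zero (fun s => integral_nonneg fun x => norm_nonneg _) (fun s => ?_) h1
  have := SchwartzMap.integral_pow_mul_iteratedFDeriv_le ℝ (volume : Measure ℝ) (f s) 0 0
  simpa using this

end Seminorms

/-! ### Maps with Schwartz derivative and a limit at `-∞` -/

section Bounded

variable {n : ℕ}

theorem hasDerivAt_integral_Iic {V : Type*} [NormedAddCommGroup V] [NormedSpace ℝ V]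
    [CompleteSpace V] {f : ℝ → V} (hc : Continuous f) (hf : Integrable f) (x : ℝ) :
    HasDerivAt (fun x => ∫ y in Set.Iic x, f y) (f x) x := by
  have h1 : (fun x => ∫ y in Set.Iic x, f y) =
      fun x => (∫ y in Set.Iic (0 : ℝ), f y) + ∫ y in (0 : ℝ)..x, f y := by
    funext x
    rw [← intervalIntegral.integral_Iic_sub_Iic hf.integrableOn hf.integrableOn]
    abel
  rw [h1]
  exact (intervalIntegral.integral_hasDerivAt_right (hc.intervalIntegrable _ _)
    hc.stronglyMeasurable.stronglyMeasurableAtFilter hc.continuousAt).const_add _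

/-- Two maps with the same derivative and the same limit at `-∞` agree. -/
theorem eq_of_hasDerivAt_of_tendsto {V : Type*} [NormedAddCommGroup V] [NormedSpace ℝ V]
    {f g f' : ℝ → V} {c : V} (hf : ∀ x, HasDerivAt f (f' x) x) (hg : ∀ x, HasDerivAt g (f' x) x)
    (hfc : Tendsto f atBot (𝓝 c)) (hgc : Tendsto g atBot (𝓝 c)) : f = g := by
  have h0 : ∀ x, HasDerivAt (f - g) 0 x := fun x => by simpa using (hf x).sub (hg x)
  have h1 : ∀ x y, (f - g) x = (f - g) y := is_const_of_deriv_eq_zero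
    (fun x => (h0 x).differentiableAt) fun x => (h0 x).deriv
  funext x
  have h2 : Tendsto (f - g) atBot (𝓝 ((f - g) x)) :=
    tendsto_const_nhds.congr fun y => h1 x y
  have h3 : Tendsto (f - g) atBot (𝓝 0) := by
    have := hfc.sub hgc
    rwa [sub_self] at this
  exact sub_eq_zero.1 (tendsto_nhds_unique h2 h3)

instance : CompleteSpace (Mat n) := FiniteDimensional.complete ℝ (Mat n)

/-- The derivative of Schwartz maps. -/
abbrev D (n : ℕ) : 𝓢(ℝ, Mat n) →L[ℝ] 𝓢(ℝ, Mat n) := SchwartzMap.derivCLM ℝ (Mat n)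

theorem hasDerivAt_D (f : 𝓢(ℝ, Mat n)) (x : ℝ) : HasDerivAt f (D n f x) x := f.hasDerivAt x

/-- Maps `ℝ → Mat n` with Schwartz derivative and a limit at `-∞`, given by this limit and the
derivative. -/
abbrev Bd (n : ℕ) : Type := Mat n × 𝓢(ℝ, Mat n)

/-- The map with limit `b.1` at `-∞` and derivative `b.2`. -/
def ev (b : Bd n) (x : ℝ) : Mat n := b.1 + ∫ y in Set.Iic x, b.2 y

theorem hasDerivAt_ev (b : Bd n) (x : ℝ) : HasDerivAt (ev b) (b.2 x) x :=
  (hasDerivAt_integral_Iic b.2.continuous b.2.integrable x).const_add _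

theorem tendsto_ev (b : Bd n) : Tendsto (ev b) atBot (𝓝 b.1) := by
  have := (tendsto_integral_Iic_zero (f := b.2) (μ := volume) tendsto_id).const_add b.1
  rwa [add_zero] at this

theorem ev_eq {f : ℝ → Mat n} {b : Bd n} (hf : ∀ x, HasDerivAt f (b.2 x) x)
    (hfc : Tendsto f atBot (𝓝 b.1)) : ev b = f :=
  eq_of_hasDerivAt_of_tendsto (hasDerivAt_ev b) hf (tendsto_ev b) hfc

theorem ev_injective : Function.Injective (ev (n := n)) := by
  intro b b' h
  refine Prod.ext (tendsto_nhds_unique (tendsto_ev b) (h ▸ tendsto_ev b')) ?_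
  ext1 x
  exact (hasDerivAt_ev b x).unique (h ▸ hasDerivAt_ev b' x)

theorem ev_add (b b' : Bd n) (x : ℝ) : ev (b + b') x = ev b x + ev b' x := by
  have : ev (b + b') = fun x => ev b x + ev b' x := ev_eq
    (fun x => (hasDerivAt_ev b x).add (hasDerivAt_ev b' x)) ((tendsto_ev b).add (tendsto_ev b'))
  rw [this]

theorem ev_smul (r : ℝ) (b : Bd n) (x : ℝ) : ev (r • b) x = r • ev b x := by
  have : ev (r • b) = fun x => r • ev b x := ev_eq
    (fun x => (hasDerivAt_ev b x).const_smul r) ((tendsto_ev b).const_smul r)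
  rw [this]

theorem norm_ev_le (b : Bd n) (x : ℝ) : ‖ev b x‖ ≤ ‖b.1‖ + ∫ y, ‖b.2 y‖ := by
  refine (norm_add_le _ _).trans (add_le_add le_rfl ((norm_integral_le_integral_norm _).trans ?_))
  exact setIntegral_le_integral b.2.integrable.norm (ae_of_all _ fun y => norm_nonneg _)

/-- The map is bounded and its derivative is Schwartz; this makes it an admissible multiplier of
Schwartz maps. -/
theorem hasTemperateGrowth_ev (b : Bd n) : (ev b).HasTemperateGrowth := by
  refine Function.HasTemperateGrowth.of_fderiv (k := 0) (C := ‖b.1‖ + ∫ y, ‖b.2 y‖) ?_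
    (fun x => (hasDerivAt_ev b x).differentiableAt) fun x => by simpa using norm_ev_le b x
  have h1 : fderiv ℝ (ev b) = fun x =>
      ContinuousLinearMap.smulRightL ℝ ℝ (Mat n) (ContinuousLinearMap.id ℝ ℝ) (b.2 x) := by
    funext x
    ext
    simp [(hasDerivAt_ev b x).hasFDerivAt.fderiv]
  rw [h1]
  exact (ContinuousLinearMap.hasTemperateGrowth _).comp b.2.hasTemperateGrowth

/-- A Schwartz map as a map with Schwartz derivative. -/
def toBd (n : ℕ) : 𝓢(ℝ, Mat n) →L[ℝ] Bd n := (0 : _ →L[ℝ] _).prod (D n)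

theorem tendsto_schwartz_atBot (f : 𝓢(ℝ, Mat n)) : Tendsto f atBot (𝓝 0) :=
  f.tendsto_cocompact.mono_left atBot_le_cocompact

theorem tendsto_schwartz_atTop (f : 𝓢(ℝ, Mat n)) : Tendsto f atTop (𝓝 0) :=
  f.tendsto_cocompact.mono_left atTop_le_cocompact

theorem ev_toBd (f : 𝓢(ℝ, Mat n)) (x : ℝ) : ev (toBd n f) x = f x := by
  have : ev (toBd n f) = f := ev_eq (hasDerivAt_D f) (tendsto_schwartz_atBot f)
  rw [this]

/-- The Schwartz map `x ↦ B (b x) (φ x)`. -/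
def bmap (B : Mat n →L[ℝ] Mat n →L[ℝ] Mat n) : Bd n →ₗ[ℝ] 𝓢(ℝ, Mat n) →ₗ[ℝ] 𝓢(ℝ, Mat n) :=
  LinearMap.mk₂ ℝ (fun b φ => SchwartzMap.bilinLeftCLM B.flip (hasTemperateGrowth_ev b) φ)
    (fun b b' φ => by ext1 x; simp [ev_add]) (fun r b φ => by ext1 x; simp [ev_smul])
    (fun b φ ψ => by simp) (fun r b φ => by simp)

theorem bmap_apply (B : Mat n →L[ℝ] Mat n →L[ℝ] Mat n) (b : Bd n) (φ : 𝓢(ℝ, Mat n)) (x : ℝ) :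
    bmap B b φ x = B (ev b x) (φ x) := rfl

/-- Leibniz rule in a form that reproduces itself: the derivative of the multiplier, being Schwartz,
re-enters as a multiplier with limit zero. -/
theorem D_bmap (B : Mat n →L[ℝ] Mat n →L[ℝ] Mat n) (b : Bd n) (φ : 𝓢(ℝ, Mat n)) :
    D n (bmap B b φ) = bmap B (toBd n b.2) φ + bmap B b (D n φ) := by
  ext1 x
  have h2 := B.hasDerivAt_of_bilinear (fun _ => hasDerivAt_ev b x) (fun _ => hasDerivAt_D φ x)
  have h3 := hasDerivAt_D (bmap B b φ) x
  rw [h3.unique h2, add_comm]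
  simp only [add_apply, bmap_apply, ev_toBd]

theorem norm_bmap_le (B : Mat n →L[ℝ] Mat n →L[ℝ] Mat n) (b : Bd n) (φ : 𝓢(ℝ, Mat n)) (k : ℕ) :
    SchwartzMap.seminorm ℝ k 0 (bmap B b φ) ≤
      ‖B‖ * (‖b.1‖ + ∫ y, ‖b.2 y‖) * SchwartzMap.seminorm ℝ k 0 φ := by
  have h0 : 0 ≤ ‖b.1‖ + ∫ y, ‖b.2 y‖ :=
    add_nonneg (norm_nonneg _) (integral_nonneg fun _ => norm_nonneg _)
  refine seminorm_zero_le_of_norm_le k (by positivity) fun x => ?_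
  rw [bmap_apply]
  refine (B.le_opNorm₂ _ _).trans ?_
  gcongr
  exact norm_ev_le b x

section Limits

variable {ι : Type*} {l : Filter ι}

theorem tendsto_seminorm_D_add {f g h : ι → 𝓢(ℝ, Mat n)} {m : ℕ}
    (hf : ∀ s, D n (f s) = g s + h s)
    (hg : ∀ k, Tendsto (fun s => SchwartzMap.seminorm ℝ k m (g s)) l (𝓝 0))
    (hh : ∀ k, Tendsto (fun s => SchwartzMap.seminorm ℝ k m (h s)) l (𝓝 0)) (k : ℕ) :
    Tendsto (fun s => SchwartzMap.seminorm ℝ k (m + 1) (f s)) l (𝓝 0) := by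
  refine squeeze_zero (fun s => apply_nonneg _ _) (fun s => ?_) (by simpa using (hg k).add (hh k))
  rw [seminorm_succ, hf]
  exact map_add_le_add _ _ _

theorem tendsto_bound_ev {b : ι → Bd n} {b₀ : Bd n} (hb : Tendsto b l (𝓝 b₀)) :
    ∃ C, ∀ᶠ s in l, ‖(b s).1‖ + ∫ y, ‖(b s).2 y‖ ≤ C := by
  have h1 : Tendsto (fun s => ‖(b s).1‖) l (𝓝 ‖b₀.1‖) :=
    ((continuous_fst.norm).tendsto b₀).comp hb
  have h2 : Tendsto (fun s => (b s).2 - b₀.2) l (𝓝 0) := by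
    simpa using (((continuous_snd.tendsto b₀).comp hb).sub_const b₀.2)
  have h3 := (h1.add (tendsto_integral_norm_zero h2)).add_const (∫ y, ‖b₀.2 y‖)
  obtain ⟨C, hC⟩ := h3.isBoundedUnder_le
  refine ⟨C, (eventually_map.1 hC).mono fun s hs => le_trans ?_ hs⟩
  rw [add_assoc]
  refine add_le_add le_rfl ?_
  rw [← integral_add ((b s).2 - b₀.2).integrable.norm b₀.2.integrable.norm]
  refine integral_mono (b s).2.integrable.norm
    (((b s).2 - b₀.2).integrable.norm.add b₀.2.integrable.norm) fun y => ?_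
  simpa using norm_add_le ((b s).2 y - b₀.2 y) (b₀.2 y)

/-- At order zero the sup norms of the multipliers are eventually bounded because they converge. The
induction step changes both factors by `D_bmap`, hence the quantification over all convergent
families. -/
theorem tendsto_bmap_of_right (B : Mat n →L[ℝ] Mat n →L[ℝ] Mat n) (m : ℕ) :
    ∀ {b : ι → Bd n} {b₀ : Bd n} {φ : ι → 𝓢(ℝ, Mat n)}, Tendsto b l (𝓝 b₀) →
      Tendsto φ l (𝓝 0) → ∀ k,
      Tendsto (fun s => SchwartzMap.seminorm ℝ k m (bmap B (b s) (φ s))) l (𝓝 0) := by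
  induction m with
  | zero =>
    intro b b₀ φ hb hφ k
    obtain ⟨C, hC⟩ := tendsto_bound_ev hb
    have h1 := (tendsto_zero_iff_seminorm.1 hφ 0 k).const_mul (‖B‖ * C)
    rw [mul_zero] at h1
    refine squeeze_zero' (Eventually.of_forall fun s => apply_nonneg _ _)
      (hC.mono fun s hs => ?_) h1
    refine (norm_bmap_le B (b s) (φ s) k).trans ?_
    gcongr
  | succ m ih =>
    intro b b₀ φ hb hφ
    refine tendsto_seminorm_D_add (fun s => D_bmap B (b s) (φ s)) (ih (b₀ := toBd n b₀.2) ?_ hφ)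
      (ih hb ?_)
    · exact (((toBd n).continuous.comp continuous_snd).tendsto b₀).comp hb
    · have := ((D n).continuous.tendsto 0).comp hφ
      rwa [map_zero] at this

theorem tendsto_bmap_of_left (B : Mat n →L[ℝ] Mat n →L[ℝ] Mat n) (m : ℕ) :
    ∀ {b : ι → Bd n} (φ : 𝓢(ℝ, Mat n)), Tendsto b l (𝓝 0) → ∀ k,
      Tendsto (fun s => SchwartzMap.seminorm ℝ k m (bmap B (b s) φ)) l (𝓝 0) := by
  induction m with
  | zero =>
    intro b φ hb k
    have h0 : Tendsto (fun s => ‖(b s).1‖) l (𝓝 0) := by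
      have := ((continuous_fst.norm).tendsto (0 : Bd n)).comp hb
      rwa [Prod.fst_zero, norm_zero] at this
    have h2 : Tendsto (fun s => (b s).2) l (𝓝 0) := (continuous_snd.tendsto (0 : Bd n)).comp hb
    have h3 := ((h0.add (tendsto_integral_norm_zero h2)).const_mul ‖B‖).mul_const
      (SchwartzMap.seminorm ℝ k 0 φ)
    rw [add_zero, mul_zero, zero_mul] at h3
    exact squeeze_zero (fun s => apply_nonneg _ _) (fun s => norm_bmap_le B (b s) φ k) h3
  | succ m ih =>
    intro b φ hb
    refine tendsto_seminorm_D_add (fun s => D_bmap B (b s) φ) (ih φ ?_) (ih _ hb)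
    have := (((toBd n).continuous.comp continuous_snd).tendsto (0 : Bd n)).comp hb
    rwa [Function.comp_apply, Prod.snd_zero, map_zero] at this

/-- Telescoping: `B(b, φ) - B(b₀, φ₀) = B(b, φ - φ₀) + B(b - b₀, φ₀)`, with the two terms treated by
the two preceding lemmas. -/
theorem continuous_bmap (B : Mat n →L[ℝ] Mat n →L[ℝ] Mat n) :
    Continuous fun p : Bd n × 𝓢(ℝ, Mat n) => bmap B p.1 p.2 := by
  refine continuous_iff_continuousAt.2 fun p => ?_
  have hb : Tendsto (fun q : Bd n × 𝓢(ℝ, Mat n) => q.1) (𝓝 p) (𝓝 p.1) := continuous_fst.tendsto p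
  have hb' : Tendsto (fun q : Bd n × 𝓢(ℝ, Mat n) => q.1 - p.1) (𝓝 p) (𝓝 0) := by
    simpa using hb.sub_const p.1
  have hφ : Tendsto (fun q : Bd n × 𝓢(ℝ, Mat n) => q.2 - p.2) (𝓝 p) (𝓝 0) := by
    simpa using (continuous_snd.tendsto p).sub_const p.2
  have h1 := tendsto_zero_iff_seminorm.2 fun m => tendsto_bmap_of_right B m hb hφ
  have h2 := tendsto_zero_iff_seminorm.2 fun m => tendsto_bmap_of_left B m p.2 hb'
  have h3 := (h1.add h2).add_const (bmap B p.1 p.2)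
  rw [add_zero, zero_add] at h3
  refine h3.congr fun q => ?_
  simp

end Limits

end Bounded

/-! ### Products -/

section Products

variable {n : ℕ}

/-- The Schwartz map `b * φ`. -/
def lm (n : ℕ) : Bd n →ₗ[ℝ] 𝓢(ℝ, Mat n) →ₗ[ℝ] 𝓢(ℝ, Mat n) :=
  bmap (ContinuousLinearMap.mul ℝ (Mat n))

/-- The Schwartz map `φ * b`. -/
def rm (n : ℕ) : Bd n →ₗ[ℝ] 𝓢(ℝ, Mat n) →ₗ[ℝ] 𝓢(ℝ, Mat n) :=
  bmap (ContinuousLinearMap.mul ℝ (Mat n)).flip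

@[simp]
theorem lm_apply (b : Bd n) (φ : 𝓢(ℝ, Mat n)) (x : ℝ) : lm n b φ x = ev b x * φ x := rfl

@[simp]
theorem rm_apply (b : Bd n) (φ : 𝓢(ℝ, Mat n)) (x : ℝ) : rm n b φ x = φ x * ev b x := rfl

/-- The product in the algebra of maps with Schwartz derivative. -/
def bm (n : ℕ) : Bd n →ₗ[ℝ] Bd n →ₗ[ℝ] Bd n :=
  LinearMap.mk₂ ℝ (fun b c => (b.1 * c.1, lm n b c.2 + rm n c b.2))
    (fun b b' c => by simp [add_mul]; abel) (fun r b c => by simp)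
    (fun b c c' => by simp [mul_add]; abel) (fun r b c => by simp)

theorem bm_fst (b c : Bd n) : (bm n b c).1 = b.1 * c.1 := rfl

theorem bm_snd (b c : Bd n) : (bm n b c).2 = lm n b c.2 + rm n c b.2 := rfl

@[simp]
theorem ev_bm (b c : Bd n) (x : ℝ) : ev (bm n b c) x = ev b x * ev c x := by
  have : ev (bm n b c) = fun x => ev b x * ev c x := by
    refine ev_eq (fun x => ?_) ((tendsto_ev b).mul (tendsto_ev c))
    have := (hasDerivAt_ev b x).mul (hasDerivAt_ev c x)
    rwa [add_comm] at this
  rw [this]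

/-- The product of Schwartz maps. -/
def sm (n : ℕ) : 𝓢(ℝ, Mat n) →ₗ[ℝ] 𝓢(ℝ, Mat n) →ₗ[ℝ] 𝓢(ℝ, Mat n) :=
  (lm n).comp (toBd n).toLinearMap

@[simp]
theorem sm_apply (f g : 𝓢(ℝ, Mat n)) (x : ℝ) : sm n f g x = f x * g x := by
  change ev (toBd n f) x * g x = _
  rw [ev_toBd]

theorem continuous_lm : Continuous fun p : Bd n × 𝓢(ℝ, Mat n) => lm n p.1 p.2 :=
  continuous_bmap _

theorem continuous_rm : Continuous fun p : Bd n × 𝓢(ℝ, Mat n) => rm n p.1 p.2 :=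
  continuous_bmap _

theorem continuous_bm : Continuous fun p : Bd n × Bd n => bm n p.1 p.2 := by
  have h1 : Continuous fun p : Bd n × Bd n => lm n p.1 p.2.2 :=
    continuous_lm.comp (f := fun p : Bd n × Bd n => (p.1, p.2.2)) (by fun_prop)
  have h2 : Continuous fun p : Bd n × Bd n => rm n p.2 p.1.2 :=
    continuous_rm.comp (f := fun p : Bd n × Bd n => (p.2, p.1.2)) (by fun_prop)
  have h3 : Continuous fun p : Bd n × Bd n => p.1.1 * p.2.1 := by fun_prop
  exact h3.prodMk (h1.add h2)

theorem sm_eq_lm (f g : 𝓢(ℝ, Mat n)) : sm n f g = lm n (toBd n f) g := rfl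

theorem continuous_sm : Continuous fun p : 𝓢(ℝ, Mat n) × 𝓢(ℝ, Mat n) => sm n p.1 p.2 := by
  simp only [sm_eq_lm]
  have h1 : Continuous fun p : 𝓢(ℝ, Mat n) × 𝓢(ℝ, Mat n) => (toBd n p.1, p.2) :=
    ((toBd n).continuous.comp continuous_fst).prodMk continuous_snd
  have h2 := continuous_lm.comp h1
  simpa only [Function.comp_def] using h2

/-- The conjugate transpose of Schwartz maps. -/
def starS (n : ℕ) : 𝓢(ℝ, Mat n) →L[ℝ] 𝓢(ℝ, Mat n) :=
  SchwartzMap.postcompCLM (starL' ℝ : Mat n ≃L[ℝ] Mat n).toContinuousLinearMap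

@[simp]
theorem starS_apply (f : 𝓢(ℝ, Mat n)) (x : ℝ) : starS n f x = star (f x) := rfl

/-- The conjugate transpose of maps with Schwartz derivative. -/
def starB (n : ℕ) : Bd n →L[ℝ] Bd n :=
  ContinuousLinearMap.prodMap (starL' ℝ : Mat n ≃L[ℝ] Mat n).toContinuousLinearMap (starS n)

theorem starB_fst (b : Bd n) : (starB n b).1 = star b.1 := rfl

theorem starB_snd (b : Bd n) : (starB n b).2 = starS n b.2 := rfl

@[simp]
theorem ev_starB (b : Bd n) (x : ℝ) : ev (starB n b) x = star (ev b x) := by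
  have : ev (starB n b) = fun x => star (ev b x) :=
    ev_eq (fun x => (hasDerivAt_ev b x).star) ((tendsto_ev b).star)
  rw [this]

theorem ev_const (y : Mat n) (x : ℝ) : ev (y, (0 : 𝓢(ℝ, Mat n))) x = y := by
  simp [ev]

end Products

/-! ### The linear equation `g_x = g r` on the line -/

section LinearODE

variable {n : ℕ}

/-- Picard iteration on the whole line at once. With `A x = ∫_{-∞}^x ‖r‖`, the unknown is `k =
e^{-2A} F`, and in the sup norm of `k` the integral operator contracts by `1/2`, however large `r`
is. -/
theorem exists_fixedPoint_integral (r : 𝓢(ℝ, Mat n)) :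
    ∃ F : ℝ → Mat n, Continuous F ∧ Integrable (fun y => F y * r y) ∧
      ∀ x, F x = 1 + ∫ y in Set.Iic x, F y * r y := by
  set A : ℝ → ℝ := fun x => ∫ y in Set.Iic x, ‖r y‖ with hA
  have hAd : ∀ x, HasDerivAt A ‖r x‖ x :=
    hasDerivAt_integral_Iic r.continuous.norm r.integrable.norm
  have hAc : Continuous A := continuous_iff_continuousAt.2 fun x => (hAd x).continuousAt
  have hA0 : ∀ x, 0 ≤ A x := fun x => integral_nonneg fun _ => norm_nonneg _
  have hAM : ∀ x, A x ≤ ∫ y, ‖r y‖ := fun x =>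
    setIntegral_le_integral r.integrable.norm (ae_of_all _ fun _ => norm_nonneg _)
  have hAt : Tendsto A atBot (𝓝 0) := tendsto_integral_Iic_zero tendsto_id
  set M := ∫ y, ‖r y‖ with hM
  -- The exponent `2A` makes `e^{2A} / 2` a primitive of `e^{2A} ‖r‖`; this is the source of the
  -- contraction constant `1/2`.
  have hEd : ∀ x, HasDerivAt (fun x => Real.exp (2 * A x) / 2) (Real.exp (2 * A x) * ‖r x‖) x := by
    intro x
    convert! (((hAd x).const_mul 2).exp).div_const 2 using 1
    ring
  have hEt : Tendsto (fun x => Real.exp (2 * A x) / 2) atBot (𝓝 (1 / 2)) := by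
    have := ((Real.continuous_exp.tendsto _).comp (hAt.const_mul 2)).div_const 2
    rwa [mul_zero, Real.exp_zero] at this
  have hEi : Integrable fun x => Real.exp (2 * A x) * ‖r x‖ := by
    refine (r.integrable.norm).bdd_mul (c := Real.exp (2 * M))
      (Real.continuous_exp.comp (hAc.const_mul 2)).aestronglyMeasurable (ae_of_all _ fun x => ?_)
    rw [Real.norm_of_nonneg (Real.exp_pos _).le]
    exact Real.exp_le_exp.2 (by linarith [hAM x])
  have hEint : ∀ x, ∫ y in Set.Iic x, Real.exp (2 * A y) * ‖r y‖ =
      Real.exp (2 * A x) / 2 - 1 / 2 := fun x =>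
    integral_Iic_of_hasDerivAt_of_tendsto' (fun y _ => hEd y) hEi.integrableOn hEt
  have hki : ∀ k : BoundedContinuousFunction ℝ (Mat n),
      Integrable fun y => Real.exp (2 * A y) • (k y * r y) := by
    intro k
    refine (hEi.const_mul ‖k‖).mono ((Real.continuous_exp.comp (hAc.const_mul 2)).smul
      (k.continuous.mul r.continuous)).aestronglyMeasurable (ae_of_all _ fun y => ?_)
    rw [norm_smul, Real.norm_of_nonneg (Real.exp_pos _).le, Real.norm_of_nonneg (by positivity)]
    calc Real.exp (2 * A y) * ‖k y * r y‖ ≤ Real.exp (2 * A y) * (‖k‖ * ‖r y‖) := by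
          gcongr
          exact (norm_mul_le _ _).trans (by gcongr; exact k.norm_coe_le_norm y)
      _ = _ := by ring
  have hkc : ∀ k : BoundedContinuousFunction ℝ (Mat n),
      Continuous fun y => Real.exp (2 * A y) • (k y * r y) := fun k =>
    (Real.continuous_exp.comp (hAc.const_mul 2)).smul (k.continuous.mul r.continuous)
  have hkb : ∀ (k : BoundedContinuousFunction ℝ (Mat n)) (x : ℝ),
      ‖∫ y in Set.Iic x, Real.exp (2 * A y) • (k y * r y)‖ ≤
        ‖k‖ * (Real.exp (2 * A x) / 2 - 1 / 2) := by
    intro k x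
    rw [← hEint, ← integral_const_mul]
    refine norm_integral_le_of_norm_le (hEi.const_mul _).integrableOn (ae_of_all _ fun y => ?_)
    rw [norm_smul, Real.norm_of_nonneg (Real.exp_pos _).le]
    calc Real.exp (2 * A y) * ‖k y * r y‖ ≤ Real.exp (2 * A y) * (‖k‖ * ‖r y‖) := by
          gcongr
          exact (norm_mul_le _ _).trans (by gcongr; exact k.norm_coe_le_norm y)
      _ = _ := by ring
  set T : BoundedContinuousFunction ℝ (Mat n) → BoundedContinuousFunction ℝ (Mat n) := fun k =>
    BoundedContinuousFunction.ofNormedAddCommGroup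
      (fun x => Real.exp (-(2 * A x)) • (1 + ∫ y in Set.Iic x, Real.exp (2 * A y) • (k y * r y)))
      ((Real.continuous_exp.comp (hAc.const_mul 2).neg).smul (continuous_const.add
        (continuous_iff_continuousAt.2 fun x =>
          (hasDerivAt_integral_Iic (hkc k) (hki k) x).continuousAt)))
      (‖(1 : Mat n)‖ + ‖k‖) (by
        intro x
        rw [norm_smul, Real.norm_of_nonneg (Real.exp_pos _).le]
        have h1 : Real.exp (-(2 * A x)) ≤ 1 := Real.exp_le_one_iff.2 (by linarith [hA0 x])
        have h2 : Real.exp (-(2 * A x)) * Real.exp (2 * A x) = 1 := by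
          rw [← Real.exp_add]; simp
        calc _ ≤ Real.exp (-(2 * A x)) *
              (‖(1 : Mat n)‖ + ‖k‖ * (Real.exp (2 * A x) / 2 - 1 / 2)) := by
              gcongr
              exact (norm_add_le _ _).trans (add_le_add le_rfl (hkb k x))
          _ = Real.exp (-(2 * A x)) * ‖(1 : Mat n)‖ + ‖k‖ * ((1 - Real.exp (-(2 * A x))) / 2) := by
              linear_combination ‖k‖ / 2 * h2
          _ ≤ _ := by
              refine add_le_add (mul_le_of_le_one_left (norm_nonneg _) h1)
                (mul_le_of_le_one_right (norm_nonneg _) ?_)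
              linarith [Real.exp_pos (-(2 * A x))]) with hT
  have hTc : ContractingWith (1 / 2) T := by
    refine ⟨by norm_num, LipschitzWith.of_dist_le_mul fun k k' => ?_⟩
    refine (BoundedContinuousFunction.dist_le (by positivity)).2 fun x => ?_
    rw [dist_eq_norm, dist_eq_norm]
    have h0 : T k x - T k' x = Real.exp (-(2 * A x)) •
        ∫ y in Set.Iic x, Real.exp (2 * A y) • ((k - k') y * r y) := by
      have : ∀ y, Real.exp (2 * A y) • ((k - k') y * r y) =
          Real.exp (2 * A y) • (k y * r y) - Real.exp (2 * A y) • (k' y * r y) := by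
        intro y
        rw [BoundedContinuousFunction.sub_apply, sub_mul, smul_sub]
      simp only [this]
      rw [integral_sub (hki k).integrableOn (hki k').integrableOn]
      simp only [hT, BoundedContinuousFunction.coe_ofNormedAddCommGroup]
      rw [← smul_sub]
      congr 1
      abel
    rw [h0, norm_smul, Real.norm_of_nonneg (Real.exp_pos _).le]
    have h2 : Real.exp (-(2 * A x)) * Real.exp (2 * A x) = 1 := by
      rw [← Real.exp_add]; simp
    calc _ ≤ Real.exp (-(2 * A x)) * (‖k - k'‖ * (Real.exp (2 * A x) / 2 - 1 / 2)) := by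
          gcongr
          exact hkb _ x
      _ = ‖k - k'‖ * ((1 - Real.exp (-(2 * A x))) / 2) := by
          linear_combination ‖k - k'‖ / 2 * h2
      _ ≤ ‖k - k'‖ * (1 / 2) := by
          gcongr
          linarith [Real.exp_pos (-(2 * A x))]
      _ = _ := by
          push_cast
          ring
  obtain ⟨k, hk⟩ : ∃ k, T k = k := ⟨_, hTc.fixedPoint_isFixedPt⟩
  refine ⟨fun x => Real.exp (2 * A x) • k x,
    (Real.continuous_exp.comp (hAc.const_mul 2)).smul k.continuous, ?_, fun x => ?_⟩
  · simpa only [smul_mul_assoc] using hki k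
  · have h2 : Real.exp (2 * A x) * Real.exp (-(2 * A x)) = 1 := by
      rw [← Real.exp_add]; simp
    have h3 : k x = Real.exp (-(2 * A x)) •
        (1 + ∫ y in Set.Iic x, Real.exp (2 * A y) • (k y * r y)) := by
      conv_lhs => rw [← hk]
      rfl
    simp only [smul_mul_assoc]
    conv_lhs => rw [h3]
    rw [smul_smul, h2, one_smul]

/-- For a skew-Hermitian Schwartz map `r` the equation `F_x = F r`, `F(-∞) = 1` has a unitary
solution. -/
theorem exists_unitary_solution (r : 𝓢(ℝ, Mat n)) (hr : ∀ x, star (r x) = -r x) :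
    ∃ F : ℝ → Mat n, (∀ x, F x ∈ Matrix.unitaryGroup (Fin n) ℂ) ∧
      (∀ x, HasDerivAt F (F x * r x) x) ∧ Tendsto F atBot (𝓝 1) := by
  obtain ⟨F, hFc, hFi, hF⟩ := exists_fixedPoint_integral r
  have hd : ∀ x, HasDerivAt F (F x * r x) x := by
    intro x
    have h1 := (hasDerivAt_integral_Iic (hFc.mul r.continuous) hFi x).const_add (1 : Mat n)
    exact h1.congr_of_eventuallyEq (Eventually.of_forall hF)
  have ht : Tendsto F atBot (𝓝 1) := by
    have h1 := (tendsto_integral_Iic_zero (f := fun y => F y * r y) (μ := volume)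
      tendsto_id).const_add (1 : Mat n)
    rw [add_zero] at h1
    exact h1.congr fun x => (hF x).symm
  refine ⟨F, fun x => ?_, hd, ht⟩
  rw [Matrix.mem_unitaryGroup_iff]
  -- The derivative of `F F*` is `F (r + r*) F* = 0`, and its limit at `-∞` is `1`.
  have h1 : (fun x => F x * star (F x)) = fun _ => 1 := by
    refine eq_of_hasDerivAt_of_tendsto (f' := fun _ => 0) (c := 1) (fun x => ?_)
      (fun x => hasDerivAt_const _ _) ?_ tendsto_const_nhds
    · have := (hd x).mul (hd x).star
      convert! this using 1
      rw [star_mul, hr]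
      noncomm_ring
    · simpa using ht.mul ht.star
  exact congrFun h1 x

theorem unitary_solution_unique {r : ℝ → Mat n} {F G : ℝ → Mat n}
    (hr : ∀ x, star (r x) = -r x)
    (hG : ∀ x, G x ∈ Matrix.unitaryGroup (Fin n) ℂ)
    (hFd : ∀ x, HasDerivAt F (F x * r x) x) (hGd : ∀ x, HasDerivAt G (G x * r x) x)
    (hFt : Tendsto F atBot (𝓝 1)) (hGt : Tendsto G atBot (𝓝 1)) : F = G := by
  have h1 : (fun x => F x * star (G x)) = fun _ => 1 := by
    refine eq_of_hasDerivAt_of_tendsto (f' := fun _ => 0) (c := 1) (fun x => ?_)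
      (fun x => hasDerivAt_const _ _) ?_ tendsto_const_nhds
    · have := (hFd x).mul (hGd x).star
      convert! this using 1
      rw [star_mul, hr]
      noncomm_ring
    · simpa using hFt.mul hGt.star
  funext x
  have h2 := congrFun h1 x
  calc F x = F x * (star (G x) * G x) := by rw [Matrix.mem_unitaryGroup_iff'.1 (hG x), mul_one]
    _ = F x * star (G x) * G x := by rw [mul_assoc]
    _ = G x := by rw [h2, one_mul]

end LinearODE

/-! ### Dependence of unitary solutions on the coefficient -/

section Dependence

variable {n : ℕ}

/-- No convergence of `h` is assumed: at order zero a unitary factor preserves norms, and `(h φ)_x =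
h (p φ + φ_x)` has the same shape with a new `φ` that again tends to zero. This replaces a Gronwall
estimate. -/
theorem tendsto_lm_unitary {ι : Type*} {l : Filter ι} (m : ℕ) :
    ∀ {h : ι → Bd n} {p φ : ι → 𝓢(ℝ, Mat n)},
      (∀ s x, ev (h s) x ∈ Matrix.unitaryGroup (Fin n) ℂ) → (∀ s, (h s).2 = lm n (h s) (p s)) →
      Tendsto p l (𝓝 0) → Tendsto φ l (𝓝 0) → ∀ k,
      Tendsto (fun s => SchwartzMap.seminorm ℝ k m (lm n (h s) (φ s))) l (𝓝 0) := by
  induction m with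
  | zero =>
    intro h p φ hu hp hpt hφ k
    have h1 := tendsto_zero_iff_seminorm.1 hφ 0 k
    refine squeeze_zero (fun s => apply_nonneg _ _) (fun s => ?_) h1
    have := seminorm_zero_le_of_norm_le k (f := lm n (h s) (φ s)) (g := φ s) zero_le_one
      (fun x => by
        rw [lm_apply, one_mul]
        exact (CStarRing.norm_coe_unitary_mul ⟨_, hu s x⟩ _).le)
    rwa [one_mul] at this
  | succ m ih =>
    intro h p φ hu hp hpt hφ
    have h1 : ∀ s, D n (lm n (h s) (φ s)) =
        lm n (h s) (sm n (p s) (φ s)) + lm n (h s) (D n (φ s)) := by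
      intro s
      rw [lm, D_bmap]
      congr 1
      ext1 x
      change ev (toBd n (h s).2) x * φ s x = ev (h s) x * sm n (p s) (φ s) x
      rw [ev_toBd, hp, lm_apply, sm_apply, mul_assoc]
    refine tendsto_seminorm_D_add h1 (ih hu hp hpt ?_) (ih hu hp hpt ?_)
    · have := (continuous_sm.tendsto ((0 : 𝓢(ℝ, Mat n)), (0 : 𝓢(ℝ, Mat n)))).comp
        (hpt.prodMk_nhds hφ)
      rwa [map_zero] at this
    · have := ((D n).continuous.tendsto 0).comp hφ
      rwa [map_zero] at this

/-- Unitary solutions of `h_x = h p`, `h(-∞) = 1` depend differentiably on `p` at `p = 0`. -/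
theorem hasCurveDeriv_unitary {h : ℝ → Bd n} {p : ℝ → 𝓢(ℝ, Mat n)} {p' : 𝓢(ℝ, Mat n)} {I : Set ℝ}
    {t : ℝ} (hu : ∀ s x, ev (h s) x ∈ Matrix.unitaryGroup (Fin n) ℂ)
    (hp : ∀ s, (h s).2 = lm n (h s) (p s)) (h1 : ∀ s, (h s).1 = 1) (hpt : p t = 0)
    (hd : HasCurveDeriv p p' I t) : HasCurveDeriv h (0, p') I t := by
  have hp0 : Tendsto p (𝓝[I \ {t}] t) (𝓝 0) := hpt ▸ hd.tendsto
  -- As `h_x = h p`, the previous lemma with `φ = p` shows that `h` tends to the constant `1`. The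
  -- difference quotient of `h_x` is `h` times that of `p`, since `p t = 0`, so it tends to `p'`.
  have hh : Tendsto (fun s => (h s).2) (𝓝[I \ {t}] t) (𝓝 0) := by
    rw [tendsto_zero_iff_seminorm]
    intro m k
    simpa only [← hp] using tendsto_lm_unitary m hu hp hp0 hp0 k
  have hh' : Tendsto h (𝓝[I \ {t}] t) (𝓝 ((1 : Mat n), (0 : 𝓢(ℝ, Mat n)))) := by
    refine (tendsto_const_nhds.prodMk_nhds hh).congr fun s => ?_
    rw [← h1 s]
  have h2 := (continuous_lm.tendsto (((1 : Mat n), (0 : 𝓢(ℝ, Mat n))), p')).comp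
    (hh'.prodMk_nhds hd)
  have h3 : lm n ((1 : Mat n), (0 : 𝓢(ℝ, Mat n))) p' = p' := by
    ext1 x
    rw [lm_apply, ev_const, one_mul]
  simp only [h3] at h2
  refine (tendsto_const_nhds.prodMk_nhds h2).congr fun s => ?_
  refine Prod.ext ?_ ?_
  · simp [h1]
  · simp [hp, hpt]

end Dependence

/-! ### Linear algebra of the centralizer of a diagonal matrix -/

section DiagonalAlgebra

variable {n : ℕ}

theorem mem_u_of_star {y : Mat n} (h : star y = -y) : y ∈ u n := h

/-- `piPerp` as a continuous linear map. -/
def offL (a : Mat n) : Mat n →L[ℝ] Mat n :=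
  LinearMap.toContinuousLinearMap
    { toFun := piPerp a
      map_add' := fun x y => by
        ext i j
        by_cases h : a i i = a j j <;> simp [piPerp, h]
      map_smul' := fun r x => by
        ext i j
        by_cases h : a i i = a j j <;> simp [piPerp, h] }

@[simp]
theorem offL_apply (a y : Mat n) : offL a y = piPerp a y := rfl

/-- The inverse of `y ↦ [y, a]` on the image of `piPerp`. -/
def invL (a : Mat n) : Mat n →L[ℝ] Mat n :=
  LinearMap.toContinuousLinearMap
    -- Division by zero gives zero, so the block entries are annihilated without a case distinction.
    { toFun := fun y => Matrix.of fun i j => y i j / (a j j - a i i)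
      map_add' := fun x y => by
        ext i j
        simp [add_div]
      map_smul' := fun r x => by
        ext i j
        simp [mul_div_assoc] }

theorem invL_apply (a y : Mat n) (i j : Fin n) : invL a y i j = y i j / (a j j - a i i) := rfl

theorem lie_invL {a : Mat n} (hd : a.IsDiag) (y : Mat n) : ⁅invL a y, a⁆ = piPerp a y := by
  ext i j
  rw [lie_diag_apply hd, invL_apply]
  by_cases h : a i i = a j j
  · simp [piPerp, h]
  · simp [piPerp, h, div_mul_cancel₀ _ (sub_ne_zero.2 (Ne.symm h))]

theorem invL_lie {a : Mat n} (hd : a.IsDiag) (y : Mat n) : invL a ⁅y, a⁆ = piPerp a y := by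
  ext i j
  rw [invL_apply, lie_diag_apply hd]
  by_cases h : a i i = a j j
  · simp [piPerp, h]
  · simp [piPerp, h, mul_div_cancel_right₀ _ (sub_ne_zero.2 (Ne.symm h))]

theorem piPerp_invL (a y : Mat n) : piPerp a (invL a y) = invL a y := by
  ext i j
  by_cases h : a i i = a j j
  · simp [piPerp, h, invL_apply]
  · simp [piPerp, h]

theorem piPerp_piPerp (a y : Mat n) : piPerp a (piPerp a y) = piPerp a y := by
  ext i j
  by_cases h : a i i = a j j <;> simp [piPerp, h]

theorem piPerp_lie {a : Mat n} (hd : a.IsDiag) (y : Mat n) : piPerp a ⁅y, a⁆ = ⁅y, a⁆ := by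
  ext i j
  rw [lie_diag_apply hd]
  by_cases h : a i i = a j j
  · simp [piPerp, h]
  · simp [piPerp, h, lie_diag_apply hd]

theorem lie_piPerp {a : Mat n} (hd : a.IsDiag) (y : Mat n) : ⁅piPerp a y, a⁆ = ⁅y, a⁆ := by
  ext i j
  rw [lie_diag_apply hd, lie_diag_apply hd]
  by_cases h : a i i = a j j <;> simp [piPerp, h]

theorem piPerp_eq_zero_iff {a : Mat n} (hd : a.IsDiag) {y : Mat n} :
    piPerp a y = 0 ↔ ⁅y, a⁆ = 0 := by
  constructor
  · intro h
    rw [← lie_piPerp hd, h, Ring.lie_def, zero_mul, mul_zero, sub_zero]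
  · intro h
    rw [← invL_lie hd, h, map_zero]

theorem apply_conj {a : Mat n} (ha : a ∈ u n) (i : Fin n) : star (a i i) = -a i i := by
  have := congrFun (congrFun (mem_u.1 ha) i) i
  simpa using this

theorem star_invL {a : Mat n} (ha : a ∈ u n) (y : Mat n) : star (invL a y) = invL a (star y) := by
  ext i j
  rw [Matrix.star_apply, invL_apply, invL_apply, Matrix.star_apply, star_div₀, star_sub,
    apply_conj ha, apply_conj ha]
  congr 1
  ring

theorem star_lie (x y : Mat n) : star ⁅x, y⁆ = ⁅star y, star x⁆ := by
  simp [Ring.lie_def]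

theorem lie_mem_u {x y : Mat n} (hx : x ∈ u n) (hy : y ∈ u n) : ⁅x, y⁆ ∈ u n := by
  refine mem_u_of_star ?_
  rw [star_lie, mem_u.1 hx, mem_u.1 hy]
  simp only [Ring.lie_def]
  noncomm_ring

theorem ip_sub_left (x y z : Mat n) : ip (x - y) z = ip x z - ip y z := by
  simp only [ip, sub_mul, Matrix.trace_sub, Complex.sub_re]
  ring

/-- If `y` is orthogonal to the centralizer, then so is its block part `y - piPerp a y`, which also
lies in the centralizer and must vanish. -/
theorem mem_perp_iff {a : Mat n} (hd : a.IsDiag) {y : Mat n} :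
    y ∈ perp a ↔ y ∈ u n ∧ piPerp a y = y := by
  constructor
  · intro hy
    refine ⟨hy.1, ?_⟩
    have hc := sub_piPerp_mem hd hy.1
    have h1 := hy.2 _ hc
    have h2 := (piPerp_mem hd hy.1).2 _ hc
    have h3 : y - piPerp a y = 0 := eq_zero_of_ip_self hc.1 (by rw [ip_sub_left, h1, h2, sub_zero])
    exact (sub_eq_zero.1 h3).symm
  · rintro ⟨h1, h2⟩
    rw [← h2]
    exact piPerp_mem hd h1

theorem invL_mem {a : Mat n} (ha : a ∈ u n) (hd : a.IsDiag) {y : Mat n} (hy : y ∈ u n) :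
    invL a y ∈ perp a := by
  refine (mem_perp_iff hd).2 ⟨mem_u_of_star ?_, piPerp_invL a y⟩
  rw [star_invL ha, mem_u.1 hy, map_neg]

theorem lie_mem_perp {a : Mat n} (ha : a ∈ u n) (hd : a.IsDiag) {y : Mat n} (hy : y ∈ u n) :
    ⁅y, a⁆ ∈ perp a :=
  (mem_perp_iff hd).2 ⟨lie_mem_u hy ha, piPerp_lie hd y⟩

theorem adInv_eq {a : Mat n} (ha : a ∈ u n) (hd : a.IsDiag) {y : Mat n} (hy : y ∈ perp a) :
    adInv a y = -invL a y := by
  have h1 : -invL a y ∈ perp a := by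
    rw [← map_neg]
    exact invL_mem ha hd ((u n).neg_mem hy.1)
  have h2 : ⁅a, -invL a y⁆ = y := by
    rw [show ⁅a, -invL a y⁆ = ⁅invL a y, a⁆ by simp only [Ring.lie_def]; noncomm_ring,
      lie_invL hd, ((mem_perp_iff hd).1 hy).2]
  conv_lhs => rw [← h2]
  exact adInv_lie h1

/-- Guarantees that limits of difference quotients of `u(n)_a^⊥`-valued maps stay in `u(n)_a^⊥`. -/
theorem isClosed_perp {a : Mat n} (hd : a.IsDiag) : IsClosed (perp a) := by
  have h1 : perp a = {y | star y = -y} ∩ {y | offL a y = y} := by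
    ext y
    exact mem_perp_iff hd
  rw [h1]
  exact (isClosed_eq continuous_star continuous_neg).inter
    (isClosed_eq (offL a).continuous continuous_id)

theorem eq_zero_or_of_lie {a : Mat n} (hd : a.IsDiag) {z : Mat n} (hz : ⁅z, a⁆ = 0) (i j : Fin n) :
    z i j = 0 ∨ a i i = a j j := by
  have := congrFun (congrFun hz i) j
  rw [lie_diag_apply hd, Matrix.zero_apply, mul_eq_zero, sub_eq_zero] at this
  exact this.imp id Eq.symm

/-- A matrix commuting with `a` is block diagonal, so multiplying by it mixes entries only within
one pair of eigenspaces. -/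
theorem piPerp_mul_left {a : Mat n} (hd : a.IsDiag) {z : Mat n} (hz : ⁅z, a⁆ = 0) (y : Mat n) :
    piPerp a (z * y) = z * piPerp a y := by
  ext i j
  simp only [piPerp, Matrix.of_apply, Matrix.mul_apply]
  split_ifs with h
  · refine (Finset.sum_eq_zero fun k _ => ?_).symm
    rcases eq_zero_or_of_lie hd hz i k with h1 | h1
    · simp [h1]
    · simp [← h1, h]
  · refine Finset.sum_congr rfl fun k _ => ?_
    rcases eq_zero_or_of_lie hd hz i k with h1 | h1
    · simp [h1]
    · simp [← h1, h]

theorem piPerp_mul_right {a : Mat n} (hd : a.IsDiag) {z : Mat n} (hz : ⁅z, a⁆ = 0) (y : Mat n) :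
    piPerp a (y * z) = piPerp a y * z := by
  ext i j
  simp only [piPerp, Matrix.of_apply, Matrix.mul_apply]
  split_ifs with h
  · refine (Finset.sum_eq_zero fun k _ => ?_).symm
    rcases eq_zero_or_of_lie hd hz k j with h1 | h1
    · simp [h1]
    · simp [h1, h]
  · refine Finset.sum_congr rfl fun k _ => ?_
    rcases eq_zero_or_of_lie hd hz k j with h1 | h1
    · simp [h1]
    · simp [h1, h]

theorem piPerp_add (a x y : Mat n) : piPerp a (x + y) = piPerp a x + piPerp a y :=
  map_add (offL a) x y

theorem piPerp_sub (a x y : Mat n) : piPerp a (x - y) = piPerp a x - piPerp a y :=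
  map_sub (offL a) x y

theorem piPerp_zero (a : Mat n) : piPerp a 0 = 0 := map_zero (offL a)

theorem piPerp_lie_left {a : Mat n} (hd : a.IsDiag) {z : Mat n} (hz : ⁅z, a⁆ = 0) (y : Mat n) :
    piPerp a ⁅y, z⁆ = ⁅piPerp a y, z⁆ := by
  rw [Ring.lie_def, piPerp_sub, piPerp_mul_left hd hz, piPerp_mul_right hd hz, Ring.lie_def]

/-- The eigenvalues of a diagonal matrix. -/
def spec (a : Mat n) : Finset ℂ := Finset.univ.image fun i => a i i

theorem apply_mem_spec (a : Mat n) (i : Fin n) : a i i ∈ spec a :=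
  Finset.mem_image.2 ⟨i, Finset.mem_univ i, rfl⟩

/-- The spectral projection of a diagonal matrix for the eigenvalue `μ`. -/
def proj (a : Mat n) (μ : ℂ) : Mat n := Matrix.diagonal fun i => if a i i = μ then 1 else 0

theorem proj_mul_self (a : Mat n) (μ : ℂ) : proj a μ * proj a μ = proj a μ := by
  rw [proj, Matrix.diagonal_mul_diagonal]
  congr 1
  funext i
  split_ifs <;> simp

theorem proj_mul_ne (a : Mat n) {μ ν : ℂ} (h : μ ≠ ν) : proj a μ * proj a ν = 0 := by
  rw [proj, proj, Matrix.diagonal_mul_diagonal, ← Matrix.diagonal_zero]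
  congr 1
  funext i
  by_cases h1 : a i i = μ
  · simp [h1, h]
  · simp [h1]

theorem star_proj (a : Mat n) (μ : ℂ) : star (proj a μ) = proj a μ := by
  rw [proj, Matrix.star_eq_conjTranspose, Matrix.diagonal_conjTranspose]
  congr 1
  funext i
  simp only [Pi.star_apply]
  split_ifs <;> simp

theorem diagonal_sum {ι : Type*} (s : Finset ι) (f : ι → Fin n → ℂ) :
    ∑ k ∈ s, Matrix.diagonal (f k) = Matrix.diagonal fun i => ∑ k ∈ s, f k i := by
  have := (map_sum (Matrix.diagonalAddMonoidHom (Fin n) ℂ) f s).symm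
  simp only [Matrix.diagonalAddMonoidHom_apply] at this
  rw [this]
  congr 1
  funext i
  simp

theorem sum_proj (a : Mat n) : ∑ μ ∈ spec a, proj a μ = 1 := by
  simp only [proj]
  rw [diagonal_sum, ← Matrix.diagonal_one]
  congr 1
  funext i
  rw [Finset.sum_ite_eq, if_pos (apply_mem_spec a i)]

theorem sum_smul_proj {a : Mat n} (hd : a.IsDiag) : ∑ μ ∈ spec a, μ • proj a μ = a := by
  simp only [proj, ← Matrix.diagonal_smul]
  rw [diagonal_sum]
  conv_rhs => rw [← hd.diagonal_diag]
  congr 1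
  funext i
  simp [spec]

theorem lie_proj_of_lie {a : Mat n} (hd : a.IsDiag) {z : Mat n} (hz : ⁅z, a⁆ = 0) (μ : ℂ) :
    ⁅z, proj a μ⁆ = 0 := by
  ext i j
  rw [Ring.lie_def, Matrix.sub_apply, proj, Matrix.mul_diagonal, Matrix.diagonal_mul]
  rcases eq_zero_or_of_lie hd hz i j with h1 | h1
  · simp [h1]
  · simp [h1]

theorem lie_proj_self {a : Mat n} (hd : a.IsDiag) (μ : ℂ) : ⁅proj a μ, a⁆ = 0 := by
  ext i j
  rw [lie_diag_apply hd]
  by_cases h : i = j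
  · simp [h]
  · simp [proj, h]

theorem piPerp_eq_self_of_proj {a y : Mat n} (h : ∀ μ ∈ spec a, proj a μ * y * proj a μ = 0) :
    piPerp a y = y := by
  ext i j
  by_cases hij : a i i = a j j
  · have h1 := congrFun (congrFun (h (a i i) (apply_mem_spec a i)) i) j
    rw [proj, Matrix.mul_diagonal, Matrix.diagonal_mul] at h1
    simp only [hij, if_true, one_mul, mul_one, Matrix.zero_apply] at h1
    simp [piPerp, hij, h1]
  · simp [piPerp, hij]

/-- Writing the spectral projections as polynomials with fixed coefficients makes sense along the
whole orbit and makes them differentiable functions of the path. -/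
theorem aeval_basis_proj {a : Mat n} (hd : a.IsDiag) {μ : ℂ} (hμ : μ ∈ spec a) :
    Polynomial.aeval a (Lagrange.basis (spec a) id μ) = proj a μ := by
  have h0 : ∀ (d : Fin n → ℂ) (p : Polynomial ℂ), Polynomial.aeval (Matrix.diagonal d) p =
      Matrix.diagonal fun i => p.eval (d i) := by
    intro d p
    have h1 := Polynomial.aeval_algHom_apply (Matrix.diagonalAlgHom ℂ (n := Fin n) (α := ℂ)) d p
    rw [Matrix.diagonalAlgHom_apply] at h1
    rw [h1, Matrix.diagonalAlgHom_apply]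
    congr 1
    funext i
    rw [Polynomial.aeval_pi_apply]
    simp
  have h1 := h0 a.diag (Lagrange.basis (spec a) id μ)
  rw [hd.diagonal_diag] at h1
  rw [h1, proj]
  congr 1
  funext i
  rw [Matrix.diag_apply]
  split_ifs with h
  · rw [h]
    exact Lagrange.eval_basis_self (v := id) Function.injective_id.injOn hμ
  · exact Lagrange.eval_basis_of_ne (v := id) (Ne.symm h)
      (apply_mem_spec a i)

theorem aeval_conj {a g : Mat n} (hg : g ∈ Matrix.unitaryGroup (Fin n) ℂ) (p : Polynomial ℂ) :
    Polynomial.aeval (g * a * star g) p = g * Polynomial.aeval a p * star g := by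
  have h1 : g * star g = 1 := Matrix.mem_unitaryGroup_iff.1 hg
  have h2 : star g * g = 1 := Matrix.mem_unitaryGroup_iff'.1 hg
  induction p using Polynomial.induction_on' with
  | add p q hp hq => simp only [map_add, hp, hq, mul_add, add_mul]
  | monomial k c =>
    have h3 : ∀ k : ℕ, (g * a * star g) ^ k = g * a ^ k * star g := by
      intro k
      induction k with
      | zero => simp [h1]
      | succ k ih =>
        rw [pow_succ, ih, pow_succ]
        calc _ = g * a ^ k * (star g * g) * a * star g := by noncomm_ring
          _ = _ := by rw [h2]; noncomm_ring
    rw [Polynomial.aeval_monomial, Polynomial.aeval_monomial, h3]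
    simp only [← Algebra.smul_def, mul_smul_comm, smul_mul_assoc]

end DiagonalAlgebra

/-! ### Unitary solutions have Schwartz derivatives -/

section Bootstrap

variable {n : ℕ}

/-- Differentiating `F φ` gives `F (r φ + φ_x)`, so the `m`-th derivative is `F` times an iterate of
`T` on `φ`; the unitary factor does not affect its norm. -/
theorem exists_schwartz_mul {F : ℝ → Mat n} {r : 𝓢(ℝ, Mat n)}
    (hF : ∀ x, F x ∈ Matrix.unitaryGroup (Fin n) ℂ) (hd : ∀ x, HasDerivAt F (F x * r x) x)
    (φ : 𝓢(ℝ, Mat n)) : ∃ ψ : 𝓢(ℝ, Mat n), ∀ x, ψ x = F x * φ x := by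
  set T : 𝓢(ℝ, Mat n) → 𝓢(ℝ, Mat n) := fun φ => sm n r φ + D n φ with hT
  have hd1 : ∀ (φ : 𝓢(ℝ, Mat n)) x, HasDerivAt (fun x => F x * φ x) (F x * T φ x) x := by
    intro φ x
    have h1 := (hd x).mul (hasDerivAt_D φ x)
    convert! h1 using 1
    rw [hT, add_apply, sm_apply]
    noncomm_ring
  have h2 : ∀ (m : ℕ) (φ : 𝓢(ℝ, Mat n)),
      iteratedDeriv m (fun x => F x * φ x) = fun x => F x * (T^[m] φ) x := by
    intro m
    induction m with
    | zero => intro φ; simp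
    | succ m ih =>
      intro φ
      rw [iteratedDeriv_succ', show deriv (fun x => F x * φ x) = fun x => F x * T φ x from
        funext fun x => (hd1 φ x).deriv, ih, Function.iterate_succ_apply]
  refine ⟨⟨fun x => F x * φ x, ?_, fun k m => ?_⟩, fun x => rfl⟩
  · refine contDiff_of_differentiable_iteratedDeriv fun m _ => ?_
    rw [h2]
    exact fun x => (hd1 _ x).differentiableAt
  · obtain ⟨C, hC⟩ := (T^[m] φ).decay k 0
    refine ⟨C, fun x => ?_⟩
    rw [norm_iteratedFDeriv_eq_norm_iteratedDeriv, h2]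
    have h3 : ‖F x * (T^[m] φ) x‖ = ‖(T^[m] φ) x‖ :=
      CStarRing.norm_coe_unitary_mul ⟨_, hF x⟩ _
    rw [h3]
    simpa using hC.2 x

theorem exists_bd_of_solution {F : ℝ → Mat n} {r : 𝓢(ℝ, Mat n)}
    (hF : ∀ x, F x ∈ Matrix.unitaryGroup (Fin n) ℂ) (hd : ∀ x, HasDerivAt F (F x * r x) x)
    (ht : Tendsto F atBot (𝓝 1)) :
    ∃ h : Bd n, ev h = F ∧ h.1 = 1 ∧ h.2 = lm n h r := by
  obtain ⟨ψ, hψ⟩ := exists_schwartz_mul hF hd r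
  have h1 : ev ((1 : Mat n), ψ) = F := ev_eq (fun x => by simpa [hψ] using hd x) ht
  refine ⟨(1, ψ), h1, rfl, ?_⟩
  ext1 x
  rw [lm_apply, h1, hψ]

end Bootstrap

/-! ### Polynomials in maps with Schwartz derivative -/

section Polynomials

variable {n : ℕ}

/-- Powers of a map with Schwartz derivative. -/
def powB (b : Bd n) : ℕ → Bd n
  | 0 => (1, 0)
  | k + 1 => bm n (powB b k) b

/-- Polynomials in a map with Schwartz derivative. -/
def polyB (p : Polynomial ℂ) (b : Bd n) : Bd n :=
  ∑ k ∈ p.support, bm n (p.coeff k • (1 : Mat n), 0) (powB b k)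

theorem ev_sum {ι : Type*} (s : Finset ι) (b : ι → Bd n) (x : ℝ) :
    ev (∑ i ∈ s, b i) x = ∑ i ∈ s, ev (b i) x := by
  classical
  induction s using Finset.induction_on with
  | empty => exact (ev_const (0 : Mat n) x).trans (by simp)
  | insert i s hi ih => rw [Finset.sum_insert hi, Finset.sum_insert hi, ev_add, ih]

theorem ev_powB (b : Bd n) (k : ℕ) (x : ℝ) : ev (powB b k) x = ev b x ^ k := by
  induction k with
  | zero => exact (ev_const (1 : Mat n) x).trans (pow_zero _).symm
  | succ k ih => rw [powB, ev_bm, ih, pow_succ]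

theorem ev_polyB (p : Polynomial ℂ) (b : Bd n) (x : ℝ) :
    ev (polyB p b) x = Polynomial.aeval (ev b x) p := by
  rw [polyB, ev_sum, Polynomial.aeval_def, Polynomial.eval₂_eq_sum, Polynomial.sum]
  refine Finset.sum_congr rfl fun k _ => ?_
  rw [ev_bm, ev_const, ev_powB, smul_mul_assoc, one_mul, Algebra.smul_def]

theorem hasCurveDeriv_bm {c d : ℝ → Bd n} {v w : Bd n} {I : Set ℝ} {t : ℝ}
    (h : HasCurveDeriv c v I t) (h' : HasCurveDeriv d w I t) :
    HasCurveDeriv (fun s => bm n (c s) (d s)) (bm n v (d t) + bm n (c t) w) I t :=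
  h.bilin (bm n) continuous_bm h'

theorem hasCurveDeriv_lm {c : ℝ → Bd n} {d : ℝ → 𝓢(ℝ, Mat n)} {v : Bd n} {w : 𝓢(ℝ, Mat n)}
    {I : Set ℝ} {t : ℝ} (h : HasCurveDeriv c v I t) (h' : HasCurveDeriv d w I t) :
    HasCurveDeriv (fun s => lm n (c s) (d s)) (lm n v (d t) + lm n (c t) w) I t :=
  h.bilin (lm n) continuous_lm h'

theorem hasCurveDeriv_rm {c : ℝ → Bd n} {d : ℝ → 𝓢(ℝ, Mat n)} {v : Bd n} {w : 𝓢(ℝ, Mat n)}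
    {I : Set ℝ} {t : ℝ} (h : HasCurveDeriv c v I t) (h' : HasCurveDeriv d w I t) :
    HasCurveDeriv (fun s => rm n (c s) (d s)) (rm n v (d t) + rm n (c t) w) I t :=
  h.bilin (rm n) continuous_rm h'

theorem hasCurveDeriv_sm {c d : ℝ → 𝓢(ℝ, Mat n)} {v w : 𝓢(ℝ, Mat n)} {I : Set ℝ} {t : ℝ}
    (h : HasCurveDeriv c v I t) (h' : HasCurveDeriv d w I t) :
    HasCurveDeriv (fun s => sm n (c s) (d s)) (sm n v (d t) + sm n (c t) w) I t :=
  h.bilin (sm n) continuous_sm h'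

theorem exists_hasCurveDeriv_polyB (p : Polynomial ℂ) {c : ℝ → Bd n} {v : Bd n} {I : Set ℝ} {t : ℝ}
    (h : HasCurveDeriv c v I t) : ∃ w, HasCurveDeriv (fun s => polyB p (c s)) w I t := by
  have h1 : ∀ k, ∃ w, HasCurveDeriv (fun s => powB (c s) k) w I t := by
    intro k
    induction k with
    | zero => exact ⟨0, hasCurveDeriv_const _⟩
    | succ k ih =>
      obtain ⟨w, hw⟩ := ih
      exact ⟨_, hasCurveDeriv_bm hw h⟩
  choose w hw using h1
  exact ⟨_, HasCurveDeriv.sum p.support fun k _ =>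
    hasCurveDeriv_bm (hasCurveDeriv_const (p.coeff k • (1 : Mat n), (0 : 𝓢(ℝ, Mat n)))) (hw k)⟩

end Polynomials

/-! ### Parallel transport of spectral projections -/

section Transport

/-- Kato's formula: the operator `∑ P_i' P_i` generates the transport of a moving family of
projections, and the vanishing of its diagonal blocks makes this transport parallel. The hypothesis
on `P'` is the differentiated orthogonality relation. -/
theorem transport_identities {R ι : Type*} [Ring R] [DecidableEq ι] {s : Finset ι} {P P' : ι → R}
    (hP : ∀ i j, i ∈ s → j ∈ s → P i * P j = if i = j then P i else 0)
    (hP' : ∀ i j, i ∈ s → j ∈ s → P' i * P j + P i * P' j = if i = j then P' i else 0)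
    (hs : ∑ i ∈ s, P i = 1) {j : ι} (hj : j ∈ s) :
    (∑ i ∈ s, P' i * P i) * P j - P j * (∑ i ∈ s, P' i * P i) = P' j ∧
      P j * (∑ i ∈ s, P' i * P i) * P j = 0 := by
  have h1 : (∑ i ∈ s, P' i * P i) * P j = P' j * P j := by
    rw [Finset.sum_mul, Finset.sum_eq_single_of_mem j hj]
    · rw [mul_assoc, hP j j hj hj, if_pos rfl]
    · intro i hi hij
      rw [mul_assoc, hP i j hi hj, if_neg hij, mul_zero]
  have h2 : P j * (∑ i ∈ s, P' i * P i) = P' j * P j - P' j := by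
    have h3 : ∀ i ∈ s, P j * (P' i * P i) = (if j = i then P' j * P i else 0) - P' j * P i := by
      intro i hi
      have h4 : P j * P' i = (if j = i then P' j else 0) - P' j * P i :=
        eq_sub_of_add_eq' (hP' j i hj hi)
      rw [← mul_assoc, h4, sub_mul, mul_assoc, hP i i hi hi, if_pos rfl]
      split_ifs <;> simp
    rw [Finset.mul_sum, Finset.sum_congr rfl h3, Finset.sum_sub_distrib, Finset.sum_ite_eq,
      if_pos hj, ← Finset.mul_sum, hs, mul_one]
  have h5 : P j * P j = P j := by rw [hP j j hj hj, if_pos rfl]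
  refine ⟨?_, ?_⟩
  · rw [h1, h2]
    abel
  · rw [h2, sub_mul, mul_assoc, h5, sub_self]

end Transport

/-! ### Frames -/

section Frames

variable {n : ℕ} {a : Mat n}

/-- A path, as a map with Schwartz derivative. -/
def Path.bd (γ : Path a) : Bd n := (a, γ.vel)

theorem Path.ev_bd (γ : Path a) : ev γ.bd = γ := ev_eq γ.hasDerivAt γ.tendsto

theorem Path.ext' {γ γ' : Path a} (h : (γ : ℝ → Mat n) = γ') : γ = γ' := by
  have h1 : γ.bd = γ'.bd := ev_injective (by rw [γ.ev_bd, γ'.ev_bd, h])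
  have h2 : γ.vel = γ'.vel := congrArg Prod.snd h1
  cases γ
  cases γ'
  simp only at h h2
  subst h h2
  rfl

theorem S_star (q : S a) (x : ℝ) : star (q.1 x) = -q.1 x := (q.2 x).1

theorem mul_star_of_unitary {g : Mat n} (h : g ∈ Matrix.unitaryGroup (Fin n) ℂ) : g * star g = 1 :=
  Matrix.mem_unitaryGroup_iff.1 h

theorem star_mul_of_unitary {g : Mat n} (h : g ∈ Matrix.unitaryGroup (Fin n) ℂ) : star g * g = 1 :=
  Matrix.mem_unitaryGroup_iff'.1 h

theorem exists_frame_of_S (q : S a) : ∃ (γ : Path a) (g : ℝ → Mat n), IsFrame a γ q g := by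
  obtain ⟨F, hF, hFd, hFt⟩ := exists_unitary_solution q.1 (S_star q)
  obtain ⟨h, rfl, h1, h2⟩ := exists_bd_of_solution hF hFd hFt
  set b : Bd n := bm n (bm n h (a, 0)) (starB n h) with hb
  have hev : ∀ x, ev b x = ev h x * a * star (ev h x) := fun x => by
    rw [hb, ev_bm, ev_bm, ev_const, ev_starB]
  have hb1 : b.1 = a := by
    rw [hb, bm_fst, bm_fst, starB_fst, h1, star_one, one_mul, mul_one]
  exact ⟨⟨ev b, b.2, hasDerivAt_ev b, fun x => ⟨ev h x, hF x, hev x⟩, hb1 ▸ tendsto_ev b⟩, ev h,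
    ⟨hF, hFd, hFt, hev⟩⟩

theorem IsFrame.exists_bd {γ : Path a} {q : S a} {g : ℝ → Mat n} (h : IsFrame a γ q g) :
    ∃ b : Bd n, ev b = g ∧ b.1 = 1 ∧ b.2 = lm n b q.1 :=
  exists_bd_of_solution h.unitary h.hasDerivAt h.tendsto

theorem IsFrame.path_unique {γ γ' : Path a} {q : S a} {g g' : ℝ → Mat n} (h : IsFrame a γ q g)
    (h' : IsFrame a γ' q g') : γ = γ' := by
  have h1 : g = g' := unitary_solution_unique (S_star q) h'.unitary h.hasDerivAt h'.hasDerivAt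
    h.tendsto h'.tendsto
  refine Path.ext' (funext fun x => ?_)
  rw [h.eq, h'.eq, h1]

/-- Two frames differ by `k = g* g'`, which commutes with `a` because both conjugate `a` to `γ`. So
`k_x` is block diagonal, while `k_x = k q' - q k` is off-diagonal; hence `k` is constant and equal
to `1`. -/
theorem IsFrame.unique (hd : a.IsDiag) {γ : Path a} {q q' : S a} {g g' : ℝ → Mat n}
    (h : IsFrame a γ q g) (h' : IsFrame a γ q' g') : q = q' ∧ g = g' := by
  set k : ℝ → Mat n := fun x => star (g x) * g' x with hk
  have hkd : ∀ x, HasDerivAt k (k x * q'.1 x - q.1 x * k x) x := by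
    intro x
    have h1 := (h.hasDerivAt x).star.mul (h'.hasDerivAt x)
    convert! h1 using 1
    simp only [hk]
    rw [star_mul, S_star]
    noncomm_ring
  have hka : ∀ x, ⁅k x, a⁆ = 0 := by
    intro x
    have h1 : g x * a * star (g x) = g' x * a * star (g' x) := by rw [← h.eq, ← h'.eq]
    have h2 : star (g x) * (g x * a * star (g x)) * g' x =
        star (g x) * (g' x * a * star (g' x)) * g' x := by rw [h1]
    have h3 : star (g x) * (g x * a * star (g x)) * g' x = a * k x := by
      calc _ = (star (g x) * g x) * a * (star (g x) * g' x) := by noncomm_ring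
        _ = _ := by rw [star_mul_of_unitary (h.unitary x), one_mul]
    have h4 : star (g x) * (g' x * a * star (g' x)) * g' x = k x * a := by
      calc _ = (star (g x) * g' x) * a * (star (g' x) * g' x) := by noncomm_ring
        _ = _ := by rw [star_mul_of_unitary (h'.unitary x), mul_one]
    rw [Ring.lie_def, ← h3, ← h4, h2, sub_self]
  have hoff : ∀ x, piPerp a (k x * q'.1 x - q.1 x * k x) = k x * q'.1 x - q.1 x * k x := by
    intro x
    rw [piPerp_sub, piPerp_mul_left hd (hka x), piPerp_mul_right hd (hka x),
      ((mem_perp_iff hd).1 (q.2 x)).2, ((mem_perp_iff hd).1 (q'.2 x)).2]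
  have hzero : ∀ x, k x * q'.1 x - q.1 x * k x = 0 := by
    intro x
    have h1 : HasDerivAt (fun x => offL a (k x)) (offL a (k x * q'.1 x - q.1 x * k x)) x :=
      (offL a).hasFDerivAt.comp_hasDerivAt x (hkd x)
    have h2 : (fun x => offL a (k x)) = fun _ => 0 :=
      funext fun x => (piPerp_eq_zero_iff hd).2 (hka x)
    rw [h2, offL_apply, hoff] at h1
    exact h1.unique (hasDerivAt_const x 0)
  have hk1 : k = fun _ => 1 := by
    refine eq_of_hasDerivAt_of_tendsto (f' := fun _ => 0) (c := 1) (fun x => ?_)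
      (fun x => hasDerivAt_const _ _) ?_ tendsto_const_nhds
    · have := hkd x
      rwa [hzero] at this
    · simpa using h.tendsto.star.mul h'.tendsto
  refine ⟨?_, ?_⟩
  · refine Subtype.ext (SchwartzMap.ext fun x => ?_)
    have h1 := hzero x
    rw [hk1, one_mul, mul_one] at h1
    exact (sub_eq_zero.1 h1).symm
  · funext x
    have h1 : star (g x) * g' x = 1 := congrFun hk1 x
    calc g x = g x * (star (g x) * g' x) := by rw [h1, mul_one]
      _ = (g x * star (g x)) * g' x := by rw [mul_assoc]
      _ = g' x := by rw [mul_star_of_unitary (h.unitary x), one_mul]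

variable (a) in
/-- The spectral projections of a path. -/
def projB (b : Bd n) (μ : ℂ) : Bd n := polyB (Lagrange.basis (spec a) id μ) b

variable (a) in
/-- The generator of the parallel transport along a path. -/
def transport (b : Bd n) : 𝓢(ℝ, Mat n) := ∑ μ ∈ spec a, rm n (projB a b μ) (projB a b μ).2

theorem ev_projB (hd : a.IsDiag) (γ : Path a) {μ : ℂ} (hμ : μ ∈ spec a) {g : Mat n} {x : ℝ}
    (hg : g ∈ Matrix.unitaryGroup (Fin n) ℂ) (hγ : γ x = g * a * star g) :
    ev (projB a γ.bd μ) x = g * proj a μ * star g := by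
  rw [projB, ev_polyB, γ.ev_bd, hγ, aeval_conj hg, aeval_basis_proj hd hμ]

theorem schwartz_sum_apply {ι : Type*} (s : Finset ι) (f : ι → 𝓢(ℝ, Mat n)) (x : ℝ) :
    (∑ i ∈ s, f i) x = ∑ i ∈ s, f i x := by
  classical
  induction s using Finset.induction_on with
  | empty => simp
  | insert i s hi ih => rw [Finset.sum_insert hi, Finset.sum_insert hi, add_apply, ih]

theorem transport_apply (b : Bd n) (x : ℝ) :
    transport a b x = ∑ μ ∈ spec a, (projB a b μ).2 x * ev (projB a b μ) x := by
  rw [transport, schwartz_sum_apply]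
  rfl

/-- The relations among the projections `P_i` hold at every point, so they may be differentiated in
`x`. Skewness comes from `∑ (P_i' P_i + P_i P_i') = ∑ P_i' = 0`, the equation for `γ_x` from `γ = ∑
i P_i` with `i` running over the eigenvalues. -/
theorem transport_spec (hd : a.IsDiag) (γ : Path a) (x : ℝ) :
    star (transport a γ.bd x) = -transport a γ.bd x ∧
      γ.vel x = transport a γ.bd x * γ x - γ x * transport a γ.bd x ∧
      ∀ μ ∈ spec a, ev (projB a γ.bd μ) x * transport a γ.bd x * ev (projB a γ.bd μ) x = 0 := by
  classical
  set P : ℂ → Mat n := fun μ => ev (projB a γ.bd μ) x with hP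
  set P' : ℂ → Mat n := fun μ => (projB a γ.bd μ).2 x with hP'
  have key : ∀ y, ∃ g, g ∈ Matrix.unitaryGroup (Fin n) ℂ ∧ γ y = g * a * star g := γ.mem
  have hmul : ∀ i j, i ∈ spec a → j ∈ spec a → ∀ y, ev (projB a γ.bd i) y * ev (projB a γ.bd j) y =
      if i = j then ev (projB a γ.bd i) y else 0 := by
    intro i j hi hj y
    obtain ⟨g, hg, hγ⟩ := key y
    rw [ev_projB hd γ hi hg hγ, ev_projB hd γ hj hg hγ]
    have : g * proj a i * star g * (g * proj a j * star g) =
        g * (proj a i * proj a j) * star g := by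
      calc _ = g * proj a i * (star g * g) * proj a j * star g := by noncomm_ring
        _ = _ := by rw [star_mul_of_unitary hg]; noncomm_ring
    rw [this]
    split_ifs with h
    · rw [h, proj_mul_self]
    · rw [proj_mul_ne a h, mul_zero, zero_mul]
  have hmul' : ∀ i j, i ∈ spec a → j ∈ spec a → P' i * P j + P i * P' j =
      if i = j then P' i else 0 := by
    intro i j hi hj
    have h1 := (hasDerivAt_ev (projB a γ.bd i) x).mul (hasDerivAt_ev (projB a γ.bd j) x)
    have h2 : (ev (projB a γ.bd i) * ev (projB a γ.bd j)) =
        fun y => if i = j then ev (projB a γ.bd i) y else 0 := funext (hmul i j hi hj)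
    rw [h2] at h1
    refine h1.unique ?_
    split_ifs with h
    · exact hasDerivAt_ev _ x
    · exact hasDerivAt_const x 0
  have hsum : ∀ y, ∑ i ∈ spec a, ev (projB a γ.bd i) y = 1 := by
    intro y
    obtain ⟨g, hg, hγ⟩ := key y
    rw [Finset.sum_congr rfl fun i hi => ev_projB hd γ hi hg hγ, ← Finset.sum_mul,
      ← Finset.mul_sum, sum_proj, mul_one, mul_star_of_unitary hg]
  have hsum' : ∑ i ∈ spec a, P' i = 0 := by
    have h1 := HasDerivAt.fun_sum fun i (_ : i ∈ spec a) => hasDerivAt_ev (projB a γ.bd i) x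
    have h2 : (fun y => ∑ i ∈ spec a, ev (projB a γ.bd i) y) = fun _ => 1 := funext hsum
    rw [h2] at h1
    exact h1.unique (hasDerivAt_const x 1)
  have hstar : ∀ i ∈ spec a, ∀ y, star (ev (projB a γ.bd i) y) = ev (projB a γ.bd i) y := by
    intro i hi y
    obtain ⟨g, hg, hγ⟩ := key y
    rw [ev_projB hd γ hi hg hγ, star_mul, star_mul, star_star, star_proj, mul_assoc]
  have hstar' : ∀ i ∈ spec a, star (P' i) = P' i := by
    intro i hi
    have h1 := (hasDerivAt_ev (projB a γ.bd i) x).star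
    have h2 : (fun y => star (ev (projB a γ.bd i) y)) = ev (projB a γ.bd i) :=
      funext (hstar i hi)
    rw [h2] at h1
    exact h1.unique (hasDerivAt_ev _ x)
  have hγ : ∀ y, γ y = ∑ i ∈ spec a, i • ev (projB a γ.bd i) y := by
    intro y
    obtain ⟨g, hg, hγ⟩ := key y
    rw [Finset.sum_congr rfl fun i hi => by rw [ev_projB hd γ hi hg hγ, ← smul_mul_assoc,
      ← mul_smul_comm], ← Finset.sum_mul, ← Finset.mul_sum, sum_smul_proj hd, hγ]
  have hγ' : γ.vel x = ∑ i ∈ spec a, i • P' i := by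
    have h1 := HasDerivAt.fun_sum fun i (_ : i ∈ spec a) =>
      (hasDerivAt_ev (projB a γ.bd i) x).const_smul i
    have h2 : (γ : ℝ → Mat n) = fun y => ∑ i ∈ spec a, i • ev (projB a γ.bd i) y := funext hγ
    have h3 := γ.hasDerivAt x
    rw [h2] at h3
    exact h3.unique h1
  have ht : transport a γ.bd x = ∑ i ∈ spec a, P' i * P i := transport_apply _ x
  have hid : ∀ j ∈ spec a, _ := fun j hj => transport_identities (P := P) (P' := P')
    (fun i j hi hj => hmul i j hi hj x) hmul' (hsum x) hj
  rw [ht]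
  refine ⟨?_, ?_, fun μ hμ => (hid μ hμ).2⟩
  · rw [eq_neg_iff_add_eq_zero, star_sum, ← Finset.sum_add_distrib, ← hsum']
    refine Finset.sum_congr rfl fun i hi => ?_
    rw [star_mul, hstar i hi, hstar' i hi, add_comm]
    simpa using hmul' i i hi hi
  · rw [hγ', hγ x, Finset.mul_sum, Finset.sum_mul, ← Finset.sum_sub_distrib]
    refine Finset.sum_congr rfl fun i hi => ?_
    rw [mul_smul_comm, smul_mul_assoc, ← smul_sub, (hid i hi).1]

/-- Solve `F_x = -F σ` and take `g = F*`. The explicit formula for `q` is kept because it shows how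
`q` depends on the path. -/
theorem exists_frame (hd : a.IsDiag) (γ : Path a) :
    ∃ (q : S a) (g : ℝ → Mat n), IsFrame a γ q g ∧
      ∀ x, q.1 x = star (g x) * transport a γ.bd x * g x := by
  set σ := transport a γ.bd with hσ
  have hspec := transport_spec hd γ
  have hskew : ∀ x, star (σ x) = -σ x := fun x => (hspec x).1
  obtain ⟨F, hF, hFd, hFt⟩ := exists_unitary_solution (-σ) (fun x => by simp [hskew])
  obtain ⟨h, rfl, h1, h2⟩ := exists_bd_of_solution hF hFd hFt
  have hFd' : ∀ x, HasDerivAt (fun x => star (ev h x)) (σ x * star (ev h x)) x := by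
    intro x
    convert! (hFd x).star using 1
    simp [hskew]
  -- The derivative is `F (γ_x - [σ, γ]) F*`, which vanishes, and the limit at `-∞` is `a`.
  have hconst : (fun x => ev h x * γ x * star (ev h x)) = fun _ => a := by
    refine eq_of_hasDerivAt_of_tendsto (f' := fun _ => 0) (c := a) (fun x => ?_)
      (fun x => hasDerivAt_const _ _) ?_ tendsto_const_nhds
    · convert! ((hFd x).mul (γ.hasDerivAt x)).mul (hFd' x) using 1
      rw [(hspec x).2.1, ← hσ]
      simp only [neg_apply, Pi.mul_apply]
      noncomm_ring
    · simpa using (hFt.mul γ.tendsto).mul hFt.star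
  have hγ : ∀ x, γ x = star (ev h x) * a * star (star (ev h x)) := by
    intro x
    have h3 : ev h x * γ x * star (ev h x) = a := congrFun hconst x
    rw [star_star, ← congrArg (fun y => star (ev h x) * y * ev h x) h3]
    calc γ x = (star (ev h x) * ev h x) * γ x * (star (ev h x) * ev h x) := by
          rw [star_mul_of_unitary (hF x), one_mul, mul_one]
      _ = _ := by noncomm_ring
  have hu : ∀ x, star (ev h x) ∈ Matrix.unitaryGroup (Fin n) ℂ := fun x =>
    Unitary.star_mem (hF x)
  set r : 𝓢(ℝ, Mat n) := lm n h (rm n (starB n h) σ) with hr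
  have hrx : ∀ x, r x = ev h x * (σ x * star (ev h x)) := fun x => by
    rw [hr, lm_apply, rm_apply, ev_starB]
  have hrp : ∀ x, r x ∈ perp a := by
    intro x
    refine (mem_perp_iff hd).2 ⟨mem_u_of_star ?_, piPerp_eq_self_of_proj fun μ hμ => ?_⟩
    · rw [hrx, star_mul, star_mul, star_star, hskew]
      noncomm_ring
    · have h3 := (hspec x).2.2 μ hμ
      rw [ev_projB hd γ hμ (hu x) (hγ x), star_star] at h3
      rw [hrx]
      calc proj a μ * (ev h x * (σ x * star (ev h x))) * proj a μ
          = (ev h x * star (ev h x)) * (proj a μ * (ev h x * (σ x * star (ev h x))) * proj a μ) *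
            (ev h x * star (ev h x)) := by rw [mul_star_of_unitary (hF x), one_mul, mul_one]
        _ = ev h x * (star (ev h x) * proj a μ * ev h x * σ x *
            (star (ev h x) * proj a μ * ev h x)) * star (ev h x) := by noncomm_ring
        _ = 0 := by rw [h3, mul_zero, zero_mul]
  refine ⟨⟨r, hrp⟩, fun x => star (ev h x), ⟨hu, fun x => ?_, by simpa using hFt.star, hγ⟩,
    fun x => by rw [star_star]; exact (hrx x).trans (mul_assoc _ _ _).symm⟩
  convert! hFd' x using 1
  change star (ev h x) * r x = _
  rw [hrx, ← mul_assoc, star_mul_of_unitary (hF x), one_mul]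

theorem isFrame_Phi (hd : a.IsDiag) (γ : Path a) : ∃ g, IsFrame a γ (Phi a γ) g := by
  have h : ∃ q : S a, ∃ g, IsFrame a γ q g := by
    obtain ⟨q, g, h, -⟩ := exists_frame hd γ
    exact ⟨q, g, h⟩
  rw [Phi, dif_pos h]
  exact h.choose_spec

theorem IsFrame.Phi_eq (hd : a.IsDiag) {γ : Path a} {q : S a} {g : ℝ → Mat n}
    (h : IsFrame a γ q g) : Phi a γ = q := by
  obtain ⟨g', h'⟩ := isFrame_Phi hd γ
  exact (h'.unique hd h).1

theorem existsUnique_frame (hd : a.IsDiag) (γ : Path a) :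
    ∃! p : S a × (ℝ → Mat n), IsFrame a γ p.1 p.2 := by
  obtain ⟨g, h⟩ := isFrame_Phi hd γ
  refine ⟨(Phi a γ, g), h, fun p hp => ?_⟩
  obtain ⟨h1, h2⟩ := hp.unique hd h
  exact Prod.ext h1 h2

theorem bijective_Phi (hd : a.IsDiag) : Function.Bijective (Phi a) := by
  refine ⟨fun γ γ' h => ?_, fun q => ?_⟩
  · obtain ⟨g, hg⟩ := isFrame_Phi hd γ
    obtain ⟨g', hg'⟩ := isFrame_Phi hd γ'
    rw [h] at hg
    exact hg.path_unique hg'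
  · obtain ⟨γ, g, h⟩ := exists_frame_of_S q
    exact ⟨γ, h.Phi_eq hd⟩

end Frames

/-! ### The development map along curves -/

section Development

variable {n : ℕ} {a : Mat n}

/-- Evaluation of Schwartz maps. -/
def evalS (n : ℕ) (x : ℝ) : 𝓢(ℝ, Mat n) →L[ℝ] Mat n :=
  (BoundedContinuousFunction.evalCLM ℝ x).comp
    (SchwartzMap.toBoundedContinuousFunctionCLM ℝ ℝ (Mat n))

theorem ev_zero_of_skew {p : 𝓢(ℝ, Mat n)} (hp : ∀ x, star (p x) = -p x) (x : ℝ) :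
    star (ev (0, p) x) = -ev (0, p) x := by
  have h1 : starB n (0, p) = (-1 : ℝ) • ((0 : Mat n), p) := by
    refine Prod.ext ?_ ?_
    · rw [starB_fst]
      simp
    · rw [starB_snd]
      ext1 x
      simp [hp]
  rw [← ev_starB, h1, ev_smul, neg_one_smul]

/-- The linearized gauge equation `ζ_x + [q, ζ] = v`, `ζ(-∞) = 0`. -/
structure IsGauge (q v : S a) (z : Bd n) : Prop where
  fst : z.1 = 0
  snd : ∀ x, z.2 x = v.1 x - ⁅q.1 x, ev z x⁆

/-- Conjugation by the frame turns `∂ + [q, ·]` into `∂`: the derivative of `g ζ g*` is `g (ζ_x +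
[q, ζ]) g*`. -/
theorem IsFrame.conj_gauge {γ : Path a} {q v : S a} {g : ℝ → Mat n} (hg : IsFrame a γ q g)
    {z : Bd n} (hz : IsGauge q v z) {p : 𝓢(ℝ, Mat n)} (hp : ∀ x, p x = g x * v.1 x * star (g x))
    (x : ℝ) : ev (0, p) x = g x * ev z x * star (g x) := by
  have h1 : ev (0, p) = fun x => g x * ev z x * star (g x) := by
    refine ev_eq (fun x => ?_) ?_
    · convert! ((hg.hasDerivAt x).mul (hasDerivAt_ev z x)).mul (hg.hasDerivAt x).star using 1
      simp only [Pi.mul_apply]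
      rw [hz.snd, hp, star_mul, S_star, Ring.lie_def]
      noncomm_ring
    · have := tendsto_ev z
      rw [hz.fst] at this
      simpa using (hg.tendsto.mul this).mul hg.tendsto.star
  rw [h1]

/-- The solution is `g* (∫ g v g*) g`, integrating from `-∞`. -/
theorem IsFrame.exists_gauge {γ : Path a} {q : S a} {g : ℝ → Mat n} (hg : IsFrame a γ q g)
    (v : S a) : ∃ z : Bd n, IsGauge q v z := by
  obtain ⟨b, rfl, hb1, hb2⟩ := hg.exists_bd
  set p : 𝓢(ℝ, Mat n) := lm n b (rm n (starB n b) v.1) with hp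
  have hu := hg.unitary
  refine ⟨bm n (starB n b) (bm n (0, p) b), ?_, fun x => ?_⟩
  · rw [bm_fst, bm_fst, zero_mul, mul_zero]
  · rw [bm_snd, bm_snd, starB_snd, hb2, hp]
    simp only [add_apply, lm_apply, rm_apply, ev_bm, ev_starB, starS_apply, star_mul, S_star,
      Ring.lie_def]
    have h1 : star (ev b x) * (ev b x * (v.1 x * star (ev b x)) * ev b x) = v.1 x := by
      calc _ = (star (ev b x) * ev b x) * v.1 x * (star (ev b x) * ev b x) := by noncomm_ring
        _ = _ := by rw [star_mul_of_unitary (hu x), one_mul, mul_one]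
    rw [mul_add, h1]
    noncomm_ring

theorem IsFrame.skew_gauge {γ : Path a} {q v : S a} {g : ℝ → Mat n} (hg : IsFrame a γ q g)
    {z : Bd n} (hz : IsGauge q v z) (x : ℝ) : star (ev z x) = -ev z x := by
  obtain ⟨b, rfl, hb1, hb2⟩ := hg.exists_bd
  set p : 𝓢(ℝ, Mat n) := lm n b (rm n (starB n b) v.1) with hp
  have hpx : ∀ x, p x = ev b x * v.1 x * star (ev b x) := fun x => by
    rw [hp, lm_apply, rm_apply, ev_starB, mul_assoc]
  have h1 : ∀ x, ev z x = star (ev b x) * ev (0, p) x * ev b x := fun x => by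
    rw [hg.conj_gauge hz hpx]
    calc ev z x = (star (ev b x) * ev b x) * ev z x * (star (ev b x) * ev b x) := by
          rw [star_mul_of_unitary (hg.unitary x), one_mul, mul_one]
      _ = _ := by noncomm_ring
  have h2 := ev_zero_of_skew (p := p) (fun x => by
    rw [hpx, star_mul, star_mul, star_star, S_star]
    noncomm_ring) x
  rw [h1, star_mul, star_mul, star_star, h2]
  noncomm_ring

/-- The quotient frame `h_s = g_s g_t*` satisfies `h_x = h p` with `p_s = g_t (q_s - q_t) g_t*`,
which vanishes at `s = t`. Differentiating `γ_s = h_s γ_t h_s*` at `s = t` gives the commutator of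
`∫ g v g* = g ζ g*` with `γ_t`. -/
theorem hasVelocity_of_hasCurveDeriv (hd : a.IsDiag) {c : ℝ → Path a} {v : S a} {I : Set ℝ} {t : ℝ}
    (hc : HasCurveDeriv (fun s => Phi a (c s)) v I t) {g : ℝ → Mat n}
    (hg : IsFrame a (c t) (Phi a (c t)) g) {z : Bd n} (hz : IsGauge (Phi a (c t)) v z) :
    HasVelocity c (fun x => g x * ⁅ev z x, a⁆ * star (g x)) I t := by
  have hfr : ∀ s, ∃ b : Bd n, IsFrame a (c s) (Phi a (c s)) (ev b) ∧ b.1 = 1 ∧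
      b.2 = lm n b (Phi a (c s)).1 := by
    intro s
    obtain ⟨g, h⟩ := isFrame_Phi hd (c s)
    obtain ⟨b, hb, hb'⟩ := h.exists_bd
    exact ⟨b, hb ▸ h, hb'⟩
  choose b hb hb1 hb2 using hfr
  obtain rfl : ev (b t) = g := ((hb t).unique hd hg).2
  set h : ℝ → Bd n := fun s => bm n (b s) (starB n (b t)) with hh
  set p : ℝ → 𝓢(ℝ, Mat n) := fun s =>
    lm n (b t) (rm n (starB n (b t)) ((Phi a (c s)).1 - (Phi a (c t)).1)) with hp
  set p' : 𝓢(ℝ, Mat n) := lm n (b t) (rm n (starB n (b t)) v.1) with hp'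
  have hut := (hb t).unitary
  have hev : ∀ s x, ev (h s) x = ev (b s) x * star (ev (b t) x) := fun s x => by
    simp only [hh]
    rw [ev_bm, ev_starB]
  have h2 : ∀ s, (h s).2 = lm n (h s) (p s) := by
    intro s
    ext1 x
    simp only [hh, hp, bm_snd, hb2, starB_snd, add_apply, lm_apply, rm_apply, ev_bm, ev_starB,
      starS_apply, star_mul, S_star, sub_apply]
    calc _ = ev (b s) x * 1 * (((Phi a (c s)).1 x - (Phi a (c t)).1 x) * star (ev (b t) x)) := by
          noncomm_ring
      _ = _ := by
          rw [← star_mul_of_unitary (hut x)]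
          noncomm_ring
  have hpd : HasCurveDeriv p p' I t := by
    have h3 := hc.clm ((S a).subtypeL)
    have h4 := h3.add (hasCurveDeriv_const (-(Phi a (c t)).1))
    have h5 := hasCurveDeriv_lm (hasCurveDeriv_const (b t))
      (hasCurveDeriv_rm (hasCurveDeriv_const (starB n (b t))) h4)
    simpa [hp, hp', sub_eq_add_neg] using h5
  have hhd : HasCurveDeriv h (0, p') I t := by
    refine hasCurveDeriv_unitary (fun s x => ?_) h2 (fun s => ?_) ?_ hpd
    · rw [hev]
      exact mul_mem ((hb s).unitary x) (Unitary.star_mem (hut x))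
    · simp only [hh]
      rw [bm_fst, starB_fst, hb1, hb1, star_one, one_mul]
    · simp [hp]
  have hγ : ∀ s, (c s).bd = bm n (bm n (h s) (c t).bd) (starB n (h s)) := by
    intro s
    refine ev_injective (funext fun x => ?_)
    simp only [ev_bm, ev_starB, Path.ev_bd, hev]
    rw [(hb s).eq, (hb t).eq]
    simp only [star_mul, star_star]
    calc _ = ev (b s) x * 1 * a * 1 * star (ev (b s) x) := by noncomm_ring
      _ = _ := by
          rw [← star_mul_of_unitary (hut x)]
          noncomm_ring
  set β : Bd n := bm n (bm n (0, p') (c t).bd) (starB n (h t)) +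
    bm n (bm n (h t) (c t).bd) (starB n (0, p')) with hβ
  have hβd : HasCurveDeriv (fun s => (c s).bd) β I t := by
    have h3 := hasCurveDeriv_bm (hasCurveDeriv_bm hhd (hasCurveDeriv_const (c t).bd))
      (hhd.clm (starB n))
    simp only [map_zero, add_zero] at h3
    exact h3.congr fun s => (hγ s).symm
  have hβ1 : β.1 = 0 := by
    rw [hβ, Prod.fst_add, bm_fst, bm_fst, bm_fst, starB_fst, starB_fst]
    simp
  have hht : ∀ x, ev (h t) x = 1 := fun x => by rw [hev, mul_star_of_unitary (hut x)]
  have hpx : ∀ x, p' x = ev (b t) x * v.1 x * star (ev (b t) x) := fun x => by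
    rw [hp', lm_apply, rm_apply, ev_starB, mul_assoc]
  have hβev : ev β = fun x => ev (b t) x * ⁅ev z x, a⁆ * star (ev (b t) x) := by
    funext x
    have h3 : star (ev (0, p') x) = -ev (0, p') x := ev_zero_of_skew (fun x => by
      rw [hpx, star_mul, star_mul, star_star, S_star]
      noncomm_ring) x
    rw [hβ, ev_add]
    simp only [ev_bm, ev_starB, hht, h3, Path.ev_bd, star_one, mul_one, one_mul]
    rw [hg.conj_gauge hz hpx, (hb t).eq, Ring.lie_def]
    symm
    calc _ = ev (b t) x * ev z x * 1 * a * star (ev (b t) x) -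
          ev (b t) x * a * 1 * ev z x * star (ev (b t) x) := by noncomm_ring
      _ = _ := by
          rw [← star_mul_of_unitary (hut x)]
          noncomm_ring
  refine ⟨β.2, fun x => ?_, ?_, hβd.clm (ContinuousLinearMap.snd ℝ (Mat n) 𝓢(ℝ, Mat n))⟩
  · rw [← hβev]
    exact hasDerivAt_ev β x
  · rw [← hβev, ← hβ1]
    exact tendsto_ev β

theorem HasVelocity.unique {c : ℝ → Path a} {ξ ξ' : ℝ → Mat n} {I : Set ℝ} {t : ℝ}
    [(𝓝[I \ {t}] t).NeBot] (h : HasVelocity c ξ I t) (h' : HasVelocity c ξ' I t) : ξ = ξ' := by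
  obtain ⟨η, h1, h2, h3⟩ := h
  obtain ⟨η', h1', h2', h3'⟩ := h'
  obtain rfl := h3.unique h3'
  exact eq_of_hasDerivAt_of_tendsto h1 h1' h2 h2'

/-- The generator `σ_s` is built from `γ_s` by products and derivatives, so it is differentiable in
`s`. With `R_s = g_t* σ_s g_t` and `h_s = g_s* g_t` one has `h_x = h (R_t - R_s)` and `q_s = h_s R_s
h_s*`, so only differentiability of `h` at a vanishing coefficient is needed. -/
theorem exists_hasCurveDeriv_Phi (hd : a.IsDiag) {c : ℝ → Path a} {ξ : ℝ → Mat n} {I : Set ℝ}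
    {t : ℝ} [(𝓝[I \ {t}] t).NeBot] (hc : HasVelocity c ξ I t) :
    ∃ v : S a, HasCurveDeriv (fun s => Phi a (c s)) v I t := by
  obtain ⟨η, -, -, hη⟩ := hc
  have hγ : HasCurveDeriv (fun s => (c s).bd) (0, η) I t := (hasCurveDeriv_const a).prodMk hη
  obtain ⟨σ', hσ'⟩ : ∃ σ', HasCurveDeriv (fun s => transport a (c s).bd) σ' I t := by
    have h1 : ∀ μ, ∃ w, HasCurveDeriv (fun s => projB a (c s).bd μ) w I t := fun μ =>
      exists_hasCurveDeriv_polyB _ hγ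
    choose w hw using h1
    exact ⟨_, HasCurveDeriv.sum (spec a) fun μ _ => hasCurveDeriv_rm (hw μ)
      ((hw μ).clm (ContinuousLinearMap.snd ℝ (Mat n) 𝓢(ℝ, Mat n)))⟩
  have hfr : ∀ s, ∃ b : Bd n, IsFrame a (c s) (Phi a (c s)) (ev b) ∧ b.1 = 1 ∧
      b.2 = lm n b (Phi a (c s)).1 ∧
      ∀ x, (Phi a (c s)).1 x = star (ev b x) * transport a (c s).bd x * ev b x := by
    intro s
    obtain ⟨q, g, h, hq⟩ := exists_frame hd (c s)
    obtain rfl := h.Phi_eq hd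
    obtain ⟨b, rfl, hb'⟩ := h.exists_bd
    exact ⟨b, h, hb'.1, hb'.2, hq⟩
  choose b hb hb1 hb2 hb3 using hfr
  have hut := (hb t).unitary
  set σ : ℝ → 𝓢(ℝ, Mat n) := fun s => transport a (c s).bd with hσ
  set h : ℝ → Bd n := fun s => bm n (starB n (b s)) (b t) with hh
  set R : ℝ → 𝓢(ℝ, Mat n) := fun s => lm n (starB n (b t)) (rm n (b t) (σ s)) with hR
  have hRd : HasCurveDeriv R (lm n (starB n (b t)) (rm n (b t) σ')) I t := by
    have h5 := hasCurveDeriv_lm (hasCurveDeriv_const (starB n (b t)))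
      (hasCurveDeriv_rm (hasCurveDeriv_const (b t)) hσ')
    simpa using h5
  set p : ℝ → 𝓢(ℝ, Mat n) := fun s => R t - R s with hp
  have hev : ∀ s x, ev (h s) x = star (ev (b s) x) * ev (b t) x := fun s x => by
    simp only [hh]
    rw [ev_bm, ev_starB]
  have hRx : ∀ s x, R s x = star (ev (b t) x) * (σ s x * ev (b t) x) := fun s x => by
    simp only [hR]
    rw [lm_apply, rm_apply, ev_starB]
  have hq : ∀ s x, (Phi a (c s)).1 x = ev (h s) x * (R s x * star (ev (h s) x)) := by
    intro s x
    rw [hev, hRx, hb3, star_mul, star_star]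
    calc _ = star (ev (b s) x) * 1 * σ s x * 1 * ev (b s) x := by
          simp only [hσ]
          noncomm_ring
      _ = _ := by
          rw [← mul_star_of_unitary (hut x)]
          noncomm_ring
  have h2 : ∀ s, (h s).2 = lm n (h s) (p s) := by
    intro s
    ext1 x
    simp only [hh, hp, bm_snd, hb2, starB_snd, add_apply, lm_apply, rm_apply, ev_bm, ev_starB,
      starS_apply, star_mul, S_star, sub_apply]
    rw [hb3 t, hb3 s, hRx, hRx]
    have h3 := mul_star_of_unitary (hut x)
    have h4 := mul_star_of_unitary ((hb s).unitary x)
    calc _ = star (ev (b s) x) * (ev (b t) x * star (ev (b t) x)) * σ t x * ev (b t) x -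
          star (ev (b s) x) * σ s x * (ev (b s) x * star (ev (b s) x)) * ev (b t) x := by
          simp only [hσ]
          noncomm_ring
      _ = star (ev (b s) x) * (ev (b t) x * star (ev (b t) x)) * σ t x * ev (b t) x -
          star (ev (b s) x) * (ev (b t) x * star (ev (b t) x)) * σ s x * ev (b t) x := by
          rw [h3, h4]
          noncomm_ring
      _ = _ := by
          noncomm_ring
  have hpd : HasCurveDeriv p (-lm n (starB n (b t)) (rm n (b t) σ')) I t := by
    have h3 := (hasCurveDeriv_const (R t)).add
      (hRd.clm (-ContinuousLinearMap.id ℝ 𝓢(ℝ, Mat n)))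
    simpa [hp, sub_eq_add_neg] using h3
  have hhd := hasCurveDeriv_unitary (h := h) (fun s x => by
    rw [hev]
    exact mul_mem (Unitary.star_mem ((hb s).unitary x)) (hut x)) h2 (fun s => by
    simp only [hh]
    rw [bm_fst, starB_fst, hb1, hb1, star_one, one_mul]) (by simp [hp]) hpd
  have hqd := hasCurveDeriv_lm hhd (hasCurveDeriv_rm (hhd.clm (starB n)) hRd)
  have hq' : ∀ s, lm n (h s) (rm n (starB n (h s)) (R s)) = (Phi a (c s)).1 := by
    intro s
    ext1 x
    rw [hq, lm_apply, rm_apply, ev_starB]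
  replace hqd := hqd.congr hq'
  -- Only the existence of the derivative matters; its value is identified later by uniqueness of
  -- velocities.
  generalize lm n ((0 : Mat n), -lm n (starB n (b t)) (rm n (b t) σ'))
      (rm n (starB n (h t)) (R t)) + lm n (h t)
      (rm n (starB n ((0 : Mat n), -lm n (starB n (b t)) (rm n (b t) σ'))) (R t) +
        rm n (starB n (h t)) (lm n (starB n (b t)) (rm n (b t) σ'))) = v at hqd
  have hv : ∀ x, v x ∈ perp a := by
    intro x
    refine (isClosed_perp hd).mem_of_tendsto (hqd.clm (evalS n x)) (Eventually.of_forall fun s => ?_)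
    exact ((s - t)⁻¹ • (Phi a (c s) - Phi a (c t))).2 x
  exact ⟨⟨v, hv⟩, tendsto_subtype_rng.2 hqd⟩

theorem HasVelocity.exists_gauge (hd : a.IsDiag) {c : ℝ → Path a} {ξ : ℝ → Mat n} {I : Set ℝ}
    {t : ℝ} [(𝓝[I \ {t}] t).NeBot] (hc : HasVelocity c ξ I t) {g : ℝ → Mat n}
    (hg : IsFrame a (c t) (Phi a (c t)) g) :
    ∃ (v : S a) (z : Bd n), HasCurveDeriv (fun s => Phi a (c s)) v I t ∧
      IsGauge (Phi a (c t)) v z ∧ ξ = fun x => g x * ⁅ev z x, a⁆ * star (g x) := by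
  obtain ⟨v, hv⟩ := exists_hasCurveDeriv_Phi hd hc
  obtain ⟨z, hz⟩ := hg.exists_gauge v
  exact ⟨v, z, hv, hz, hc.unique (hasVelocity_of_hasCurveDeriv hd hv hg hz)⟩

/-- The straight line through `Phi a γ` is pulled back by the bijection `Phi`; this provides all the
test curves. -/
theorem exists_curve (hd : a.IsDiag) (γ : Path a) (v : S a) :
    ∃ c : ℝ → Path a, c 0 = γ ∧ HasCurveDeriv (fun s => Phi a (c s)) v Set.univ 0 := by
  choose c hc using fun s : ℝ => (bijective_Phi hd).2 (Phi a γ + s • v)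
  refine ⟨c, (bijective_Phi hd).1 (by rw [hc]; simp), ?_⟩
  simp only [hc]
  exact hasCurveDeriv_line _ _

theorem D_mem_perp (hd : a.IsDiag) {φ : 𝓢(ℝ, Mat n)} (hφ : ∀ x, φ x ∈ perp a) (x : ℝ) :
    D n φ x ∈ perp a := by
  refine (mem_perp_iff hd).2 ⟨mem_u_of_star ?_, ?_⟩
  · have h1 := (hasDerivAt_D φ x).star
    have h2 : (fun x => star (φ x)) = fun x => -φ x := funext fun x => (hφ x).1
    rw [h2] at h1
    exact h1.unique (hasDerivAt_D φ x).neg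
  · have h1 : HasDerivAt (fun x => offL a (φ x)) (offL a (D n φ x)) x :=
      (offL a).hasFDerivAt.comp_hasDerivAt x (hasDerivAt_D φ x)
    have h2 : (fun x => offL a (φ x)) = φ := funext fun x => ((mem_perp_iff hd).1 (hφ x)).2
    rw [h2] at h1
    exact h1.unique (hasDerivAt_D φ x)

theorem piPerp_ev (b : Bd n) (h1 : piPerp a b.1 = 0) (h2 : ∀ x, piPerp a (b.2 x) = 0) (x : ℝ) :
    piPerp a (ev b x) = 0 := by
  have h : (fun x => offL a (ev b x)) = fun _ => 0 := by
    refine eq_of_hasDerivAt_of_tendsto (f' := fun _ => 0) (c := 0) (fun x => ?_)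
      (fun x => hasDerivAt_const _ _) ?_ tendsto_const_nhds
    · rw [← h2 x]
      exact (offL a).hasFDerivAt.comp_hasDerivAt x (hasDerivAt_ev b x)
    · rw [← h1]
      exact ((offL a).continuous.tendsto _).comp (tendsto_ev b)
  exact congrFun h x

/-- Every Schwartz map into `u(n)_a^⊥` is `[ζ, a]` for a solution `ζ` of a linearized gauge
equation. -/
theorem exists_gauge_lie_eq (ha : a ∈ u n) (hd : a.IsDiag) (q φ : S a) :
    ∃ (v : S a) (z : Bd n), IsGauge q v z ∧ ∀ x, ⁅ev z x, a⁆ = φ.1 x := by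
  set ζ : 𝓢(ℝ, Mat n) := SchwartzMap.postcompCLM (invL a) φ.1 with hζ
  have hζx : ∀ x, ζ x = invL a (φ.1 x) := fun x => rfl
  have hζp : ∀ x, ζ x ∈ perp a := fun x => invL_mem ha hd (φ.2 x).1
  set X : 𝓢(ℝ, Mat n) := sm n q.1 ζ - sm n ζ q.1 with hX
  have hXx : ∀ x, X x = ⁅q.1 x, ζ x⁆ := fun x => by
    rw [hX, sub_apply, sm_apply, sm_apply, Ring.lie_def]
  set Y : 𝓢(ℝ, Mat n) := SchwartzMap.postcompCLM (offL a) X with hY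
  have hYx : ∀ x, Y x = piPerp a (X x) := fun x => rfl
  have hXu : ∀ x, X x ∈ u n := fun x => by
    rw [hXx]
    exact lie_mem_u (q.2 x).1 (hζp x).1
  have hYp : ∀ x, Y x ∈ perp a := fun x => piPerp_mem hd (hXu x)
  -- The off-diagonal part of the solution is `ζ`. Its block part `z₀` is forced by requiring `v` to
  -- be off-diagonal: its derivative is minus the block part of `[q, ζ]`. It need not decay at `+∞`.
  set z₀ : Bd n := (0, Y - X) with hz₀
  have hz₀a : ∀ x, ⁅ev z₀ x, a⁆ = 0 := fun x => by
    rw [← piPerp_eq_zero_iff hd]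
    refine piPerp_ev _ (piPerp_zero a) (fun x => ?_) x
    rw [hz₀, sub_apply, hYx, piPerp_sub, piPerp_piPerp, sub_self]
  have hz₀s : ∀ x, star (ev z₀ x) = -ev z₀ x := ev_zero_of_skew fun x => by
    rw [sub_apply, star_sub, (hYp x).1, mem_u.1 (hXu x)]
    abel
  set v : 𝓢(ℝ, Mat n) := D n ζ + Y + (rm n z₀ q.1 - lm n z₀ q.1) with hv
  have hvx : ∀ x, v x = D n ζ x + Y x + ⁅q.1 x, ev z₀ x⁆ := fun x => by
    rw [hv, add_apply, add_apply, sub_apply, rm_apply, lm_apply, Ring.lie_def]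
  have hvp : v ∈ S a := by
    refine (S a).add_mem ((S a).add_mem (D_mem_perp hd hζp) hYp) fun x => ?_
    rw [sub_apply, rm_apply, lm_apply, ← Ring.lie_def]
    refine (mem_perp_iff hd).2 ⟨lie_mem_u (q.2 x).1 (hz₀s x), ?_⟩
    rw [piPerp_lie_left hd (hz₀a x), ((mem_perp_iff hd).1 (q.2 x)).2]
  have hev : ∀ x, ev (toBd n ζ + z₀) x = ζ x + ev z₀ x := fun x => by rw [ev_add, ev_toBd]
  refine ⟨⟨v, hvp⟩, toBd n ζ + z₀, ⟨?_, fun x => ?_⟩, fun x => ?_⟩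
  · rw [hz₀, Prod.fst_add]
    simp [toBd]
  · rw [hev, hvx]
    change D n ζ x + (Y x - X x) = _
    rw [hXx]
    simp only [Ring.lie_def]
    noncomm_ring
  · rw [hev]
    have h1 : ⁅ζ x + ev z₀ x, a⁆ = ⁅ζ x, a⁆ + ⁅ev z₀ x, a⁆ := by
      simp only [Ring.lie_def]
      noncomm_ring
    rw [h1, hz₀a, add_zero, hζx, lie_invL hd, ((mem_perp_iff hd).1 (φ.2 x)).2]

theorem isTangent_of_S (ha : a ∈ u n) (hd : a.IsDiag) {γ : Path a} {g : ℝ → Mat n}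
    (hg : IsFrame a γ (Phi a γ) g) (φ : S a) :
    IsTangent γ (fun x => g x * φ.1 x * star (g x)) := by
  obtain ⟨v, z, hz, hzφ⟩ := exists_gauge_lie_eq ha hd (Phi a γ) φ
  obtain ⟨c, rfl, hc⟩ := exists_curve hd γ v
  refine ⟨c, rfl, ?_⟩
  simp only [← hzφ]
  exact hasVelocity_of_hasCurveDeriv hd hc hg hz

end Development

/-! ### The spectral hierarchy of a projection -/

section SpectralHierarchy

variable {n : ℕ}

/-- The map `y ↦ [y, e]`. -/
def lieL (e : Mat n) : Mat n →L[ℝ] Mat n :=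
  (ContinuousLinearMap.mul ℝ (Mat n)).flip e - ContinuousLinearMap.mul ℝ (Mat n) e

theorem lieL_apply (e y : Mat n) : lieL e y = ⁅y, e⁆ := rfl

/-- The map `y ↦ (1 - 2e) (y - piPerp a y)`. -/
def blockL (a e : Mat n) : Mat n →L[ℝ] Mat n :=
  (ContinuousLinearMap.mul ℝ (Mat n) (1 - 2 * e)).comp (ContinuousLinearMap.id ℝ (Mat n) - offL a)

theorem blockL_apply (a e y : Mat n) : blockL a e y = (1 - 2 * e) * (y - piPerp a y) := rfl

/-- The Schwartz coefficients `P_j`, `j ≥ 1`, of the formal series `P = e + ∑ P_j λ^{-j}` with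
`P² = P` and `[∂ + q + λ a, P] = 0`; the coefficient of index zero is set to zero. -/
def pS (a e : Mat n) (q : 𝓢(ℝ, Mat n)) : ℕ → 𝓢(ℝ, Mat n)
  | 0 => 0
  | j + 1 =>
    SchwartzMap.postcompCLM (invL a)
      (D n (pS a e q j) + (sm n q (pS a e q j) - sm n (pS a e q j) q) +
        -- The true coefficient of index zero is the constant `e`, which is not Schwartz; its
        -- contribution `[q, e]` is added by hand.
        if j = 0 then SchwartzMap.postcompCLM (lieL e) q else 0) +
    -- The block part `B` must solve `e B + B e - B + Y = 0`, where `Y` is the block part of the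
    -- interior Cauchy sum. As `B` commutes with `e` and `(1 - 2e)² = 1`, this gives `B = (1 - 2e)
    -- Y`.
    SchwartzMap.postcompCLM (blockL a e)
      (∑ i : Fin j, sm n (pS a e q (i + 1)) (pS a e q (j - i)))
  decreasing_by all_goals omega

/-- The coefficients of the series `P`. -/
def pC (a e : Mat n) (q : 𝓢(ℝ, Mat n)) (j : ℕ) (x : ℝ) : Mat n :=
  if j = 0 then e else pS a e q j x

theorem pS_zero (a e : Mat n) (q : 𝓢(ℝ, Mat n)) : pS a e q 0 = 0 := by rw [pS]

theorem pC_zero (a e : Mat n) (q : 𝓢(ℝ, Mat n)) (x : ℝ) : pC a e q 0 x = e := rfl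

theorem pC_succ (a e : Mat n) (q : 𝓢(ℝ, Mat n)) (j : ℕ) (x : ℝ) :
    pC a e q (j + 1) x = pS a e q (j + 1) x := rfl

theorem hasDerivAt_pC (a e : Mat n) (q : 𝓢(ℝ, Mat n)) (j : ℕ) (x : ℝ) :
    HasDerivAt (pC a e q j) (D n (pS a e q j) x) x := by
  rcases j with _ | j
  · have h1 : D n (pS a e q 0) x = 0 := by rw [pS_zero, map_zero]; rfl
    rw [h1]
    exact hasDerivAt_const x e
  · exact hasDerivAt_D (pS a e q (j + 1)) x

theorem pC_succ_eq (a e : Mat n) (q : 𝓢(ℝ, Mat n)) (j : ℕ) (x : ℝ) :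
    pC a e q (j + 1) x = invL a (D n (pS a e q j) x + ⁅q x, pC a e q j x⁆) +
      blockL a e (∑ i : Fin j, pC a e q (i + 1) x * pC a e q (j - i) x) := by
  rw [pC_succ, pS, add_apply]
  congr 1
  · change invL a _ = _
    congr 1
    rw [add_apply, add_apply, sub_apply, sm_apply, sm_apply, add_assoc]
    congr 1
    rcases j with _ | j
    · simp [pS_zero, pC_zero, lieL_apply, SchwartzMap.postcompCLM_apply]
    · simp [pC_succ, Ring.lie_def]
  · change blockL a e _ = _
    congr 1
    rw [schwartz_sum_apply]
    refine Finset.sum_congr rfl fun i _ => ?_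
    obtain ⟨k, hk⟩ : ∃ k, j - (i : ℕ) = k + 1 := ⟨j - i - 1, by have := i.2; omega⟩
    rw [sm_apply, hk]
    rfl

open Finset in
/-- The Cauchy product of the series `P` with itself, with the extreme terms split off. -/
theorem sum_antidiagonal_succ_split {R : Type*} [Ring R] (f : ℕ → R) (j : ℕ) :
    ∑ p ∈ antidiagonal (j + 1), f p.1 * f p.2 =
      f 0 * f (j + 1) + f (j + 1) * f 0 + ∑ i : Fin j, f (i + 1) * f (j - i) := by
  rw [Finset.Nat.sum_antidiagonal_succ, Finset.Nat.sum_antidiagonal_eq_sum_range_succ_mk,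
    Finset.sum_range_succ, Finset.sum_fin_eq_sum_range]
  simp only [Nat.sub_self]
  rw [add_assoc, add_comm (f (j + 1) * f 0)]
  congr 2
  refine Finset.sum_congr rfl fun i hi => ?_
  rw [dif_pos (Finset.mem_range.1 hi)]

/-- The variable `X` stands for `λ⁻¹`, so that `C a + X C U` is `λ⁻¹ (λ a + U)`. -/
theorem coeff_conj_L (a U : Mat n) (F : PowerSeries (Mat n)) (j : ℕ) :
    PowerSeries.coeff (j + 1) ((PowerSeries.C a + PowerSeries.X * PowerSeries.C U) * F -
      F * (PowerSeries.C a + PowerSeries.X * PowerSeries.C U)) =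
      ⁅U, PowerSeries.coeff j F⁆ - ⁅PowerSeries.coeff (j + 1) F, a⁆ := by
  have h1 : (PowerSeries.C a + PowerSeries.X * PowerSeries.C U) * F -
      F * (PowerSeries.C a + PowerSeries.X * PowerSeries.C U) =
      (PowerSeries.C a * F - F * PowerSeries.C a) +
      PowerSeries.X * (PowerSeries.C U * F - F * PowerSeries.C U) := by
    have h2 : F * (PowerSeries.X * PowerSeries.C U) = PowerSeries.X * (F * PowerSeries.C U) := by
      rw [← mul_assoc, ← mul_assoc, (PowerSeries.commute_X F).eq]
    rw [add_mul, mul_add, h2, mul_sub, mul_assoc]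
    abel
  rw [h1, map_add, map_sub, PowerSeries.coeff_succ_X_mul, map_sub, PowerSeries.coeff_C_mul,
    PowerSeries.coeff_mul_C, PowerSeries.coeff_C_mul, PowerSeries.coeff_mul_C]
  simp only [Ring.lie_def]
  abel

/-- The coefficients of the family `F` of power series are differentiable at `x`, the derivatives
being the coefficients of `F'`. -/
def HasCoeffDeriv (F : ℝ → PowerSeries (Mat n)) (F' : PowerSeries (Mat n)) (x : ℝ) : Prop :=
  ∀ j, HasDerivAt (fun y => PowerSeries.coeff j (F y)) (PowerSeries.coeff j F') x

theorem HasCoeffDeriv.sub {F G : ℝ → PowerSeries (Mat n)} {F' G' : PowerSeries (Mat n)} {x : ℝ}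
    (hF : HasCoeffDeriv F F' x) (hG : HasCoeffDeriv G G' x) :
    HasCoeffDeriv (fun y => F y - G y) (F' - G') x := fun j => by
  simp only [map_sub]
  exact (hF j).sub (hG j)

theorem HasCoeffDeriv.mul {F G : ℝ → PowerSeries (Mat n)} {F' G' : PowerSeries (Mat n)} {x : ℝ}
    (hF : HasCoeffDeriv F F' x) (hG : HasCoeffDeriv G G' x) :
    HasCoeffDeriv (fun y => F y * G y) (F' * G x + F x * G') x := fun j => by
  simp only [map_add, PowerSeries.coeff_mul, ← Finset.sum_add_distrib]
  exact HasDerivAt.fun_sum fun p _ => (hF p.1).mul (hG p.2)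

theorem hasCoeffDeriv_mk {f : ℕ → ℝ → Mat n} {f' : ℕ → Mat n} {x : ℝ}
    (h : ∀ j, HasDerivAt (f j) (f' j) x) :
    HasCoeffDeriv (fun y => PowerSeries.mk (f · y)) (PowerSeries.mk f') x := fun j => by
  simpa only [PowerSeries.coeff_mk] using h j

theorem hasCoeffDeriv_pC (a e : Mat n) (q : 𝓢(ℝ, Mat n)) (x : ℝ) :
    HasCoeffDeriv (fun y => PowerSeries.mk (pC a e q · y))
      (PowerSeries.mk fun j => D n (pS a e q j) x) x :=
  hasCoeffDeriv_mk fun j => hasDerivAt_pC a e q j x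

open Finset PowerSeries in
/-- The generating series of the spectral hierarchy satisfies `P² = P` and
`[∂ + q + λ a, P] = 0`. -/
theorem pC_spec {a e : Mat n} (hd : a.IsDiag) (he : e * e = e)
    (hc : ∀ z : Mat n, ⁅z, a⁆ = 0 → ⁅z, e⁆ = 0) (hea : ⁅e, a⁆ = 0) (q : 𝓢(ℝ, Mat n)) (j : ℕ) :
    (∀ i ≤ j, ∀ x, ∑ p ∈ antidiagonal i, pC a e q p.1 x * pC a e q p.2 x = pC a e q i x) ∧
    ∀ i < j, ∀ x, D n (pS a e q i) x + ⁅q x, pC a e q i x⁆ = ⁅pC a e q (i + 1) x, a⁆ := by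
  induction j with
  | zero =>
    refine ⟨fun i hi x => ?_, fun i hi => absurd hi (Nat.not_lt_zero i)⟩
    obtain rfl := Nat.le_zero.1 hi
    simp [pC_zero, he]
  | succ j ih =>
    obtain ⟨ihW, ihZ⟩ := ih
    suffices h : ∀ x, ∑ p ∈ antidiagonal (j + 1), pC a e q p.1 x * pC a e q p.2 x =
        pC a e q (j + 1) x ∧
        D n (pS a e q j) x + ⁅q x, pC a e q j x⁆ = ⁅pC a e q (j + 1) x, a⁆ by
      refine ⟨fun i hi x => ?_, fun i hi x => ?_⟩
      · rcases Nat.lt_or_ge i (j + 1) with h1 | h1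
        · exact ihW i (by omega) x
        · obtain rfl : i = j + 1 := by omega
          exact (h x).1
      · rcases Nat.lt_or_ge i j with h1 | h1
        · exact ihZ i h1 x
        · obtain rfl : i = j := by omega
          exact (h x).2
    intro x
    set P : PowerSeries (Mat n) := mk (pC a e q · x) with hP
    set P' : PowerSeries (Mat n) := mk (fun j => D n (pS a e q j) x) with hP'
    set L : PowerSeries (Mat n) := C a + X * C (q x) with hL
    -- `Z` and `W` are the defects of the two equations; the leading coefficients `z`, `w` of both
    -- are shown to vanish simultaneously.
    set Z : PowerSeries (Mat n) := X * P' + (L * P - P * L) with hZ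
    set W : PowerSeries (Mat n) := P * P - P with hW
    have hWj : ∀ i ≤ j, ∀ y,
        coeff i (mk (pC a e q · y) * mk (pC a e q · y)) = pC a e q i y := by
      intro i hi y
      simpa only [coeff_mul, coeff_mk] using ihW i hi y
    have hid : X * (P' * P + P * P' - P') + (L * W - W * L) = Z * P + P * Z - Z := by
      have h1 : X * (P * P') = P * (X * P') := by
        rw [← mul_assoc, ← mul_assoc, (commute_X P).eq]
      rw [mul_sub, mul_add, h1, ← mul_assoc, hZ, hW]
      noncomm_ring
    -- The induction hypothesis for `P² = P` holds at all points, so it can be differentiated.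
    have hder : coeff j (P' * P + P * P' - P') = 0 := by
      have h1 : HasDerivAt (fun y => coeff j (mk (pC a e q · y) * mk (pC a e q · y)))
          (coeff j (P' * P + P * P')) x :=
        ((hasCoeffDeriv_pC a e q x).mul (hasCoeffDeriv_pC a e q x)) j
      have h2 := h1.sub (hasDerivAt_pC a e q j x)
      have h3 : ((fun y => coeff j (mk (pC a e q · y) * mk (pC a e q · y))) - pC a e q j) =
          fun _ => 0 := funext fun y => by
        rw [Pi.sub_apply, hWj j le_rfl y, sub_self]
      rw [h3] at h2
      rw [map_sub, hP', coeff_mk]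
      exact h2.unique (hasDerivAt_const x 0)
    have hZc : ∀ i, coeff (i + 1) Z =
        D n (pS a e q i) x + ⁅q x, pC a e q i x⁆ - ⁅pC a e q (i + 1) x, a⁆ := by
      intro i
      rw [hZ, map_add, hL, coeff_conj_L, coeff_succ_X_mul, hP, hP', coeff_mk, coeff_mk, coeff_mk]
      abel
    have hZ0 : coeff 0 Z = 0 := by
      have h1 : a * e - e * a = 0 := by
        rw [← neg_eq_zero, neg_sub]
        exact hea
      rw [hZ, hL, hP]
      simpa [coeff_zero_eq_constantCoeff_apply, pC_zero] using h1
    have hZlt : ∀ i ≤ j, coeff i Z = 0 := by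
      intro i hi
      rcases i with _ | i
      · exact hZ0
      · rw [hZc, ihZ i (by omega) x, sub_self]
    have hWle : ∀ i ≤ j, coeff i W = 0 := by
      intro i hi
      rw [hW, map_sub, hP, hWj i hi, coeff_mk, sub_self]
    set z := coeff (j + 1) Z with hz
    set w := coeff (j + 1) W with hw
    have hP0 : coeff 0 P = e := by rw [hP, coeff_mk, pC_zero]
    have hZP : coeff (j + 1) (Z * P) = z * e := by
      rw [coeff_mul, Finset.sum_eq_single (j + 1, 0), hP0]
      · rintro ⟨k, l⟩ hkl hne
        rw [HasAntidiagonal.mem_antidiagonal] at hkl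
        have : k ≤ j := by
          by_contra hk
          exact hne (Prod.ext (by simp only at hkl ⊢; omega) (by simp only at hkl ⊢; omega))
        simp only
        rw [hZlt k this, zero_mul]
      · simp
    have hPZ : coeff (j + 1) (P * Z) = e * z := by
      rw [coeff_mul, Finset.sum_eq_single (0, j + 1), hP0]
      · rintro ⟨k, l⟩ hkl hne
        rw [HasAntidiagonal.mem_antidiagonal] at hkl
        have : l ≤ j := by
          by_contra hk
          exact hne (Prod.ext (by simp only at hkl ⊢; omega) (by simp only at hkl ⊢; omega))
        simp only
        rw [hZlt l this, mul_zero]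
      · simp
    -- The coefficient of degree `j + 1` of the Bianchi-type identity `hid`, all lower defects being
    -- zero.
    have hmain : -⁅w, a⁆ = z * e + e * z - z := by
      have h1 := congrArg (coeff (j + 1)) hid
      rw [map_add, coeff_succ_X_mul, hder, hL, coeff_conj_L, hWle j le_rfl, ← hw,
        map_sub (coeff (j + 1)) (Z * P + P * Z), map_add (coeff (j + 1)) (Z * P), hZP, hPZ,
        ← hz] at h1
      rw [← h1]
      simp [Ring.lie_def]
    set V := D n (pS a e q j) x + ⁅q x, pC a e q j x⁆ with hV
    set Y := ∑ i : Fin j, pC a e q (i + 1) x * pC a e q (j - i) x with hY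
    have hbl : ∀ y : Mat n, ⁅y - piPerp a y, a⁆ = 0 := by
      intro y
      rw [← piPerp_eq_zero_iff hd, piPerp_sub, piPerp_piPerp, sub_self]
    have hble : ∀ y : Mat n, ⁅(1 - 2 * e) * (y - piPerp a y), a⁆ = 0 := by
      intro y
      rw [← piPerp_eq_zero_iff hd]
      have h1 : ⁅1 - 2 * e, a⁆ = 0 := by
        have : ⁅1 - 2 * e, a⁆ = -(2 * ⁅e, a⁆) := by
          simp only [Ring.lie_def]
          noncomm_ring
        rw [this, hea, mul_zero, neg_zero]
      rw [piPerp_mul_left hd h1, piPerp_sub, piPerp_piPerp, sub_self, mul_zero]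
    have hpj : pC a e q (j + 1) x = invL a V + (1 - 2 * e) * (Y - piPerp a Y) := by
      rw [pC_succ_eq, blockL_apply]
    -- The choice of the off-diagonal part of the new coefficient leaves `z` block diagonal; the
    -- choice of its block part will make `w` off-diagonal. The two sides of `hmain` then lie in
    -- complementary subspaces and both vanish.
    have hzV : z = V - piPerp a V := by
      rw [hz, hZc, hpj]
      have : ⁅invL a V + (1 - 2 * e) * (Y - piPerp a Y), a⁆ =
          ⁅invL a V, a⁆ + ⁅(1 - 2 * e) * (Y - piPerp a Y), a⁆ := by
        simp only [Ring.lie_def]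
        noncomm_ring
      rw [this, lie_invL hd, hble, add_zero]
    have hza : ⁅z, a⁆ = 0 := hzV ▸ hbl V
    have hze : z * e = e * z := sub_eq_zero.1 (hc z hza)
    have hw' : w = e * pC a e q (j + 1) x + pC a e q (j + 1) x * e + Y -
        pC a e q (j + 1) x := by
      rw [hw, hW, map_sub, hP, coeff_mul, coeff_mk]
      simp only [coeff_mk]
      rw [sum_antidiagonal_succ_split (fun i => pC a e q i x), pC_zero]
    have hwoff : piPerp a w = w := by
      set T := (1 - 2 * e) * (Y - piPerp a Y) with hT
      have hTe : T * e = e * T := sub_eq_zero.1 (hc T (hble Y))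
      have h1 : piPerp a T = 0 := (piPerp_eq_zero_iff hd).2 (hble Y)
      have h2 : piPerp a w = e * invL a V + invL a V * e + piPerp a Y - invL a V := by
        rw [hw', hpj]
        simp only [piPerp_sub, piPerp_add, piPerp_mul_left hd hea, piPerp_mul_right hd hea,
          piPerp_invL, h1]
        simp
      rw [h2, hw', hpj]
      have h3 : e * T + T * e + Y - T - piPerp a Y = 0 := by
        rw [hTe]
        have h4 : e * T + e * T - T = -((1 - 2 * e) * (1 - 2 * e) * (Y - piPerp a Y)) := by
          rw [hT]
          noncomm_ring
        have h5 : (1 - 2 * e) * (1 - 2 * e) = 1 := by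
          have : (1 - 2 * e) * (1 - 2 * e) = 1 - 4 * e + 4 * (e * e) := by noncomm_ring
          rw [this, he]
          abel
        calc _ = (e * T + e * T - T) + (Y - piPerp a Y) := by abel
          _ = 0 := by
            rw [h4, h5, one_mul]
            abel
      rw [← sub_eq_zero, ← neg_eq_zero, ← h3]
      noncomm_ring
    have hwa : ⁅w, a⁆ = 0 := by
      rw [← piPerp_lie hd, ← neg_neg ⁅w, a⁆, hmain]
      have h1 : ⁅-(z * e + e * z - z), a⁆ = 0 := by
        have : ⁅-(z * e + e * z - z), a⁆ =
            -(⁅z, a⁆ * e + z * ⁅e, a⁆ + ⁅e, a⁆ * z + e * ⁅z, a⁆ - ⁅z, a⁆) := by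
          simp only [Ring.lie_def]
          noncomm_ring
        rw [this, hza, hea]
        simp
      exact (piPerp_eq_zero_iff hd).2 h1
    have hw0 : w = 0 := by rw [← hwoff, (piPerp_eq_zero_iff hd).2 hwa]
    -- What remains is `(2e - 1) z = 0`, and `2e - 1` is an involution.
    have hz0 : z = 0 := by
      rw [hwa, neg_zero, hze] at hmain
      have h1 : (2 * e - 1) * (2 * e - 1) = 1 := by
        have : (2 * e - 1) * (2 * e - 1) = 1 - 4 * e + 4 * (e * e) := by noncomm_ring
        rw [this, he]
        abel
      calc z = (2 * e - 1) * (2 * e - 1) * z := by rw [h1, one_mul]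
        _ = (2 * e - 1) * (e * z + e * z - z) := by noncomm_ring
        _ = 0 := by rw [← hmain, mul_zero]
    refine ⟨?_, ?_⟩
    · have h1 := hw0
      rw [hw, hW, map_sub, hP, coeff_mul, coeff_mk, sub_eq_zero] at h1
      simpa only [coeff_mk] using h1
    · rw [hz, hZc] at hz0
      exact sub_eq_zero.1 hz0

end SpectralHierarchy

/-! ### The sequence `Q_j` -/

section QSequence

variable {n : ℕ} {a : Mat n}

theorem pC_recursion (hd : a.IsDiag) (μ : ℂ) (q : 𝓢(ℝ, Mat n)) (j : ℕ) (x : ℝ) :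
    D n (pS a (proj a μ) q j) x + ⁅q x, pC a (proj a μ) q j x⁆ =
      ⁅pC a (proj a μ) q (j + 1) x, a⁆ :=
  (pC_spec hd (proj_mul_self a μ) (fun _ hz => lie_proj_of_lie hd hz μ) (lie_proj_self hd μ) q
    (j + 1)).2 j (Nat.lt_succ_self j) x

open Finset in
theorem pC_idempotent (hd : a.IsDiag) (μ : ℂ) (q : 𝓢(ℝ, Mat n)) (j : ℕ) (x : ℝ) :
    ∑ p ∈ antidiagonal j, pC a (proj a μ) q p.1 x * pC a (proj a μ) q p.2 x =
      pC a (proj a μ) q j x :=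
  (pC_spec hd (proj_mul_self a μ) (fun _ hz => lie_proj_of_lie hd hz μ) (lie_proj_self hd μ) q
    j).1 j le_rfl x

/-- Multiplication by the complex number `μ`, as a real linear map. -/
def smulL (n : ℕ) (μ : ℂ) : Mat n →L[ℝ] Mat n := ContinuousLinearMap.mul ℝ (Mat n) (μ • 1)

@[simp]
theorem smulL_apply (μ : ℂ) (y : Mat n) : smulL n μ y = μ • y := by
  change (μ • (1 : Mat n)) * y = _
  rw [smul_mul_assoc, one_mul]

/-- The Schwartz maps `Q_j(q)`, `j ≥ 1`. -/
def qS (a : Mat n) (q : 𝓢(ℝ, Mat n)) (j : ℕ) : 𝓢(ℝ, Mat n) :=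
  ∑ μ ∈ spec a, SchwartzMap.postcompCLM (smulL n μ) (pS a (proj a μ) q j)

/-- The maps `Q_j(q)`. -/
def qC (a : Mat n) (q : 𝓢(ℝ, Mat n)) (j : ℕ) (x : ℝ) : Mat n :=
  ∑ μ ∈ spec a, μ • pC a (proj a μ) q j x

theorem qS_apply (q : 𝓢(ℝ, Mat n)) (j : ℕ) (x : ℝ) :
    qS a q j x = ∑ μ ∈ spec a, μ • pS a (proj a μ) q j x := by
  rw [qS, schwartz_sum_apply]
  refine Finset.sum_congr rfl fun μ _ => ?_
  rw [SchwartzMap.postcompCLM_apply, smulL_apply]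

theorem qC_succ (q : 𝓢(ℝ, Mat n)) (j : ℕ) (x : ℝ) : qC a q (j + 1) x = qS a q (j + 1) x := by
  rw [qS_apply]
  rfl

theorem qC_zero (hd : a.IsDiag) (q : 𝓢(ℝ, Mat n)) (x : ℝ) : qC a q 0 x = a := by
  simp only [qC, pC_zero]
  exact sum_smul_proj hd

theorem hasDerivAt_qC (q : 𝓢(ℝ, Mat n)) (j : ℕ) (x : ℝ) :
    HasDerivAt (qC a q j) (∑ μ ∈ spec a, μ • D n (pS a (proj a μ) q j) x) x :=
  HasDerivAt.fun_sum fun μ _ => (hasDerivAt_pC a (proj a μ) q j x).const_smul μ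

theorem sum_lie {ι : Type*} (s : Finset ι) (f : ι → Mat n) (y : Mat n) :
    ⁅∑ i ∈ s, f i, y⁆ = ∑ i ∈ s, ⁅f i, y⁆ := by
  simp only [Ring.lie_def, Finset.sum_mul, Finset.mul_sum, Finset.sum_sub_distrib]

theorem lie_sum {ι : Type*} (s : Finset ι) (f : ι → Mat n) (y : Mat n) :
    ⁅y, ∑ i ∈ s, f i⁆ = ∑ i ∈ s, ⁅y, f i⁆ := by
  simp only [Ring.lie_def, Finset.sum_mul, Finset.mul_sum, Finset.sum_sub_distrib]

theorem smul_lie' (c : ℂ) (x y : Mat n) : ⁅c • x, y⁆ = c • ⁅x, y⁆ := by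
  simp only [Ring.lie_def, smul_mul_assoc, mul_smul_comm, smul_sub]

theorem lie_smul' (c : ℂ) (x y : Mat n) : ⁅x, c • y⁆ = c • ⁅x, y⁆ := by
  simp only [Ring.lie_def, smul_mul_assoc, mul_smul_comm, smul_sub]

theorem qC_recursion (hd : a.IsDiag) (q : 𝓢(ℝ, Mat n)) (j : ℕ) (x : ℝ) :
    deriv (qC a q j) x + ⁅q x, qC a q j x⁆ = ⁅qC a q (j + 1) x, a⁆ := by
  rw [(hasDerivAt_qC q j x).deriv, qC, qC, lie_sum, sum_lie, ← Finset.sum_add_distrib]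
  refine Finset.sum_congr rfl fun μ _ => ?_
  rw [lie_smul', smul_lie', ← smul_add, pC_recursion hd]

theorem tendsto_qC (q : 𝓢(ℝ, Mat n)) {j : ℕ} (hj : 1 ≤ j) : Tendsto (qC a q j) atBot (𝓝 0) := by
  obtain ⟨j, rfl⟩ : ∃ k, j = k + 1 := ⟨j - 1, by omega⟩
  exact (tendsto_schwartz_atBot (qS a q (j + 1))).congr fun x => (qC_succ q j x).symm

/-- The recursion has at most one solution. -/
theorem recursion_unique (hd : a.IsDiag) {q : S a} {R R' : ℕ → ℝ → Mat n}
    (hR : ∀ j, Differentiable ℝ (R j)) (hR' : ∀ j, Differentiable ℝ (R' j))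
    (h0 : ∀ x, R 0 x = R' 0 x)
    (hs : ∀ j x, deriv (R j) x + ⁅q.1 x, R j x⁆ = ⁅R (j + 1) x, a⁆)
    (hs' : ∀ j x, deriv (R' j) x + ⁅q.1 x, R' j x⁆ = ⁅R' (j + 1) x, a⁆)
    (ht : ∀ j, 1 ≤ j → Tendsto (R j) atBot (𝓝 0))
    (ht' : ∀ j, 1 ≤ j → Tendsto (R' j) atBot (𝓝 0)) : R = R' := by
  funext j
  induction j with
  | zero => exact funext h0
  | succ j ih =>
    have hda : ∀ x, ⁅R (j + 1) x - R' (j + 1) x, a⁆ = 0 := fun x => by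
      have h1 := hs j x
      rw [ih, hs'] at h1
      simp only [Ring.lie_def, sub_mul, mul_sub] at h1 ⊢
      rw [sub_sub_sub_comm, ← h1, sub_self]
    have hder : ∀ x, HasDerivAt (fun x => R (j + 1) x - R' (j + 1) x)
        (deriv (R (j + 1)) x - deriv (R' (j + 1)) x) x := fun x =>
      ((hR (j + 1)) x).hasDerivAt.sub ((hR' (j + 1)) x).hasDerivAt
    -- The difference is block diagonal by the equation of index `j`, so its derivative is too. The
    -- equation of index `j + 1` writes this derivative as a sum of brackets that are off-diagonal,
    -- so it is zero.
    have hz : ∀ x, deriv (R (j + 1)) x - deriv (R' (j + 1)) x = 0 := by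
      intro x
      have h1 : piPerp a (deriv (R (j + 1)) x - deriv (R' (j + 1)) x) = 0 := by
        have h2 : HasDerivAt (fun x => offL a (R (j + 1) x - R' (j + 1) x))
            (offL a (deriv (R (j + 1)) x - deriv (R' (j + 1)) x)) x :=
          (offL a).hasFDerivAt.comp_hasDerivAt x (hder x)
        have h3 : (fun x => offL a (R (j + 1) x - R' (j + 1) x)) = fun _ => 0 :=
          funext fun x => (piPerp_eq_zero_iff hd).2 (hda x)
        rw [h3] at h2
        exact h2.unique (hasDerivAt_const x 0)
      have h4 : deriv (R (j + 1)) x - deriv (R' (j + 1)) x =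
          ⁅R (j + 2) x - R' (j + 2) x, a⁆ - ⁅q.1 x, R (j + 1) x - R' (j + 1) x⁆ := by
        rw [eq_sub_of_add_eq (hs (j + 1) x), eq_sub_of_add_eq (hs' (j + 1) x)]
        simp only [Ring.lie_def]
        noncomm_ring
      have h5 : piPerp a (deriv (R (j + 1)) x - deriv (R' (j + 1)) x) =
          deriv (R (j + 1)) x - deriv (R' (j + 1)) x := by
        rw [h4, piPerp_sub, piPerp_lie hd, piPerp_lie_left hd (hda x),
          ((mem_perp_iff hd).1 (q.2 x)).2]
      rw [← h5, h1]
    refine eq_of_hasDerivAt_of_tendsto (f' := deriv (R' (j + 1))) (fun x => ?_)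
      (fun x => ((hR' (j + 1)) x).hasDerivAt) (ht _ (by omega)) (ht' _ (by omega))
    rw [← sub_eq_zero.1 (hz x)]
    exact ((hR (j + 1)) x).hasDerivAt

theorem contDiff_qC (hd : a.IsDiag) (q : 𝓢(ℝ, Mat n)) (j : ℕ) : ContDiff ℝ ∞ (qC a q j) := by
  rcases j with _ | j
  · rw [show qC a q 0 = fun _ => a from funext (qC_zero hd q)]
    exact contDiff_const
  · rw [show qC a q (j + 1) = qS a q (j + 1) from funext (qC_succ q j)]
    exact (qS a q (j + 1)).smooth ⊤

/-- The sequence `-Q_j*` satisfies the same recursion with the same limits, because `a` and `q` are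
skew-Hermitian; uniqueness gives `-Q_j* = Q_j`. -/
theorem qC_mem (ha : a ∈ u n) (hd : a.IsDiag) (q : S a) (j : ℕ) (x : ℝ) : qC a q.1 j x ∈ u n := by
  have hdiff : ∀ j, Differentiable ℝ (qC a q.1 j) := fun j x =>
    (hasDerivAt_qC q.1 j x).differentiableAt
  have hder : ∀ j x, HasDerivAt (fun x => -star (qC a q.1 j x)) (-star (deriv (qC a q.1 j) x)) x :=
    fun j x => ((hdiff j) x).hasDerivAt.star.neg
  have h := recursion_unique hd (q := q) (R := qC a q.1) (R' := fun j x => -star (qC a q.1 j x))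
    hdiff (fun j x => (hder j x).differentiableAt)
    (fun x => by rw [qC_zero hd, mem_u.1 ha, neg_neg]) (qC_recursion hd q.1) (fun j x => by
      rw [(hder j x).deriv]
      have h1 := congrArg star (qC_recursion hd q.1 j x)
      rw [star_add, star_lie, star_lie, mem_u.1 ha, S_star] at h1
      simp only [Ring.lie_def] at h1 ⊢
      rw [← sub_eq_zero] at h1 ⊢
      rw [← neg_eq_zero, ← h1]
      noncomm_ring)
    (fun _ hj => tendsto_qC q.1 hj) (fun _ hj => by
      simpa using (tendsto_qC (a := a) q.1 hj).star.neg)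
  have h2 := congrFun (congrFun h j) x
  refine mem_u_of_star ?_
  rw [← neg_eq_iff_eq_neg]
  exact h2.symm

theorem isQSeq_qC (ha : a ∈ u n) (hd : a.IsDiag) (q : S a) : IsQSeq a q (qC a q.1) where
  smooth := contDiff_qC hd q.1
  mem := qC_mem ha hd q
  zero := qC_zero hd q.1
  succ := qC_recursion hd q.1
  tendsto _ hj := tendsto_qC q.1 hj

theorem IsQSeq.unique (hd : a.IsDiag) {q : S a} {R R' : ℕ → ℝ → Mat n} (h : IsQSeq a q R)
    (h' : IsQSeq a q R') : R = R' :=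
  recursion_unique hd (fun j => (h.smooth j).differentiable (by simp))
    (fun j => (h'.smooth j).differentiable (by simp)) (fun x => by rw [h.zero, h'.zero]) h.succ
    h'.succ h.tendsto h'.tendsto

theorem Q_eq_qC (ha : a ∈ u n) (hd : a.IsDiag) (q : S a) : Q a q = qC a q.1 := by
  have h : ∃ R, IsQSeq a q R := ⟨_, isQSeq_qC ha hd q⟩
  rw [Q, dif_pos h]
  exact h.choose_spec.unique hd (isQSeq_qC ha hd q)

theorem existsUnique_QSeq (ha : a ∈ u n) (hd : a.IsDiag) (q : S a) :
    ∃! R : ℕ → ℝ → Mat n, IsQSeq a q R :=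
  ⟨_, isQSeq_qC ha hd q, fun _ h => h.unique hd (isQSeq_qC ha hd q)⟩

end QSequence

/-! ### The variation of the Hamiltonians -/

section TraceIdentity

/-- The left side is the `x`-derivative of `τ(P (N d - d N))` after inserting the equations for the
derivatives of `P`, `N` and `d`. The terms with `L` form a commutator with trace zero. As `N` and
`d` are tangent to the idempotents, `P N P = P d P = 0`, and the other terms collapse. -/
theorem trace_variation {R A : Type*} [Ring R] [AddCommGroup A] (τ : R →+ A)
    (hτ : ∀ x y, τ (x * y) = τ (y * x)) {a v L P N d : R} (hP : P * P = P) (hN : N * P + P * N = N)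
    (hd : d * P + P * d = d) :
    τ ((P * L - L * P) * (N * d - d * N) +
        P * (((a * P - P * a + (N * L - L * N)) * d + N * (P * v - v * P + (d * L - L * d))) -
          ((P * v - v * P + (d * L - L * d)) * N + d * (a * P - P * a + (N * L - L * N))))) =
      -τ (d * a) - τ (N * v) := by
  have hz : ∀ y, y * P + P * y = y → P * y * P = 0 := by
    intro y hy
    have h1 : P * y * P + P * P * y = P * y := by
      rw [mul_assoc, mul_assoc, ← mul_add, hy]
    rw [hP] at h1
    simpa using h1
  have h1 : (P * L - L * P) * (N * d - d * N) +
        P * (((a * P - P * a + (N * L - L * N)) * d + N * (P * v - v * P + (d * L - L * d))) -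
          ((P * v - v * P + (d * L - L * d)) * N + d * (a * P - P * a + (N * L - L * N)))) =
      (P * (N * d - d * N) * L - L * (P * (N * d - d * N))) +
      (P * (a * (P * d)) - P * P * (a * d) - P * d * (a * P) + P * d * P * a) +
      (P * N * P * v - P * N * (v * P) - P * P * (v * N) + P * (v * (P * N))) := by
    noncomm_ring
  have e1 : τ (P * (a * (P * d))) = 0 := by
    rw [hτ, mul_assoc, hτ a, hz d hd, zero_mul, map_zero]
  have e2 : τ (P * d * (a * P)) = τ (P * d * a) := by
    rw [hτ, mul_assoc, ← mul_assoc P P d, hP, hτ]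
  have e3 : τ (P * P * (a * d)) = τ (d * P * a) := by
    rw [hP, hτ, mul_assoc, hτ]
  have e4 : τ (P * (v * (P * N))) = 0 := by
    rw [hτ, mul_assoc, hτ v, hz N hN, zero_mul, map_zero]
  have e5 : τ (P * N * (v * P)) = τ (P * N * v) := by
    rw [hτ, mul_assoc, ← mul_assoc P P N, hP, hτ]
  have e6 : τ (P * P * (v * N)) = τ (N * P * v) := by
    rw [hP, hτ, mul_assoc, hτ]
  rw [h1]
  simp only [map_add, map_sub]
  rw [hτ (P * (N * d - d * N)) L, e1, e2, e3, e4, e5, e6, hz d hd, hz N hN]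
  conv_rhs => rw [← hd, ← hN]
  simp only [add_mul, map_add, zero_mul, map_zero]
  abel

end TraceIdentity

/-! ### Variation of the spectral hierarchy and its trace integrals. -/

section Variation

variable {n : ℕ} {a : Mat n}

open Finset PowerSeries

/-- The trace of the `j`-th coefficient. -/
def coeffTrace (n j : ℕ) : PowerSeries (Mat n) →+ ℂ :=
  (Matrix.traceAddMonoidHom (Fin n) ℂ).comp (coeff (R := Mat n) j).toAddMonoidHom

theorem coeffTrace_apply (j : ℕ) (f : PowerSeries (Mat n)) :
    coeffTrace n j f = Matrix.trace (coeff j f) := rfl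

theorem coeffTrace_mul_comm (j : ℕ) (f g : PowerSeries (Mat n)) :
    coeffTrace n j (f * g) = coeffTrace n j (g * f) := by
  rw [coeffTrace_apply, coeffTrace_apply, coeff_mul, coeff_mul, Matrix.trace_sum, Matrix.trace_sum,
    ← Finset.Nat.sum_antidiagonal_swap]
  exact Finset.sum_congr rfl fun p _ => Matrix.trace_mul_comm _ _

/-- The coefficients of the family `F` of power series converge to those of `F₀`. -/
def HasCoeffLimit (F : ℝ → PowerSeries (Mat n)) (l : Filter ℝ) (F₀ : PowerSeries (Mat n)) : Prop :=
  ∀ j, Tendsto (fun y => coeff j (F y)) l (𝓝 (coeff j F₀))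

theorem HasCoeffLimit.sub {F G : ℝ → PowerSeries (Mat n)} {F₀ G₀ : PowerSeries (Mat n)}
    {l : Filter ℝ} (hF : HasCoeffLimit F l F₀) (hG : HasCoeffLimit G l G₀) :
    HasCoeffLimit (fun y => F y - G y) l (F₀ - G₀) := fun j => by
  simp only [map_sub]
  exact (hF j).sub (hG j)

theorem HasCoeffLimit.mul {F G : ℝ → PowerSeries (Mat n)} {F₀ G₀ : PowerSeries (Mat n)}
    {l : Filter ℝ} (hF : HasCoeffLimit F l F₀) (hG : HasCoeffLimit G l G₀) :
    HasCoeffLimit (fun y => F y * G y) l (F₀ * G₀) := fun j => by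
  simp only [coeff_mul]
  exact tendsto_finsetSum _ fun p _ => (hF p.1).mul (hG p.2)

theorem hasCoeffLimit_mk {f : ℕ → ℝ → Mat n} {f₀ : ℕ → Mat n} {l : Filter ℝ}
    (h : ∀ j, Tendsto (f j) l (𝓝 (f₀ j))) :
    HasCoeffLimit (fun y => PowerSeries.mk (f · y)) l (PowerSeries.mk f₀) := fun j => by
  simpa only [coeff_mk] using h j

/-- Existence of a derivative is enough: its properties follow from differentiating the relations
satisfied by the `P_j`. -/
theorem exists_hasCurveDeriv_pS (e : Mat n) {c : ℝ → 𝓢(ℝ, Mat n)} {v : 𝓢(ℝ, Mat n)} {I : Set ℝ}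
    {t : ℝ} (hc : HasCurveDeriv c v I t) (j : ℕ) :
    ∃ w, HasCurveDeriv (fun s => pS a e (c s) j) w I t := by
  induction j using Nat.strong_induction_on with
  | _ j ih =>
    rcases j with _ | j
    · refine ⟨0, ?_⟩
      simp only [pS_zero]
      exact hasCurveDeriv_const _
    · obtain ⟨w, hw⟩ := ih j (Nat.lt_succ_self j)
      have h1 : ∀ i : Fin j, ∃ w, HasCurveDeriv
          (fun s => sm n (pS a e (c s) (i + 1)) (pS a e (c s) (j - i))) w I t := by
        intro i
        obtain ⟨w₁, hw₁⟩ := ih (i + 1) (by omega)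
        obtain ⟨w₂, hw₂⟩ := ih (j - i) (by omega)
        exact ⟨_, hasCurveDeriv_sm hw₁ hw₂⟩
      choose w₁ hw₁ using h1
      have h2 : ∃ w, HasCurveDeriv (fun s =>
          if j = 0 then SchwartzMap.postcompCLM (lieL e) (c s) else 0) w I t := by
        split_ifs
        · exact ⟨_, hc.clm (SchwartzMap.postcompCLM (lieL e))⟩
        · exact ⟨0, hasCurveDeriv_const _⟩
      obtain ⟨w₂, hw₂⟩ := h2
      have h3 := ((hw.clm (D n)).add ((hasCurveDeriv_sm hc hw).add
        ((hasCurveDeriv_sm hw hc).clm (-ContinuousLinearMap.id ℝ _)))).add hw₂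
      have h4 := (h3.clm (SchwartzMap.postcompCLM (invL a))).add
        ((HasCurveDeriv.sum univ fun i _ => hw₁ i).clm (SchwartzMap.postcompCLM (blockL a e)))
      refine ⟨_, h4.congr fun s => ?_⟩
      rw [pS]
      simp [sub_eq_add_neg]

/-- The trace, as a real linear map. -/
def trL (n : ℕ) : Mat n →L[ℝ] ℂ :=
  LinearMap.toContinuousLinearMap
    { toFun := Matrix.trace
      map_add' := Matrix.trace_add
      map_smul' := fun r x => Matrix.trace_smul r x }

theorem integrable_trace (f : 𝓢(ℝ, Mat n)) : Integrable fun x => Matrix.trace (f x) :=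
  (trL n).integrable_comp f.integrable

theorem integrable_trace_mul (f g : 𝓢(ℝ, Mat n)) : Integrable fun x => Matrix.trace (f x * g x) := by
  simpa only [sm_apply] using integrable_trace (sm n f g)

theorem integrable_trace_mul_const (f : 𝓢(ℝ, Mat n)) (y : Mat n) :
    Integrable fun x => Matrix.trace (f x * y) := by
  simpa only [rm_apply, ev_const] using integrable_trace (rm n (y, 0) f)

theorem hasDerivAt_eval {c : ℝ → 𝓢(ℝ, Mat n)} {v : 𝓢(ℝ, Mat n)} {t : ℝ}
    (hc : HasCurveDeriv c v Set.univ t) (x : ℝ) : HasDerivAt (fun s => c s x) (v x) t :=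
  (hc.clm (evalS n x)).hasDerivAt

/-- The variation of `∫ tr (P_{j+1} a)` for the spectral hierarchy. -/
theorem integral_trace_variation (hd : a.IsDiag) (μ : ℂ) {c : ℝ → 𝓢(ℝ, Mat n)} {v : 𝓢(ℝ, Mat n)}
    {t : ℝ} (hc : HasCurveDeriv c v Set.univ t) {δ : ℕ → 𝓢(ℝ, Mat n)}
    (hδ : ∀ j, HasCurveDeriv (fun s => pS a (proj a μ) (c s) j) (δ j) Set.univ t) (j : ℕ) :
    ∫ x, Matrix.trace (δ (j + 1) x * a) =
      -(j * ∫ x, Matrix.trace (pS a (proj a μ) (c t) j x * v x)) := by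
  set e := proj a μ with he
  set q := c t with hq
  have hδ0 : δ 0 = 0 := by
    have h1 := hδ 0
    simp only [pS_zero] at h1
    exact h1.unique (hasCurveDeriv_const _)
  have hpC : ∀ j x, HasDerivAt (fun s => pC a e (c s) j x) (δ j x) t := by
    intro j x
    rcases j with _ | j
    · rw [hδ0]
      exact hasDerivAt_const t e
    · exact hasDerivAt_eval (hδ (j + 1)) x
  set P : ℝ → PowerSeries (Mat n) := fun x => mk (pC a e q · x) with hP
  set P' : ℝ → PowerSeries (Mat n) := fun x => mk (fun j => D n (pS a e q j) x) with hP'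
  -- `N` is the Euler operator `X d/dX` applied to `P`, a derivation like the variation `d`; it is
  -- the source of the factor `j`.
  set N : ℝ → PowerSeries (Mat n) := fun x => mk (fun j => (j : ℝ) • pC a e q j x) with hN
  set N' : ℝ → PowerSeries (Mat n) := fun x => mk (fun j => (j : ℝ) • D n (pS a e q j) x) with hN'
  set d : ℝ → PowerSeries (Mat n) := fun x => mk (δ · x) with hdd
  set d' : ℝ → PowerSeries (Mat n) := fun x => mk (fun j => D n (δ j) x) with hdd'
  set L : ℝ → PowerSeries (Mat n) := fun x => C a + X * C (q x) with hL
  have hea : a * e - e * a = 0 := by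
    have h1 : ⁅e, a⁆ = 0 := lie_proj_self hd μ
    rw [← neg_eq_zero, neg_sub]
    exact h1
  have hPP : ∀ x, P x * P x = P x := fun x => PowerSeries.ext fun k => by
    simpa only [hP, coeff_mul, coeff_mk] using pC_idempotent hd μ q k x
  have hNP : ∀ x, N x * P x + P x * N x = N x := fun x => PowerSeries.ext fun k => by
    simp only [hP, hN, map_add, coeff_mul, coeff_mk, ← Finset.sum_add_distrib]
    rw [← pC_idempotent hd μ q k x, Finset.smul_sum]
    refine Finset.sum_congr rfl fun p hp => ?_
    rw [← HasAntidiagonal.mem_antidiagonal.1 hp, smul_mul_assoc, mul_smul_comm, ← add_smul]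
    push_cast
    rfl
  have hdP : ∀ x, d x * P x + P x * d x = d x := fun x => PowerSeries.ext fun k => by
    simp only [hP, hdd, map_add, coeff_mul, coeff_mk, ← Finset.sum_add_distrib]
    have h1 : HasDerivAt (fun s => ∑ p ∈ antidiagonal k, pC a e (c s) p.1 x * pC a e (c s) p.2 x)
        (∑ p ∈ antidiagonal k, (δ p.1 x * pC a e q p.2 x + pC a e q p.1 x * δ p.2 x)) t :=
      HasDerivAt.fun_sum fun p _ => (hpC p.1 x).mul (hpC p.2 x)
    have h2 : (fun s => ∑ p ∈ antidiagonal k, pC a e (c s) p.1 x * pC a e (c s) p.2 x) =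
        fun s => pC a e (c s) k x := funext fun s => pC_idempotent hd μ (c s) k x
    rw [h2] at h1
    exact h1.unique (hpC k x)
  have hS : ∀ x, X * P' x = P x * L x - L x * P x := fun x => by
    rw [← sub_eq_zero, sub_sub_eq_add_sub, add_sub_assoc]
    refine PowerSeries.ext fun k => ?_
    rcases k with _ | k
    · simpa [hL, hP, coeff_zero_eq_constantCoeff_apply, pC_zero] using hea
    · rw [map_add, coeff_succ_X_mul, hL, coeff_conj_L]
      simp only [hP, hP', coeff_mk, map_zero]
      rw [← pC_recursion hd μ q k x]
      abel
  -- This is the Euler operator applied to `X P' = [P, L]`, with `X P'` itself subtracted; the terms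
  -- in `q` cancel and `[a, P]` remains.
  have hSN : ∀ x, X * N' x = C a * P x - P x * C a + (N x * L x - L x * N x) := fun x => by
    rw [← sub_eq_iff_eq_add, sub_sub_eq_add_sub, add_sub_assoc]
    refine PowerSeries.ext fun k => ?_
    rcases k with _ | k
    · simp [hL, hP, hN, coeff_zero_eq_constantCoeff_apply, pC_zero, hea]
    · rw [map_add, coeff_succ_X_mul, hL, coeff_conj_L, map_sub, coeff_C_mul, coeff_mul_C]
      simp only [hP, hN, hN', coeff_mk]
      have h1 : ⁅q x, (k : ℝ) • pC a e q k x⁆ = (k : ℝ) • ⁅q x, pC a e q k x⁆ := by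
        simp only [Ring.lie_def, smul_mul_assoc, mul_smul_comm, smul_sub]
      have h2 : ⁅((k + 1 : ℕ) : ℝ) • pC a e q (k + 1) x, a⁆ =
          (k : ℝ) • ⁅pC a e q (k + 1) x, a⁆ + ⁅pC a e q (k + 1) x, a⁆ := by
        simp only [Ring.lie_def, smul_mul_assoc, mul_smul_comm]
        push_cast
        simp only [add_smul, one_smul, smul_sub]
        abel
      rw [h1, h2, ← pC_recursion hd μ q k x, smul_add, pC_recursion hd μ q k x, Ring.lie_def _ a]
      abel
  have hSd : ∀ x, X * d' x = P x * (X * C (v x)) - X * C (v x) * P x +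
      (d x * L x - L x * d x) := fun x => by
    rw [← sub_eq_iff_eq_add, sub_sub_eq_add_sub, add_sub_assoc]
    refine PowerSeries.ext fun k => ?_
    have h0 : P x * (X * C (v x)) = X * (P x * C (v x)) := by
      rw [← mul_assoc, ← mul_assoc, (commute_X (P x)).eq]
    rcases k with _ | k
    · simp [hL, hP, hdd, coeff_zero_eq_constantCoeff_apply, hδ0]
    · rw [map_add, coeff_succ_X_mul, hL, coeff_conj_L, map_sub, h0, mul_assoc, coeff_succ_X_mul,
        coeff_succ_X_mul, coeff_C_mul, coeff_mul_C]
      simp only [hP, hdd, hdd', coeff_mk]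
      have h1 := (hasDerivAt_eval ((hδ k).clm (D n)) x).add
        (((hasDerivAt_eval hc x).mul (hpC k x)).sub ((hpC k x).mul (hasDerivAt_eval hc x)))
      have h2 := ((hpC (k + 1) x).mul_const a).sub ((hpC (k + 1) x).const_mul a)
      have h3 := h1.unique (h2.congr_of_eventuallyEq
        (Eventually.of_forall fun s => pC_recursion hd μ (c s) k x))
      simp only [Ring.lie_def]
      rw [← sub_eq_zero] at h3 ⊢
      rw [← h3]
      abel
  -- Since the equations give `X` times the derivatives, the coefficient of index `j` here is
  -- governed by the trace identity in degree `j + 1`.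
  set G : ℝ → ℂ := fun x => coeffTrace n j (P x * (N x * d x - d x * N x)) with hG
  have hGd : ∀ x, HasDerivAt G
      (-Matrix.trace (δ (j + 1) x * a) - j * Matrix.trace (pS a e q j x * v x)) x := by
    intro x
    have h1 : HasCoeffDeriv P (P' x) x := hasCoeffDeriv_pC a e q x
    have h2 : HasCoeffDeriv N (N' x) x :=
      hasCoeffDeriv_mk fun j => (hasDerivAt_pC a e q j x).const_smul (j : ℝ)
    have h3 : HasCoeffDeriv d (d' x) x := hasCoeffDeriv_mk fun j => hasDerivAt_D (δ j) x
    have h8 := (trL n).hasFDerivAt.comp_hasDerivAt x ((h1.mul ((h2.mul h3).sub (h3.mul h2))) j)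
    have h4 := trace_variation (coeffTrace n (j + 1)) (coeffTrace_mul_comm (j + 1)) (a := C a)
      (v := X * C (v x)) (L := L x) (hPP x) (hNP x) (hdP x)
    rw [← hS, ← hSN, ← hSd] at h4
    have h5 : X * P' x * (N x * d x - d x * N x) + P x * (X * N' x * d x + N x * (X * d' x) -
        (X * d' x * N x + d x * (X * N' x))) = X * (P' x * (N x * d x - d x * N x) +
        P x * (N' x * d x + N x * d' x - (d' x * N x + d x * N' x))) := by
      have hX : ∀ F G : PowerSeries (Mat n), F * (X * G) = X * (F * G) := fun F G => by
        rw [← mul_assoc, ← mul_assoc, (commute_X F).eq]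
      simp only [mul_assoc, hX, mul_add, mul_sub]
    have h6 : coeffTrace n (j + 1) (d x * C a) = Matrix.trace (δ (j + 1) x * a) := by
      rw [coeffTrace_apply, coeff_mul_C, coeff_mk]
    have h7 : coeffTrace n (j + 1) (N x * (X * C (v x))) =
        j * Matrix.trace (pS a e q j x * v x) := by
      rw [coeffTrace_apply, ← mul_assoc, (commute_X (N x)).eq, mul_assoc, coeff_succ_X_mul,
        coeff_mul_C, coeff_mk, smul_mul_assoc, Matrix.trace_smul]
      rcases j with _ | j
      · simp
      · rw [pC_succ]
        simp
    rw [h5, h6, h7, coeffTrace_apply, coeff_succ_X_mul] at h4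
    rw [← h4]
    exact h8
  -- Every coefficient of `d` is Schwartz, so `G` vanishes at both ends and its derivative has
  -- integral zero.
  have hlim : ∀ l : Filter ℝ, (∀ f : 𝓢(ℝ, Mat n), Tendsto f l (𝓝 0)) → Tendsto G l (𝓝 0) := by
    intro l hl
    have hp : ∀ j, Tendsto (pC a e q j) l (𝓝 (if j = 0 then e else 0)) := by
      intro j
      rcases j with _ | j
      · exact tendsto_const_nhds
      · exact hl (pS a e q (j + 1))
    have h1 : HasCoeffLimit P l _ := hasCoeffLimit_mk hp
    have h2 : HasCoeffLimit N l _ := hasCoeffLimit_mk fun j => (hp j).const_smul (j : ℝ)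
    have h3 : HasCoeffLimit d l 0 := hasCoeffLimit_mk (f₀ := 0) fun j => hl (δ j)
    have h4 := (h1.mul ((h2.mul h3).sub (h3.mul h2))) j
    rw [mul_zero, zero_mul, sub_self, mul_zero, map_zero] at h4
    have h5 := ((trL n).continuous.tendsto 0).comp h4
    rw [map_zero] at h5
    exact h5
  have hi1 := integrable_trace_mul_const (δ (j + 1)) a
  have hi2 := integrable_trace_mul (pS a e q j) v
  have hint := integral_of_hasDerivAt_of_tendsto hGd (hi1.neg.sub (hi2.const_mul (j : ℂ)))
    (hlim _ tendsto_schwartz_atBot) (hlim _ tendsto_schwartz_atTop)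
  have h8 := integral_sub hi1.neg (hi2.const_mul (j : ℂ))
  simp only [Pi.neg_apply] at h8
  rw [h8, integral_neg, integral_const_mul, sub_self] at hint
  linear_combination -hint

end Variation

/-! ### The derivative of `F_j`. -/

section Gradients

variable {n : ℕ} {a : Mat n}

theorem integrable_re_trace (f : 𝓢(ℝ, Mat n)) : Integrable fun x => -(Matrix.trace (f x)).re :=
  (integrable_trace f).re.neg

theorem integrable_ip_ev (f : 𝓢(ℝ, Mat n)) (b : Bd n) :
    Integrable fun x => ip (f x) (ev b x) :=
  integrable_re_trace (rm n b f)

theorem integrable_ip (f g : 𝓢(ℝ, Mat n)) : Integrable fun x => ip (f x) (g x) := by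
  simpa only [ev_toBd] using integrable_ip_ev f (toBd n g)

theorem integrable_ip_const (f : 𝓢(ℝ, Mat n)) (y : Mat n) : Integrable fun x => ip (f x) y := by
  simpa only [ev_const] using integrable_ip_ev f (y, 0)

/-- The functional `f ↦ ∫ <f, y>`. -/
def intIp (y : Mat n) : 𝓢(ℝ, Mat n) →L[ℝ] ℝ :=
  SchwartzMap.integralCLM ℝ volume ∘L
    SchwartzMap.postcompCLM
      (-(Complex.reCLM ∘L trL n ∘L (ContinuousLinearMap.mul ℝ (Mat n)).flip y))

theorem intIp_apply (y : Mat n) (f : 𝓢(ℝ, Mat n)) : intIp y f = ∫ x, ip (f x) y := by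
  simp only [intIp, ContinuousLinearMap.comp_apply, SchwartzMap.integralCLM_apply]
  rfl

theorem integral_ip_eq {f g : ℝ → Mat n} (h : Integrable fun x => Matrix.trace (f x * g x)) :
    ∫ x, ip (f x) (g x) = -(∫ x, Matrix.trace (f x * g x)).re := by
  simp only [ip, integral_neg]
  congr 1
  exact integral_re h

theorem F_eq (ha : a ∈ u n) (hd : a.IsDiag) (j : ℕ) (q : S a) :
    F a j q = -(1 / ((j : ℝ) + 1)) * intIp a (qS a q.1 (j + 2)) := by
  rw [F, intIp_apply, Q_eq_qC ha hd]
  simp only [qC_succ]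

/-- The trace variation is applied to each spectral projection with index `j + 1`; its factor `-(j +
1)` cancels the normalization of `F_j`, and the eigenvalue weights reassemble `Q_{j+1}`. -/
theorem hasDerivAt_F (ha : a ∈ u n) (hd : a.IsDiag) (j : ℕ) {c : ℝ → S a} {v : S a} {t : ℝ}
    (hc : HasCurveDeriv c v Set.univ t) :
    HasDerivAt (fun s => F a j (c s)) (∫ x, ip (qS a (c t).1 (j + 1) x) (v.1 x)) t := by
  have hc' : HasCurveDeriv (fun s => (c s).1) v.1 Set.univ t := hc.clm (S a).subtypeL
  choose δ hδ using fun μ j => exists_hasCurveDeriv_pS (proj a μ) hc' j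
  have hq : HasCurveDeriv (fun s => qS a (c s).1 (j + 2))
      (∑ μ ∈ spec a, SchwartzMap.postcompCLM (smulL n μ) (δ μ (j + 2))) Set.univ t :=
    HasCurveDeriv.sum (spec a) fun μ _ => (hδ μ (j + 2)).clm (SchwartzMap.postcompCLM (smulL n μ))
  have h := (hq.clm (intIp a)).hasDerivAt.const_mul (-(1 / ((j : ℝ) + 1)))
  simp only [F_eq ha hd]
  refine h.congr_deriv ?_
  have h1 : ∀ μ, intIp a (SchwartzMap.postcompCLM (smulL n μ) (δ μ (j + 2))) =
      ((j : ℝ) + 1) *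
        (μ * ∫ x, Matrix.trace (pS a (proj a μ) (c t).1 (j + 1) x * v.1 x)).re := by
    intro μ
    have h2 : ∀ x, Matrix.trace (SchwartzMap.postcompCLM (smulL n μ) (δ μ (j + 2)) x * a) =
        μ * Matrix.trace (δ μ (j + 2) x * a) := by
      intro x
      rw [SchwartzMap.postcompCLM_apply]
      simp [smulL_apply]
    rw [intIp_apply, integral_ip_eq (integrable_trace_mul_const _ a)]
    simp only [h2]
    rw [integral_const_mul, integral_trace_variation hd μ hc' (hδ μ) (j + 1)]
    rw [mul_neg, Complex.neg_re, neg_neg, mul_left_comm, ← Complex.ofReal_natCast,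
      Complex.re_ofReal_mul]
    push_cast
    rfl
  rw [map_sum, Finset.sum_congr rfl fun μ _ => h1 μ, ← Finset.mul_sum, ← mul_assoc,
    integral_ip_eq (integrable_trace_mul _ _)]
  have h3 : -(1 / ((j : ℝ) + 1)) * ((j : ℝ) + 1) = -1 := by
    field_simp
  rw [h3, neg_one_mul, ← Complex.re_sum]
  congr 2
  simp only [qS_apply, Finset.sum_mul, Matrix.trace_sum, smul_mul_assoc, Matrix.trace_smul,
    smul_eq_mul]
  rw [integral_finsetSum _ fun μ _ => (integrable_trace_mul _ _).const_mul _]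
  simp only [integral_const_mul]

end Gradients

/-! ### Invariance of the form and Hamiltonian vectors for `w`. -/

section Symplectic

variable {n : ℕ} {a : Mat n}

theorem ip_self_nonneg {y : Mat n} (hy : y ∈ u n) : 0 ≤ ip y y := by
  have h1 : ip y y = (Matrix.trace (star y * y)).re := by
    rw [mem_u.1 hy]
    simp [ip]
  rw [h1]
  simp only [Matrix.trace, Matrix.diag, Matrix.mul_apply, Complex.re_sum, Matrix.star_apply]
  refine Finset.sum_nonneg fun i _ => Finset.sum_nonneg fun j _ => ?_
  simp only [RCLike.star_def, Complex.mul_re, Complex.conj_re, Complex.conj_im]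
  nlinarith [sq_nonneg (y j i).re, sq_nonneg (y j i).im]

/-- Invariance of the form under `ad`. -/
theorem ip_lie_left (x y z : Mat n) : ip ⁅x, y⁆ z = ip x ⁅y, z⁆ := by
  simp only [ip, Ring.lie_def, sub_mul, mul_sub, Matrix.trace_sub, ← mul_assoc]
  rw [Matrix.trace_mul_cycle y x z, Matrix.trace_mul_cycle z y x]

theorem ip_piPerp_left (a x y : Mat n) : ip (piPerp a x) y = ip x (piPerp a y) := by
  simp only [ip, Matrix.trace, Matrix.diag, Matrix.mul_apply, piPerp, Matrix.of_apply, ite_mul,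
    mul_ite, zero_mul, mul_zero, eq_comm]

theorem ip_conj {g : Mat n} (hg : g ∈ Matrix.unitaryGroup (Fin n) ℂ) (x y : Mat n) :
    ip (g * x * star g) (g * y * star g) = ip x y := by
  have h : g * x * star g * (g * y * star g) = g * (x * (star g * g) * y) * star g := by
    noncomm_ring
  rw [ip, h, star_mul_of_unitary hg, Matrix.trace_mul_cycle, ← mul_assoc, star_mul_of_unitary hg,
    one_mul, mul_one, ip]

theorem eq_zero_of_integral_ip_self {f : ℝ → Mat n} (hf : ∀ x, f x ∈ u n) (hc : Continuous f)
    {χ : ℝ → ℝ} (hχ : ∀ x, 0 ≤ χ x) (hχc : Continuous χ)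
    (hi : Integrable fun x => χ x * ip (f x) (f x)) (h : ∫ x, χ x * ip (f x) (f x) = 0) {x : ℝ}
    (hx : χ x ≠ 0) : f x = 0 := by
  have h1 := (integral_eq_zero_iff_of_nonneg
    (fun x => mul_nonneg (hχ x) (ip_self_nonneg (hf x))) hi).1 h
  have hcont : Continuous fun x => χ x * ip (f x) (f x) :=
    hχc.mul (Complex.continuous_re.comp ((hc.mul hc).matrix_trace)).neg
  have h2 := congrFun ((hcont.ae_eq_iff_eq volume continuous_const).1 h1) x
  exact eq_zero_of_ip_self (hf x) ((mul_eq_zero.1 h2).resolve_left hx)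

theorem qS_mem (ha : a ∈ u n) (hd : a.IsDiag) (q : S a) (j : ℕ) (x : ℝ) :
    qS a q.1 (j + 1) x ∈ u n := by
  rw [← qC_succ]
  exact qC_mem ha hd q (j + 1) x

theorem qS_recursion (hd : a.IsDiag) (q : 𝓢(ℝ, Mat n)) (j : ℕ) (x : ℝ) :
    D n (qS a q (j + 1)) x + ⁅q x, qS a q (j + 1) x⁆ = ⁅qS a q (j + 2) x, a⁆ := by
  have h := qC_recursion hd q (j + 1) x
  have h1 : qC a q (j + 1) = qS a q (j + 1) := funext fun x => qC_succ q j x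
  rw [h1, qC_succ] at h
  exact h

theorem exists_lie_qS (ha : a ∈ u n) (hd : a.IsDiag) (q : S a) (j : ℕ) :
    ∃ Y : S a, ∀ x, Y.1 x = ⁅qS a q.1 (j + 1) x, a⁆ :=
  ⟨⟨SchwartzMap.postcompCLM (lieL a) (qS a q.1 (j + 1)),
    fun x => lie_mem_perp ha hd (qS_mem ha hd q j x)⟩, fun _ => rfl⟩

theorem w_eq (ha : a ∈ u n) (hd : a.IsDiag) (X v : S a) :
    w X v = ∫ x, ip (invL a (X.1 x)) (v.1 x) := by
  simp only [w, fun x => adInv_eq ha hd (X.2 x), neg_neg]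

theorem w_eq_of_lie (ha : a ∈ u n) (hd : a.IsDiag) {Y : S a} {f : ℝ → Mat n}
    (hY : ∀ x, Y.1 x = ⁅f x, a⁆) (v : S a) : w Y v = ∫ x, ip (f x) (v.1 x) := by
  rw [w_eq ha hd]
  refine integral_congr_ae (Eventually.of_forall fun x => ?_)
  simp only [hY, invL_lie hd, ip_piPerp_left, ((mem_perp_iff hd).1 (v.2 x)).2]

/-- Existence is the derivative of `F_j` rewritten by `w_eq_of_lie`; uniqueness is nondegeneracy of
`w`. -/
theorem isHamW_iff (ha : a ∈ u n) (hd : a.IsDiag) (j : ℕ) {q Y : S a}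
    (hY : ∀ x, Y.1 x = ⁅qS a q.1 (j + 1) x, a⁆) (X : S a) : IsHamW (F a j) q X ↔ X = Y := by
  have hYw := w_eq_of_lie ha hd hY
  constructor
  · intro h
    -- Tested against this direction, the difference of the two pairings is `∫ <v, v>`.
    set v : S a := ⟨SchwartzMap.postcompCLM (invL a) (X.1 - Y.1), fun x =>
      invL_mem ha hd ((u n).sub_mem (X.2 x).1 (Y.2 x).1)⟩ with hv
    have hc := hasCurveDeriv_line q v
    have h1 := h _ v (by simp) hc
    have h2 := (h1.unique (hasDerivAt_F ha hd j hc))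
    simp only [zero_smul, add_zero] at h2
    have hi : ∀ Z : S a, Integrable fun x => ip (invL a (Z.1 x)) (v.1 x) := fun Z =>
      integrable_ip (SchwartzMap.postcompCLM (invL a) Z.1) v.1
    rw [← hYw v, w_eq ha hd, w_eq ha hd, ← sub_eq_zero, ← integral_sub (hi X) (hi Y)] at h2
    have h3 : ∀ x, v.1 x = invL a (X.1 x) - invL a (Y.1 x) := fun x => map_sub (invL a) _ _
    simp only [← ip_sub_left, ← h3] at h2
    refine Subtype.ext (SchwartzMap.ext fun x => ?_)
    have h4 : v.1 x = 0 :=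
      eq_zero_of_integral_ip_self (χ := fun _ => 1) (fun x => (v.2 x).1) v.1.continuous
        (fun _ => zero_le_one) continuous_const (by simpa using integrable_ip v.1 v.1)
        (by simpa using h2) one_ne_zero
    have h5 := lie_invL hd (X.1 x - Y.1 x)
    have h6 : invL a (X.1 x - Y.1 x) = 0 := h4
    rw [h6, piPerp_sub, ((mem_perp_iff hd).1 (X.2 x)).2, ((mem_perp_iff hd).1 (Y.2 x)).2,
      Ring.lie_def, zero_mul, mul_zero, sub_zero] at h5
    exact sub_eq_zero.1 h5.symm
  · rintro rfl c v rfl hc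
    rw [hYw v]
    exact hasDerivAt_F ha hd j hc

end Symplectic

/-! ### Gradient and Hamiltonian vector of `H_j` on the path space. -/

section PathSpace

variable {n : ℕ} {a : Mat n}

theorem integral_ip_D (f : 𝓢(ℝ, Mat n)) (y : Mat n) : ∫ x, ip (D n f x) y = 0 := by
  have h := integral_of_hasDerivAt_of_tendsto
    (f := fun x => ip (f x) y) (f' := fun x => ip (D n f x) y) (m := 0) (n := 0)
    (fun x => ?_) (integrable_ip_const _ y) ?_ ?_
  · simpa using h
  · exact ((Complex.reCLM ∘L trL n ∘L
      (ContinuousLinearMap.mul ℝ (Mat n)).flip y).hasFDerivAt.comp_hasDerivAt x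
        (hasDerivAt_D f x)).neg
  · have := ((-(Complex.reCLM ∘L trL n ∘L
      (ContinuousLinearMap.mul ℝ (Mat n)).flip y)).continuous.tendsto 0).comp
      (tendsto_schwartz_atBot f)
    rwa [map_zero] at this
  · have := ((-(Complex.reCLM ∘L trL n ∘L
      (ContinuousLinearMap.mul ℝ (Mat n)).flip y)).continuous.tendsto 0).comp
      (tendsto_schwartz_atTop f)
    rwa [map_zero] at this

/-- No boundary term appears at `+∞`, although `ev b` need not vanish there, because the product
with `f` is Schwartz. -/
theorem integral_ip_parts (f : 𝓢(ℝ, Mat n)) (b : Bd n) :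
    ∫ x, ip (f x) (b.2 x) = -∫ x, ip (D n f x) (ev b x) := by
  have h := integral_ip_D (rm n b f) 1
  have h1 : ∀ x, ip (D n (rm n b f) x) 1 = ip (D n f x) (ev b x) + ip (f x) (b.2 x) := by
    intro x
    have h2 : D n (rm n b f) x = D n f x * ev b x + f x * b.2 x :=
      (hasDerivAt_D (rm n b f) x).unique ((hasDerivAt_D f x).mul (hasDerivAt_ev b x))
    rw [ip, mul_one, h2, Matrix.trace_add, Complex.add_re, neg_add, ip, ip]
  simp only [h1] at h
  rw [integral_add (integrable_ip_ev _ b) (integrable_ip f b.2)] at h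
  linarith

theorem ip_lie_right (x z : Mat n) : ip x ⁅z, a⁆ = -ip ⁅x, a⁆ z := by
  rw [ip_lie_left]
  simp only [ip, Ring.lie_def, mul_sub, Matrix.trace_sub, Complex.sub_re]
  ring

/-- The operator `∂ + [q, ·]` is skew for the `L²` pairing, and on `Q_{j+1}` it equals `[Q_{j+2},
a]`; moving `ad a` across the form restores the sign. -/
theorem integral_ip_gauge (hd : a.IsDiag) {q v : S a} {z : Bd n} (hz : IsGauge q v z) (j : ℕ) :
    ∫ x, ip (qS a q.1 (j + 1) x) (v.1 x) = ∫ x, ip (qS a q.1 (j + 2) x) ⁅ev z x, a⁆ := by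
  set f := qS a q.1 (j + 1) with hf
  have h1 : ∀ x, ip (f x) (v.1 x) = ip (f x) (z.2 x) + -ip ⁅q.1 x, f x⁆ (ev z x) := by
    intro x
    have h2 : v.1 x = z.2 x + ⁅q.1 x, ev z x⁆ := by rw [hz.snd, sub_add_cancel]
    have h3 : ip (f x) ⁅q.1 x, ev z x⁆ = -ip ⁅q.1 x, f x⁆ (ev z x) := by
      rw [← ip_lie_left]
      simp only [ip, Ring.lie_def, sub_mul, Matrix.trace_sub, Complex.sub_re]
      ring
    rw [← h3, h2]
    simp only [ip, mul_add, Matrix.trace_add, Complex.add_re]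
    ring
  have hi : Integrable fun x => ip ⁅q.1 x, f x⁆ (ev z x) := by
    convert integrable_ip_ev (sm n q.1 f - sm n f q.1) z using 3
    simp [Ring.lie_def]
  have hin : Integrable fun x => -ip ⁅q.1 x, f x⁆ (ev z x) := hi.neg
  simp only [h1]
  rw [integral_add (integrable_ip f z.2) hin, integral_ip_parts f z, integral_neg, ← neg_add,
    ← integral_add (integrable_ip_ev _ z) hi, ← integral_neg]
  refine integral_congr_ae (Eventually.of_forall fun x => ?_)
  simp only
  rw [ip_lie_right, ← qS_recursion hd q.1 j x]
  simp only [ip, add_mul, Matrix.trace_add, Complex.add_re]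
  ring

theorem integrable_ip_lie (f : 𝓢(ℝ, Mat n)) (z : Bd n) :
    Integrable fun x => ip (f x) ⁅ev z x, a⁆ := by
  simp only [ip_lie_right]
  exact (integrable_ip_ev (SchwartzMap.postcompCLM (lieL a) f) z).neg

theorem hasDerivAt_H (ha : a ∈ u n) (hd : a.IsDiag) (j : ℕ) {c : ℝ → Path a} {v : S a} {z : Bd n}
    {t : ℝ} (hc : HasCurveDeriv (fun s => Phi a (c s)) v Set.univ t)
    (hz : IsGauge (Phi a (c t)) v z) :
    HasDerivAt (fun s => H a j (c s))
      (∫ x, ip (qS a (Phi a (c t)).1 (j + 2) x) ⁅ev z x, a⁆) t := by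
  rw [← integral_ip_gauge hd hz]
  exact hasDerivAt_F ha hd j hc

theorem isGradient_H (ha : a ∈ u n) (hd : a.IsDiag) (j : ℕ) {γ : Path a} {g : ℝ → Mat n}
    (hg : IsFrame a γ (Phi a γ) g) :
    IsGradient (H a j) γ
      (fun x => g x * piPerp a (qS a (Phi a γ).1 (j + 2) x) * star (g x)) := by
  refine ⟨isTangent_of_S ha hd hg ⟨SchwartzMap.postcompCLM (offL a) (qS a (Phi a γ).1 (j + 2)),
    fun x => piPerp_mem hd (qS_mem ha hd _ _ x)⟩, ?_⟩
  rintro c η rfl hη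
  obtain ⟨v, z, hv, hz, rfl⟩ := hη.exists_gauge hd hg
  simp only [fun x => ip_conj (hg.unitary x), ip_piPerp_left, piPerp_lie hd]
  exact ⟨integrable_ip_lie _ z, hasDerivAt_H ha hd j hv hz⟩

theorem conj_mem_u {g y : Mat n} (hy : y ∈ u n) : g * y * star g ∈ u n := by
  rw [mem_u] at hy ⊢
  rw [star_mul, star_mul, star_star, hy]
  noncomm_ring

theorem conj_mem_perp {g y : Mat n} (hg : g ∈ Matrix.unitaryGroup (Fin n) ℂ) (hy : y ∈ perp a) :
    g * y * star g ∈ perp (g * a * star g) := by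
  refine ⟨conj_mem_u hy.1, fun z hz => ?_⟩
  have h1 : star g * z * g ∈ cent a := by
    refine ⟨by simpa using conj_mem_u (g := star g) hz.1, ?_⟩
    have h2 : star g * ⁅z, g * a * star g⁆ * g = ⁅star g * z * g, a⁆ := by
      have h3 : star g * (z * (g * a * star g) - g * a * star g * z) * g =
        star g * z * g * a * (star g * g) - star g * g * a * (star g * z * g) := by noncomm_ring
      rw [Ring.lie_def, h3, star_mul_of_unitary hg, mul_one, one_mul, Ring.lie_def]
    rw [← h2, hz.2, mul_zero, zero_mul]
  have h4 : g * (star g * z * g) * star g = z := by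
    have h5 : g * (star g * z * g) * star g = g * star g * z * (g * star g) := by noncomm_ring
    rw [h5, mul_star_of_unitary hg, one_mul, mul_one]
  rw [← h4, ip_conj hg]
  exact hy.2 _ h1

/-- `ad` and orthogonal complements are equivariant under unitary conjugation, so the orbit form at
`γ` reduces to the one at `a`; the sign comes from `[a, z] = -[z, a]`. -/
theorem adInv_conj (ha : a ∈ u n) (hd : a.IsDiag) {g y : Mat n}
    (hg : g ∈ Matrix.unitaryGroup (Fin n) ℂ) (hy : y ∈ perp a) :
    adInv (g * a * star g) (g * y * star g) = -(g * invL a y * star g) := by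
  have h1 : -(g * invL a y * star g) ∈ perp (g * a * star g) := by
    have h := conj_mem_perp hg (invL_mem ha hd hy.1)
    refine ⟨(u n).neg_mem h.1, fun z hz => ?_⟩
    have h0 := h.2 z hz
    simp only [ip, neg_mul, Matrix.trace_neg, Complex.neg_re] at h0 ⊢
    rw [h0, neg_zero]
  have h2 : ⁅g * a * star g, -(g * invL a y * star g)⁆ = g * y * star g := by
    have h3 : ⁅g * a * star g, -(g * invL a y * star g)⁆ =
        g * (invL a y * (star g * g) * a - a * (star g * g) * invL a y) * star g := by
      rw [Ring.lie_def]
      noncomm_ring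
    rw [h3, star_mul_of_unitary hg, mul_one, mul_one, ← Ring.lie_def, lie_invL hd,
      ((mem_perp_iff hd).1 hy).2]
  rw [← h2]
  exact adInv_lie h1

theorem tauDensity_conj (ha : a ∈ u n) (hd : a.IsDiag) {γ : Path a} {q : S a} {g : ℝ → Mat n}
    (hg : IsFrame a γ q g) {V W : ℝ → Mat n} {x : ℝ} (hV : V x ∈ perp a) :
    tauDensity γ (fun x => g x * V x * star (g x)) (fun x => g x * W x * star (g x)) x =
      ip (invL a (V x)) (W x) := by
  rw [tauDensity, hg.eq, adInv_conj ha hd (hg.unitary x) hV, neg_neg, ip_conj (hg.unitary x)]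

theorem exists_bump (n : ℕ) (x₀ : ℝ) : ∃ (χ : ℝ → ℝ) (β : 𝓢(ℝ, Mat n)), (∀ x, 0 ≤ χ x) ∧
    Continuous χ ∧ χ x₀ ≠ 0 ∧ ∀ x, β x = χ x • (1 : Mat n) := by
  let f : ContDiffBump x₀ := ⟨1, 2, one_pos, one_lt_two⟩
  have h : HasCompactSupport fun x => f x • (1 : Mat n) := f.hasCompactSupport.smul_right
  refine ⟨f, h.toSchwartzMap (f.contDiff.smul contDiff_const), fun x => f.nonneg, f.continuous, ?_,
    fun x => rfl⟩
  rw [f.one_of_mem_closedBall (Metric.mem_closedBall_self zero_le_one)]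
  exact one_ne_zero

theorem ev_map (L : Mat n →L[ℝ] Mat n) (b : Bd n) (x : ℝ) :
    ev (L b.1, SchwartzMap.postcompCLM L b.2) x = L (ev b x) :=
  congrFun (ev_eq (f := fun x => L (ev b x)) (b := (L b.1, SchwartzMap.postcompCLM L b.2))
    (fun x => L.hasFDerivAt.comp_hasDerivAt x (hasDerivAt_ev b x))
    ((L.continuous.tendsto _).comp (tendsto_ev b))) x

/-- For uniqueness, write the candidate as `g [ζ, a] g*`. Both candidates pair equally with all
velocities, so the off-diagonal part of `ζ - Q_{j+2}` must vanish. -/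
theorem isHamTau_iff (ha : a ∈ u n) (hd : a.IsDiag) (j : ℕ) {γ : Path a} {g : ℝ → Mat n}
    (hg : IsFrame a γ (Phi a γ) g) (X : ℝ → Mat n) :
    IsHamTau (H a j) γ X ↔
      X = fun x => g x * ⁅qS a (Phi a γ).1 (j + 2) x, a⁆ * star (g x) := by
  set f := qS a (Phi a γ).1 (j + 2) with hf
  have hfu : ∀ x, f x ∈ u n := qS_mem ha hd _ _
  constructor
  · rintro ⟨⟨c, rfl, hc⟩, h⟩
    obtain ⟨v, z, hv, hz, rfl⟩ := hc.exists_gauge hd hg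
    have hzu : ∀ x, ev z x ∈ u n := fun x => mem_u_of_star (hg.skew_gauge hz x)
    funext x₀
    -- `ζ - Q_{j+2}` need not decay at `+∞`, so its off-diagonal part `W` becomes an admissible test
    -- field only after a cut-off near `x₀`.
    obtain ⟨χ, β, hχ, hχc, hχ0, hβ⟩ := exists_bump n x₀
    set b : Bd n := z - toBd n f with hb
    have hbe : ∀ x, ev b x = ev z x - f x := fun x => by
      rw [hb, sub_eq_add_neg, ← neg_one_smul ℝ, ev_add, ev_smul, ev_toBd, neg_one_smul,
        sub_eq_add_neg]
    set W : Bd n := (offL a b.1, SchwartzMap.postcompCLM (offL a) b.2) with hW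
    have hWe : ∀ x, ev W x = piPerp a (ev z x - f x) := fun x => by
      rw [hW, ev_map, hbe, offL_apply]
    have hWp : ∀ x, ev W x ∈ perp a := fun x => by
      rw [hWe]
      exact piPerp_mem hd ((u n).sub_mem (hzu x) (hfu x))
    have hφ : ∀ x, lm n W β x = χ x • ev W x := fun x => by
      rw [lm_apply, hβ, mul_smul_comm, mul_one]
    have hφS : ∀ x, lm n W β x ∈ perp a := fun x => by
      rw [hφ, mem_perp_iff hd]
      refine ⟨(u n).smul_mem _ (hWp x).1, ?_⟩
      rw [← offL_apply, map_smul, offL_apply, ((mem_perp_iff hd).1 (hWp x)).2]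
    -- The field `χ W` is realized as a velocity, so the equality of pairings reads `∫ χ <W, W> =
    -- 0`.
    obtain ⟨v', z', hz', hzφ⟩ := exists_gauge_lie_eq ha hd (Phi a (c 0)) ⟨lm n W β, hφS⟩
    obtain ⟨c', hc'0, hc'⟩ := exists_curve hd (c 0) v'
    rw [← hc'0] at hz' hg
    obtain ⟨hi, h1⟩ := h c' _ hc'0 (hasVelocity_of_hasCurveDeriv hd hc' hg hz')
    have h2 := h1.unique (hasDerivAt_H ha hd j hc' hz')
    rw [hc'0] at h2 hg
    have hV : tauDensity (c 0) (fun x => g x * ⁅ev z x, a⁆ * star (g x))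
        (fun x => g x * ⁅ev z' x, a⁆ * star (g x)) = fun x => ip (ev z x) ⁅ev z' x, a⁆ :=
      funext fun x => by
      rw [tauDensity_conj ha hd hg (V := fun x => ⁅ev z x, a⁆) (lie_mem_perp ha hd (hzu x)),
        invL_lie hd, ip_piPerp_left, piPerp_lie hd]
    rw [tau, hV, ← hf] at h2
    rw [hV] at hi
    have hif : Integrable fun x => ip (f x) ⁅ev z' x, a⁆ := integrable_ip_lie f z'
    rw [← sub_eq_zero, ← integral_sub hi hif] at h2
    have hid := hi.sub hif
    have h3 : ∀ x, ip (ev z x) ⁅ev z' x, a⁆ - ip (f x) ⁅ev z' x, a⁆ =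
        χ x * ip (ev W x) (ev W x) := fun x => by
      rw [← ip_sub_left, hzφ]
      change ip _ (lm n W β x) = _
      rw [hφ]
      conv_lhs => rw [← ((mem_perp_iff hd).1 (hWp x)).2]
      rw [← offL_apply, ← map_smul, offL_apply, ← ip_piPerp_left, ← hWe]
      simp [ip]
    simp only [h3] at h2
    have hid' : Integrable fun x => χ x * ip (ev W x) (ev W x) := by
      simpa only [Pi.sub_def, h3] using hid
    have h4 := eq_zero_of_integral_ip_self (fun x => (hWp x).1)
      (continuous_iff_continuousAt.2 fun x => (hasDerivAt_ev W x).continuousAt) hχ hχc hid' h2 hχ0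
    rw [hWe, piPerp_eq_zero_iff hd] at h4
    have h5 : ⁅ev z x₀, a⁆ = ⁅f x₀, a⁆ := by
      rw [← sub_eq_zero, ← h4]
      simp only [Ring.lie_def]
      noncomm_ring
    simp only [h5]
  · rintro rfl
    obtain ⟨Y, hY⟩ := exists_lie_qS ha hd (Phi a γ) (j + 1)
    refine ⟨by simpa only [hY] using isTangent_of_S ha hd hg Y, ?_⟩
    rintro c η rfl hη
    obtain ⟨v, z, hv, hz, rfl⟩ := hη.exists_gauge hd hg
    have hV : tauDensity (c 0) (fun x => g x * ⁅f x, a⁆ * star (g x))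
        (fun x => g x * ⁅ev z x, a⁆ * star (g x)) = fun x => ip (f x) ⁅ev z x, a⁆ :=
      funext fun x => by
      rw [tauDensity_conj ha hd hg (V := fun x => ⁅f x, a⁆) (lie_mem_perp ha hd (hfu x)),
        invL_lie hd, ip_piPerp_left, piPerp_lie hd]
    rw [tau, hV]
    exact ⟨integrable_ip_lie f z, hasDerivAt_H ha hd j hv hz⟩

end PathSpace

/-! ### Correspondence of the flows under `Phi`. -/

section Flows

variable {n : ℕ} {a : Mat n}

/-- The recursion, read as the linearized gauge equation; this is why `dΦ` raises the index by one.
-/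
theorem isGauge_qS (hd : a.IsDiag) {q Y : S a} {j : ℕ}
    (hY : ∀ x, Y.1 x = ⁅qS a q.1 (j + 2) x, a⁆) : IsGauge q Y (toBd n (qS a q.1 (j + 1))) := by
  refine ⟨rfl, fun x => ?_⟩
  rw [hY, ev_toBd, ← qS_recursion hd, add_sub_cancel_right]
  rfl

/-- Injectivity of the linearized inverse of `Φ`, by the argument for uniqueness of frames: `β = ζ -
ζ'` is block diagonal, but `β_x = v - v' - [q, β]` is off-diagonal, so `β = 0`. -/
theorem IsGauge.eq_of_lie_eq (hd : a.IsDiag) {q v v' : S a} {z z' : Bd n} (hz : IsGauge q v z)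
    (hz' : IsGauge q v' z') (h : ∀ x, ⁅ev z x, a⁆ = ⁅ev z' x, a⁆) : v = v' := by
  set β : ℝ → Mat n := fun x => ev z x - ev z' x with hβ
  have hβa : ∀ x, ⁅β x, a⁆ = 0 := fun x => by
    rw [← sub_eq_zero.2 (h x)]
    simp only [hβ, Ring.lie_def]
    noncomm_ring
  have hβd : ∀ x, HasDerivAt β (z.2 x - z'.2 x) x := fun x =>
    (hasDerivAt_ev z x).sub (hasDerivAt_ev z' x)
  have hsnd : ∀ x, z.2 x - z'.2 x = v.1 x - v'.1 x - ⁅q.1 x, β x⁆ := fun x => by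
    rw [hz.snd, hz'.snd]
    simp only [hβ, Ring.lie_def]
    noncomm_ring
  have hβ' : ∀ x, piPerp a (z.2 x - z'.2 x) = 0 := fun x => by
    have h1 : HasDerivAt (fun x => offL a (β x)) (offL a (z.2 x - z'.2 x)) x :=
      (offL a).hasFDerivAt.comp_hasDerivAt x (hβd x)
    have h2 : (fun x => offL a (β x)) = fun _ => 0 := funext fun x =>
      (piPerp_eq_zero_iff hd).2 (hβa x)
    rw [h2] at h1
    exact h1.unique (hasDerivAt_const x 0)
  have hself : ∀ r : S a, ∀ x, piPerp a (r.1 x) = r.1 x := fun r x =>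
    ((mem_perp_iff hd).1 (r.2 x)).2
  have hβ0 : ∀ x, z.2 x - z'.2 x = 0 := fun x => by
    have h1 := hβ' x
    rwa [hsnd, piPerp_sub, piPerp_sub, hself, hself, piPerp_lie_left hd (hβa x), hself,
      ← hsnd] at h1
  have ht : Tendsto β atBot (𝓝 0) := by
    have h1 := (tendsto_ev z).sub (tendsto_ev z')
    rwa [hz.fst, hz'.fst, sub_zero] at h1
  have hβz : β = fun _ => 0 := eq_of_hasDerivAt_of_tendsto hβd
    (fun x => by rw [hβ0]; exact hasDerivAt_const x 0) ht tendsto_const_nhds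
  refine Subtype.ext (SchwartzMap.ext fun x => ?_)
  have h1 := hsnd x
  rw [hβ0, hβz, Ring.lie_def, mul_zero, zero_mul, sub_zero, sub_zero] at h1
  exact sub_eq_zero.1 h1.symm

theorem hasVelocity_iff (hd : a.IsDiag) {c : ℝ → Path a} {I : Set ℝ} {t : ℝ} {g : ℝ → Mat n}
    (hg : IsFrame a (c t) (Phi a (c t)) g) {Y : S a} {j : ℕ}
    (hY : ∀ x, Y.1 x = ⁅qS a (Phi a (c t)).1 (j + 2) x, a⁆) :
    HasVelocity c (fun x => g x * ⁅qS a (Phi a (c t)).1 (j + 1) x, a⁆ * star (g x)) I t ↔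
      HasCurveDeriv (fun s => Phi a (c s)) Y I t := by
  have hz := isGauge_qS hd hY
  constructor
  · intro h
    -- If `t` is not an accumulation point of `I`, the limit to be shown is vacuous.
    rcases (𝓝[I \ {t}] t).eq_or_neBot with hbot | hne
    · rw [HasCurveDeriv, hbot]
      exact tendsto_bot
    obtain ⟨v, z, hv, hz', he⟩ := h.exists_gauge hd hg
    rw [hz.eq_of_lie_eq hd hz' fun x => ?_]
    · exact hv
    · have h1 := congrArg (fun y => star (g x) * y * g x) (congrFun he x)
      have h2 : ∀ y, star (g x) * (g x * y * star (g x)) * g x = y := fun y => by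
        have h3 : star (g x) * (g x * y * star (g x)) * g x =
            star (g x) * g x * y * (star (g x) * g x) := by noncomm_ring
        rw [h3, star_mul_of_unitary (hg.unitary x), one_mul, mul_one]
      simp only [h2] at h1
      rw [ev_toBd]
      exact h1
  · intro h
    simpa only [ev_toBd] using hasVelocity_of_hasCurveDeriv hd h hg hz

theorem isHierarchyFlow_iff_isFlowW (ha : a ∈ u n) (hd : a.IsDiag) (j : ℕ) (c : ℝ → S a)
    (I : Set ℝ) : IsHierarchyFlow a j c I ↔ IsFlowW (F a j) c I := by
  refine forall₂_congr fun t _ => ?_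
  obtain ⟨Y, hY⟩ := exists_lie_qS ha hd (c t) j
  simp only [isHamW_iff ha hd j hY, Q_eq_qC ha hd, qC_succ, exists_eq_left]
  constructor
  · rintro ⟨Y', hY', h⟩
    rwa [show Y = Y' from Subtype.ext (SchwartzMap.ext fun x => (hY x).trans (hY' x).symm)]
  · exact fun h => ⟨Y, hY, h⟩

theorem isFlowTau_iff_isFlowW (ha : a ∈ u n) (hd : a.IsDiag) (j : ℕ) (c : ℝ → Path a)
    (I : Set ℝ) : IsFlowTau (H a j) c I ↔ IsFlowW (F a (j + 2)) (fun t => Phi a (c t)) I := by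
  refine forall₂_congr fun t _ => ?_
  obtain ⟨Y, hY⟩ := exists_lie_qS ha hd (Phi a (c t)) (j + 2)
  obtain ⟨g, hg⟩ := isFrame_Phi hd (c t)
  simp only [isHamW_iff ha hd (j + 2) hY, isHamTau_iff ha hd j hg, exists_eq_left]
  exact hasVelocity_iff hd hg hY

end Flows

end SchrodingerFlow

end

/-! ### The main theorem. -/

open SchrodingerFlow in
theorem corollary4p3 (n : ℕ) (a : Mat n) (ha : a ∈ SchrodingerFlow.u n) (hd : a.IsDiag) :
    -- the development map is a well-defined bijection, the sequence `Q_j(q)` is well defined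
    (∀ γ : Path a, ∃! p : S a × (ℝ → Mat n), IsFrame a γ p.1 p.2) ∧
    Function.Bijective (Phi a) ∧
    (∀ q : S a, ∃! Qs : ℕ → ℝ → Mat n, IsQSeq a q Qs) ∧
    ∀ j : ℕ,
      -- `F_j` is given by a convergent integral
      (∀ q : S a, Integrable (fun x => ip (Q a q (j + 2) x) a)) ∧
      -- gradient and Hamiltonian vector field of `H_j` with respect to `τ̂`
      (∀ (γ : Path a) (g : ℝ → Mat n), IsFrame a γ (Phi a γ) g →
        IsGradient (H a j) γ (fun x => g x * piPerp a (Q a (Phi a γ) (j + 2) x) * star (g x)) ∧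
        ∀ X : ℝ → Mat n, IsHamTau (H a j) γ X ↔
          X = fun x => g x * ⁅Q a (Phi a γ) (j + 2) x, a⁆ * star (g x)) ∧
      -- the Hamiltonian vector field of `F_{j+2}` with respect to `w` is `[Q_{j+3}, a]`
      (∀ q : S a, ∃ Y : S a, (∀ x, Y.1 x = ⁅Q a q (j + 3) x, a⁆) ∧
        ∀ X : S a, IsHamW (F a (j + 2)) q X ↔ X = Y) ∧
      -- `dΦ` maps the Hamiltonian vector field of `H_j` to that of `F_{j+2}`
      (∀ (γ : Path a) (X : ℝ → Mat n) (Y : S a),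
        IsHamTau (H a j) γ X → IsHamW (F a (j + 2)) (Phi a γ) Y →
        ∀ c : ℝ → Path a, c 0 = γ → HasVelocity c X Set.univ 0 →
          HasCurveDeriv (fun s => Phi a (c s)) Y Set.univ 0) ∧
      -- `Φ` maps the Hamiltonian flow of `H_j` to the `(j+2)`-th flow, the one of `F_{j+2}`
      (∀ I : Set ℝ, I.OrdConnected →
        (∀ c : ℝ → S a, IsHierarchyFlow a (j + 2) c I ↔ IsFlowW (F a (j + 2)) c I) ∧
        ∀ c : ℝ → Path a,
          (IsFlowTau (H a j) c I ↔ IsFlowW (F a (j + 2)) (fun t => Phi a (c t)) I) ∧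
          (IsFlowTau (H a j) c I ↔ IsHierarchyFlow a (j + 2) (fun t => Phi a (c t)) I)) := by
  -- All indices in the claims are positive, so the Schwartz representatives `qS` may be used
  -- throughout.
  have hQ : ∀ (q : S a) (k : ℕ) (x : ℝ), Q a q (k + 1) x = qS a q.1 (k + 1) x := fun q k x => by
    rw [Q_eq_qC ha hd, qC_succ]
  simp only [hQ]
  refine ⟨existsUnique_frame hd, bijective_Phi hd, existsUnique_QSeq ha hd, fun j =>
    ⟨fun q => integrable_ip_const _ a,
      fun γ g hg => ⟨isGradient_H ha hd j hg, isHamTau_iff ha hd j hg⟩, fun q => ?_, ?_,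
      fun I _ => ⟨fun c => isHierarchyFlow_iff_isFlowW ha hd (j + 2) c I, fun c =>
        ⟨isFlowTau_iff_isFlowW ha hd j c I, (isFlowTau_iff_isFlowW ha hd j c I).trans
          (isHierarchyFlow_iff_isFlowW ha hd (j + 2) _ I).symm⟩⟩⟩⟩
  · obtain ⟨Y, hY⟩ := exists_lie_qS ha hd q (j + 2)
    exact ⟨Y, hY, isHamW_iff ha hd (j + 2) hY⟩
  · rintro γ X Y hX hYw c rfl hc
    obtain ⟨g, hg⟩ := isFrame_Phi hd (c 0)
    obtain ⟨Y', hY'⟩ := exists_lie_qS ha hd (Phi a (c 0)) (j + 2)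
    rw [(isHamW_iff ha hd (j + 2) hY' Y).1 hYw]
    rw [(isHamTau_iff ha hd j hg X).1 hX] at hc
    exact (hasVelocity_iff hd hg hY').1 hc
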